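/- Let $M$ be a smooth manifold (finite-dimensional, Hausdorff, second countable, without boundary) and let $\pi:E\to M$ be a smooth real vector bundle of finite rank. Let $\mathcal M=\Pi E$ be the supermanifold $(M,\mathcal O_{\mathcal M})$ with $\mathcal O_{\mathcal M}=\Gamma_{\Lambda E^*}$, and let $\mathcal T_{\mathcal M}=\mathcal T_{\mathcal M,\bar 0}\oplus\mathcal T_{\mathcal M,\bar 1}$ be its sheaf of superderivations. Let $\mathcal T_E$ be the sheaf of derivations of $\mathcal C^\infty_E$. An even (resp. odd) Riemannian metric on $\mathcal M$ is a morphism of sheaves $g:\mathcal T_{\mathcal M}\otimes_{\mathcal O_{\mathcal M}}\mathcal T_{\mathcal M}\to\mathcal O_{\mathcal M}$ of parity $|g|=0$ (resp. $|g|=1$) which is $\mathcal O_{\mathcal M}$-linear, i.e. $g(fX,Y)=(-1)^{|g||f|}f\,g(X,Y)$ and $g(X,fY)=(-1)^{|f|(|g|+|X|)}f\,g(X,Y)$ for homogeneous arguments, supersymmetric, i.e. $g(X,Y)=(-1)^{|X||Y|}g(Y,X)$, and non-degenerate, i.e. $X\mapsto g(X,\cdot)$ is an isomorphism of sheaves from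 $\mathcal T_{\mathcal M}$ onto $\Omega^1_{\mathcal M}=\mathcal Hom_{\mathcal O_{\mathcal M}}(\mathcal T_{\mathcal M},\mathcal O_{\mathcal M})$ (resp. $\Pi\Omega^1_{\mathcal M}$). For $U\subset M$ open let $\mathcal F(U)=\Gamma_{\mathbb R\oplus E^*}(U)\subset\mathcal O_{\mathcal M}(U)$, let $\mathrm{pr}:\mathcal O_{\mathcal M}\to\mathcal F$ be the projection along the components of degree at least two, and let $$\psi:\mathcal F(U)\to\mathcal C^\infty_E(\pi^{-1}(U)),\qquad \psi(s_{\bar 0}+s_{\bar 1})(e)=s_{\bar 0}(\pi(e))+s_{\bar 1}(\pi(e))(e),$$ where $s_{\bar 0}$ and $s_{\bar 1}$ are the components of degree $0$ and $1$. Let $\mathcal L(U)$ be the set of all $X\in\mathcal T_{\mathcal M}(U)$ that map $\mathcal F$ to $\mathcal F$ on all open subsets of $U$. For a homogeneous $X\in\mathcal L(U)$ and $X'\in\mathcal T_E(\pi^{-1}(U))$ write $X'=\Psi(X)$ if $X'(\psi(s))=\psi(X(s))$ for all $s\in\mathcal F(V)$ and all open $V\subset U$. Let $g$ be an even or odd Riemannian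 metric on $\mathcal M$. Then there is exactly one $\mathcal C^\infty_E$-bilinear morphism of sheaves $g^{TE}:\mathcal T_E\otimes_{\mathcal C^\infty_E}\mathcal T_E\to\mathcal C^\infty_E$ such that $$g^{TE}(X',Y')=\psi\big(\mathrm{pr}\,(g(X,Y))\big)$$ for all open $U\subset M$, all even $X,Y\in\mathcal L(U)$ and all $X',Y'\in\mathcal T_E(\pi^{-1}(U))$ with $X'=\Psi(X)$, $Y'=\Psi(Y)$. The form $g^{TE}$ is symmetric. Moreover, if $X,Y\in\mathcal L(U)$ are homogeneous of arbitrary parities, $X'=\Psi(X)$, $Y'=\Psi(Y)$, and $h,k\in\mathcal F(U)$ are homogeneous with $|h|=|X|$, $|k|=|Y|$, then $hX,kY$ are even elements of $\mathcal L(U)$, $\psi(h)X'=\Psi(hX)$, $\psi(k)Y'=\Psi(kY)$, and $$\psi(h)\,\psi(k)\,g^{TE}(X',Y')=\psi\big(\mathrm{pr}\,(g(hX,kY))\big).$$ -/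

import Mathlib

open TopologicalSpace Bundle
open scoped Manifold ContDiff

noncomputable section

namespace SuperReduction

/-! ### Smooth functions and the sheaf of derivations of a classical manifold -/

section Classical

variable {EN : Type*} [NormedAddCommGroup EN] [NormedSpace ℝ EN]
  {HN : Type*} [TopologicalSpace HN] (J : ModelWithCorners ℝ EN HN)
  {N : Type*} [TopologicalSpace N] [ChartedSpace HN N]

/-- The algebra of smooth real functions on an open subset `V` of the manifold `N`. -/
abbrev Smooth (V : Opens N) : Type _ := ContMDiffMap J 𝓘(ℝ, ℝ) V ℝ ∞

/-- Restriction of smooth functions to a smaller open set. -/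
def resSmooth {V W : Opens N} (h : W ≤ V) : Smooth J V →+* Smooth J W :=
  ContMDiffMap.restrictRingHom J 𝓘(ℝ, ℝ) ℝ h

/-- A section over the open set `V` of the sheaf of derivations of the sheaf of smooth functions:
a derivation of the smooth functions on every open `W ≤ V`, compatible with restrictions. -/
@[ext]
structure DerSection (V : Opens N) where
  act : ∀ W : Opens N, W ≤ V → Derivation ℝ (Smooth J W) (Smooth J W)
  act_res : ∀ (W W' : Opens N) (hW : W ≤ V) (h : W' ≤ W) (f : Smooth J W),
    resSmooth J h (act W hW f) = act W' (h.trans hW) (resSmooth J h f)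

variable {J}

/-- Restriction of a derivation to a smaller open set. -/
def DerSection.res {V V' : Opens N} (h : V' ≤ V) (X : DerSection J V) : DerSection J V' where
  act W hW := X.act W (hW.trans h)
  act_res W W' hW h' f := X.act_res W W' (hW.trans h) h' f

instance {V : Opens N} : Add (DerSection J V) where
  add X Y :=
    { act := fun W hW => X.act W hW + Y.act W hW
      act_res := fun W W' hW h f => by
        simp only [Derivation.add_apply, map_add, X.act_res W W' hW h f, Y.act_res W W' hW h f] }

/-- Multiplication of a derivation by a smooth function. -/
instance {V : Opens N} : SMul (Smooth J V) (DerSection J V) where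
  smul f X :=
    { act := fun W hW => resSmooth J hW f • X.act W hW
      act_res := fun W W' hW h k => by
        simp only [Derivation.smul_apply, smul_eq_mul, map_mul, X.act_res W W' hW h k]
        rfl }

variable (J N) in
/-- A bilinear form on the manifold `N`: a morphism of sheaves from the tensor square of the
sheaf of derivations to the sheaf of smooth functions, linear over smooth functions in each
argument. -/
@[ext]
structure BilinearForm where
  val : ∀ V : Opens N, DerSection J V → DerSection J V → Smooth J V
  res : ∀ (V V' : Opens N) (h : V' ≤ V) (X Y : DerSection J V),
    resSmooth J h (val V X Y) = val V' (X.res h) (Y.res h)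
  add_left : ∀ (V : Opens N) (X X' Y : DerSection J V), val V (X + X') Y = val V X Y + val V X' Y
  add_right : ∀ (V : Opens N) (X Y Y' : DerSection J V), val V X (Y + Y') = val V X Y + val V X Y'
  smul_left : ∀ (V : Opens N) (f : Smooth J V) (X Y : DerSection J V),
    val V (f • X) Y = f * val V X Y
  smul_right : ∀ (V : Opens N) (f : Smooth J V) (X Y : DerSection J V),
    val V X (f • Y) = f * val V X Y

/-- Symmetry of a bilinear form. -/
def BilinearForm.IsSymm (B : BilinearForm J N) : Prop :=
  ∀ (V : Opens N) (X Y : DerSection J V), B.val V X Y = B.val V Y X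

end Classical

/-! ### Signs and the exterior algebra -/

/-- The sign `(-1) ^ a` for a parity `a`. -/
def sgn (a : ZMod 2) : ℝ := if a = 0 then 1 else -1

theorem sgn_mul_sgn (a b : ZMod 2) : sgn a * sgn b = sgn (a + b) := by
  have h : ∀ a : ZMod 2, a = 0 ∨ a = 1 := by decide
  have h2 : (1 : ZMod 2) + 1 = 0 := by decide
  rcases h a with rfl | rfl <;> rcases h b with rfl | rfl <;> simp [sgn, h2]

section Exterior

variable {A : Type*} [AddCommGroup A] [Module ℝ A]

/-- The part of parity `c` of the exterior algebra: the sum of the exterior powers whose degree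
has parity `c`. -/
abbrev extParity (A : Type*) [AddCommGroup A] [Module ℝ A] (c : ZMod 2) :
    Submodule ℝ (ExteriorAlgebra ℝ A) :=
  CliffordAlgebra.evenOdd (0 : QuadraticForm ℝ A) c

/-- The projection of the exterior algebra to its part of degree `0` and `1`. -/
def extPr : ExteriorAlgebra ℝ A →ₗ[ℝ] ExteriorAlgebra ℝ A :=
  (Algebra.linearMap ℝ (ExteriorAlgebra ℝ A)).comp
      (ExteriorAlgebra.algebraMapInv (R := ℝ) (M := A)).toLinearMap +
    (ExteriorAlgebra.ι ℝ).comp ExteriorAlgebra.ιInv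

theorem map_extPr {A' : Type*} [AddCommGroup A'] [Module ℝ A'] (f : A →ₗ[ℝ] A')
    (u : ExteriorAlgebra ℝ A) :
    ExteriorAlgebra.map f (extPr u) = extPr (ExteriorAlgebra.map f u) := by
  have h1 : ExteriorAlgebra.algebraMapInv (ExteriorAlgebra.map f u) =
      ExteriorAlgebra.algebraMapInv u := by
    have : (ExteriorAlgebra.algebraMapInv (R := ℝ) (M := A')).comp (ExteriorAlgebra.map f) =
        ExteriorAlgebra.algebraMapInv := by
      apply ExteriorAlgebra.hom_ext
      ext x
      simp [ExteriorAlgebra.algebraMapInv]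
    exact DFunLike.congr_fun this u
  have h2 : ExteriorAlgebra.ιInv (ExteriorAlgebra.map f u) = f (ExteriorAlgebra.ιInv u) :=
    DFunLike.congr_fun (ExteriorAlgebra.ιInv_comp_map f) u
  simp [extPr, h1, h2]

/-- Graded commutativity of the exterior algebra. -/
theorem ext_graded_comm {c d : ZMod 2} {u v : ExteriorAlgebra ℝ A}
    (hu : u ∈ extParity A c) (hv : v ∈ extParity A d) : u * v = sgn (c * d) • (v * u) := by
  have hz : ∀ e : ZMod 2, e = 0 ∨ e = 1 := by decide
  have hι : ∀ (m : A) (e : ZMod 2) (w : ExteriorAlgebra ℝ A), w ∈ extParity A e →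
      ExteriorAlgebra.ι ℝ m * w = sgn e • (w * ExteriorAlgebra.ι ℝ m) := by
    intro m e w hw
    have hmm : ∀ a b : A, ExteriorAlgebra.ι ℝ a * ExteriorAlgebra.ι ℝ b =
        -(ExteriorAlgebra.ι ℝ b * ExteriorAlgebra.ι ℝ a) := fun a b =>
      eq_neg_of_add_eq_zero_left (ExteriorAlgebra.ι_add_mul_swap a b)
    refine CliffordAlgebra.evenOdd_induction (0 : QuadraticForm ℝ A) e
      (motive := fun w _ => ExteriorAlgebra.ι ℝ m * w = sgn e • (w * ExteriorAlgebra.ι ℝ m))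
      ?_ ?_ ?_ w hw
    · intro v hv
      rcases hz e with rfl | rfl
      · obtain ⟨r, rfl⟩ := Submodule.mem_one.mp (by rwa [ZMod.val_zero, pow_zero] at hv)
        have := (Algebra.commutes r (ExteriorAlgebra.ι ℝ m)).symm
        simpa [sgn] using this
      · rw [ZMod.val_one, pow_one] at hv
        obtain ⟨a, rfl⟩ := hv
        have := hmm m a
        simpa only [sgn, one_ne_zero, if_false, neg_smul, one_smul] using this
    · intro x y _ _ hx hy
      rw [mul_add, add_mul, smul_add, hx, hy]
    · intro a b x _ hx
      change ExteriorAlgebra.ι ℝ m * (ExteriorAlgebra.ι ℝ a * ExteriorAlgebra.ι ℝ b * x) =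
        sgn e • (ExteriorAlgebra.ι ℝ a * ExteriorAlgebra.ι ℝ b * x * ExteriorAlgebra.ι ℝ m)
      calc ExteriorAlgebra.ι ℝ m * (ExteriorAlgebra.ι ℝ a * ExteriorAlgebra.ι ℝ b * x)
          = (ExteriorAlgebra.ι ℝ m * ExteriorAlgebra.ι ℝ a) * ExteriorAlgebra.ι ℝ b * x := by
            simp only [mul_assoc]
        _ = -(ExteriorAlgebra.ι ℝ a * (ExteriorAlgebra.ι ℝ m * ExteriorAlgebra.ι ℝ b) * x) := by
            rw [hmm m a]; simp only [neg_mul, mul_assoc]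
        _ = ExteriorAlgebra.ι ℝ a * ExteriorAlgebra.ι ℝ b * (ExteriorAlgebra.ι ℝ m * x) := by
            rw [hmm m b]; simp only [neg_mul, mul_neg, neg_neg, mul_assoc]
        _ = _ := by rw [hx]; simp only [mul_smul_comm, mul_assoc]
  refine CliffordAlgebra.evenOdd_induction (0 : QuadraticForm ℝ A) c
    (motive := fun u _ => u * v = sgn (c * d) • (v * u)) ?_ ?_ ?_ u hu
  · intro w hw
    rcases hz c with rfl | rfl
    · obtain ⟨r, rfl⟩ := Submodule.mem_one.mp (by rwa [ZMod.val_zero, pow_zero] at hw)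
      have := Algebra.commutes r v
      simpa [sgn] using this
    · rw [ZMod.val_one, pow_one] at hw
      obtain ⟨a, rfl⟩ := hw
      have := hι a d v hv
      simpa only [one_mul] using this
  · intro x y _ _ hx hy
    rw [mul_add, add_mul, smul_add, hx, hy]
  · intro a b x _ hx
    change ExteriorAlgebra.ι ℝ a * ExteriorAlgebra.ι ℝ b * x * v =
      sgn (c * d) • (v * (ExteriorAlgebra.ι ℝ a * ExteriorAlgebra.ι ℝ b * x))
    have h3 : ExteriorAlgebra.ι ℝ a * ExteriorAlgebra.ι ℝ b * v =
        v * (ExteriorAlgebra.ι ℝ a * ExteriorAlgebra.ι ℝ b) := by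
      have hs : sgn d * sgn d = 1 := by
        unfold sgn; split_ifs <;> norm_num
      rw [mul_assoc, hι b d v hv, mul_smul_comm, ← mul_assoc, hι a d v hv, smul_mul_assoc,
        smul_smul, hs, one_smul, mul_assoc]
    rw [mul_assoc, hx, mul_smul_comm, ← mul_assoc, h3, mul_assoc]

end Exterior

/-! ### The supermanifold `ΠE` -/

section Super

variable (H : Type*) [NormedAddCommGroup H] [NormedSpace ℝ H]
  {M : Type*} [TopologicalSpace M] [ChartedSpace H M]
  (F : Type*) [NormedAddCommGroup F] [NormedSpace ℝ F] [FiniteDimensional ℝ F]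
  (E : M → Type*) [TopologicalSpace (TotalSpace F E)]
  [∀ x, AddCommGroup (E x)] [∀ x, Module ℝ (E x)] [∀ x, TopologicalSpace (E x)]
  [FiberBundle F E] [VectorBundle ℝ F E]

/-- The fibre at `x` of the bundle of exterior algebras of the dual bundle of `E`. -/
abbrev ExtFib (x : M) : Type _ := ExteriorAlgebra ℝ (Module.Dual ℝ (E x))

/-- The identification of `Λ(E x)*` with `ΛF*` by the local trivialization of `E` around `x₀`;
it is an isomorphism for `x` in the domain of that trivialization. -/
def localRep (x₀ x : M) : ExtFib E x →ₐ[ℝ] ExteriorAlgebra ℝ (Module.Dual ℝ F) :=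
  ExteriorAlgebra.map ((trivializationAt F E x₀).symmₗ ℝ x).dualMap

/-- Smoothness of a section of `ΛE*` over `U`: near every point of `U`, all coefficients of the
section in a local trivialization of `E` around that point are smooth. -/
def IsSmoothSection {U : Opens M} (s : ∀ x : U, ExtFib E x) : Prop :=
  ∀ (x₀ : U) (l : Module.Dual ℝ (ExteriorAlgebra ℝ (Module.Dual ℝ F))),
    ContMDiffAt 𝓘(ℝ, H) 𝓘(ℝ, ℝ) ∞ (fun x : U => l (localRep F E x₀ x (s x))) x₀

instance : Module.Finite ℝ (ExteriorAlgebra ℝ (Module.Dual ℝ F)) :=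
  Module.Finite.of_basis (Module.finBasis ℝ (Module.Dual ℝ F)).ExteriorAlgebra

theorem IsSmoothSection.mul {U : Opens M} {s t : ∀ x : U, ExtFib E x}
    (hs : IsSmoothSection H F E s) (ht : IsSmoothSection H F E t) :
    IsSmoothSection H F E (s * t) := by
  intro x₀ l
  let b := Module.finBasis ℝ (ExteriorAlgebra ℝ (Module.Dual ℝ F))
  have key : (fun x : U => l (localRep F E x₀ x ((s * t) x))) = fun x : U =>
      ∑ i, ∑ j, b.coord i (localRep F E x₀ x (s x)) *
        (b.coord j (localRep F E x₀ x (t x)) * l (b i * b j)) := by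
    funext x
    rw [Pi.mul_apply, map_mul]
    conv_lhs => rw [← b.sum_repr (localRep F E x₀ x (s x)), ← b.sum_repr (localRep F E x₀ x (t x))]
    simp only [Finset.sum_mul_sum, map_sum, smul_mul_smul_comm, map_smul, smul_eq_mul,
      Module.Basis.coord_apply, mul_assoc]
  rw [key]
  refine ContMDiffAt.sum fun i _ => ContMDiffAt.sum fun j _ => ?_
  exact (hs x₀ _).mul ((ht x₀ _).mul contMDiffAt_const)

/-- The superfunctions on `U`: the algebra of smooth sections over `U` of the exterior algebra
bundle of the dual of `E`. -/
def SuperFun (U : Opens M) : Subalgebra ℝ (∀ x : U, ExtFib E x) where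
  carrier := {s | IsSmoothSection H F E s}
  mul_mem' hs ht := IsSmoothSection.mul H F E hs ht
  add_mem' hs ht x₀ l := by
    simp only [Pi.add_apply, map_add]
    exact (hs x₀ l).add (ht x₀ l)
  algebraMap_mem' r x₀ l := by
    simp only [Pi.algebraMap_apply, AlgHom.commutes]
    exact contMDiffAt_const

/-- Restriction of superfunctions. -/
def resSuper {U V : Opens M} (h : V ≤ U) : SuperFun H F E U →ₐ[ℝ] SuperFun H F E V where
  toFun s := ⟨fun x => s.1 ⟨x.1, h x.2⟩, fun x₀ l =>
    ContMDiffAt.comp (I' := 𝓘(ℝ, H)) (g := fun x : U => l (localRep F E x₀ x (s.1 x)))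
      (f := Opens.inclusion h) x₀ (s.2 (Opens.inclusion h x₀) l)
      (contMDiff_inclusion h).contMDiffAt⟩
  map_one' := rfl
  map_mul' _ _ := rfl
  map_zero' := rfl
  map_add' _ _ := rfl
  commutes' _ := rfl

/-- The homogeneous superfunctions of parity `c`. -/
def superParity (c : ZMod 2) (U : Opens M) : Submodule ℝ (SuperFun H F E U) where
  carrier := {s | ∀ x : U, s.1 x ∈ extParity (Module.Dual ℝ (E x)) c}
  add_mem' hs ht x := Submodule.add_mem _ (hs x) (ht x)
  zero_mem' _ := Submodule.zero_mem _
  smul_mem' r _ hs x := Submodule.smul_mem _ r (hs x)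

variable {H F E}

theorem superParity_mul {c d : ZMod 2} {U : Opens M} {s t : SuperFun H F E U}
    (hs : s ∈ superParity H F E c U) (ht : t ∈ superParity H F E d U) :
    s * t ∈ superParity H F E (c + d) U := fun x =>
  SetLike.mul_mem_graded (hs x) (ht x)

theorem superParity_res {c : ZMod 2} {U V : Opens M} (h : V ≤ U) {s : SuperFun H F E U}
    (hs : s ∈ superParity H F E c U) : resSuper H F E h s ∈ superParity H F E c V :=
  fun x => hs ⟨x.1, h x.2⟩

theorem superFun_graded_comm {c d : ZMod 2} {U : Opens M} {s t : SuperFun H F E U}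
    (hs : s ∈ superParity H F E c U) (ht : t ∈ superParity H F E d U) :
    s * t = sgn (c * d) • (t * s) :=
  Subtype.ext (funext fun x => ext_graded_comm (hs x) (ht x))

variable (H F E) in
/-- The homogeneous sections of parity `a` over `U` of the sheaf of superderivations. The module
of all superderivations over `U` is the direct sum of those of parity `0` and of parity `1`. -/
@[ext]
structure SuperDer (a : ZMod 2) (U : Opens M) where
  act : ∀ V : Opens M, V ≤ U → SuperFun H F E V →ₗ[ℝ] SuperFun H F E V
  act_res : ∀ (V W : Opens M) (hV : V ≤ U) (h : W ≤ V) (s : SuperFun H F E V),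
    resSuper H F E h (act V hV s) = act W (h.trans hV) (resSuper H F E h s)
  parity : ∀ (V : Opens M) (hV : V ≤ U) (c : ZMod 2) (s : SuperFun H F E V),
    s ∈ superParity H F E c V → act V hV s ∈ superParity H F E (a + c) V
  leibniz : ∀ (V : Opens M) (hV : V ≤ U) (c : ZMod 2) (s t : SuperFun H F E V),
    s ∈ superParity H F E c V → act V hV (s * t) = act V hV s * t + sgn (a * c) • (s * act V hV t)

namespace SuperDer

/-- Restriction of a superderivation to a smaller open set. -/
def res {a : ZMod 2} {U U' : Opens M} (h : U' ≤ U) (X : SuperDer H F E a U) :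
    SuperDer H F E a U' where
  act V hV := X.act V (hV.trans h)
  act_res V W hV h' s := X.act_res V W (hV.trans h) h' s
  parity V hV c s hs := X.parity V (hV.trans h) c s hs
  leibniz V hV c s t hs := X.leibniz V (hV.trans h) c s t hs

instance {a : ZMod 2} {U : Opens M} : Add (SuperDer H F E a U) where
  add X Y :=
    { act := fun V hV => X.act V hV + Y.act V hV
      act_res := fun V W hV h s => by
        simp only [LinearMap.add_apply, map_add, X.act_res V W hV h s, Y.act_res V W hV h s]
      parity := fun V hV c s hs =>
        Submodule.add_mem _ (X.parity V hV c s hs) (Y.parity V hV c s hs)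
      leibniz := fun V hV c s t hs => by
        simp only [LinearMap.add_apply, X.leibniz V hV c s t hs, Y.leibniz V hV c s t hs,
          add_mul, mul_add, smul_add]
        abel }

/-- Left multiplication of a superderivation of parity `a` by a superfunction `f` of parity `c`.
The parity of the product is called `d`, with a proof of `c + a = d`. -/
def lsmul {a c d : ZMod 2} (hd : c + a = d) {U : Opens M} (f : superParity H F E c U)
    (X : SuperDer H F E a U) : SuperDer H F E d U where
  act V hV := (LinearMap.mulLeft ℝ (resSuper H F E hV f.1)).comp (X.act V hV)
  act_res V W hV h s := by
    simp only [LinearMap.comp_apply, LinearMap.mulLeft_apply, map_mul, X.act_res V W hV h s]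
    rfl
  parity V hV e s hs := by
    have := superParity_mul (superParity_res hV f.2) (X.parity V hV e s hs)
    rw [← add_assoc, hd] at this
    exact this
  leibniz V hV e s t hs := by
    subst hd
    have hf := superParity_res hV f.2
    simp only [LinearMap.comp_apply, LinearMap.mulLeft_apply, X.leibniz V hV e s t hs, mul_add,
      mul_assoc, mul_smul_comm]
    rw [← mul_assoc _ s, superFun_graded_comm hf hs, smul_mul_assoc, smul_smul, sgn_mul_sgn,
      mul_assoc, add_mul, add_comm (a * e)]

end SuperDer

variable (H F E) in
/-- A homogeneous superform of degree one and parity `q` over `U`: a section of parity `q` over `U`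
of the dual of the sheaf of superderivations. -/
structure OneForm (q : ZMod 2) (U : Opens M) where
  val : ∀ (V : Opens M), V ≤ U → ∀ a : ZMod 2, SuperDer H F E a V → SuperFun H F E V
  res : ∀ (V W : Opens M) (hV : V ≤ U) (h : W ≤ V) (a : ZMod 2) (X : SuperDer H F E a V),
    resSuper H F E h (val V hV a X) = val W (h.trans hV) a (X.res h)
  parity : ∀ (V : Opens M) (hV : V ≤ U) (a : ZMod 2) (X : SuperDer H F E a V),
    val V hV a X ∈ superParity H F E (q + a) V
  add : ∀ (V : Opens M) (hV : V ≤ U) (a : ZMod 2) (X Y : SuperDer H F E a V),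
    val V hV a (X + Y) = val V hV a X + val V hV a Y
  lsmul : ∀ (V : Opens M) (hV : V ≤ U) (a c d : ZMod 2) (hd : c + a = d)
    (f : superParity H F E c V) (X : SuperDer H F E a V),
    val V hV d (SuperDer.lsmul hd f X) = sgn (q * c) • (f.1 * val V hV a X)

variable (H F E) in
/-- A Riemannian metric of parity `p` on the supermanifold `ΠE`: a morphism `g` of parity `p` from
the tensor square of the sheaf of superderivations to the sheaf of superfunctions, given by its
values on homogeneous superderivations, linear over the superfunctions (with the sign rule),
supersymmetric, and such that `X ↦ g(X, ·)` is a bijection (shifting the parity by `p`) from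
superderivations onto superforms of degree one over every open set. -/
structure RiemannianMetric (p : ZMod 2) where
  val : ∀ (U : Opens M) (a b : ZMod 2), SuperDer H F E a U → SuperDer H F E b U → SuperFun H F E U
  res : ∀ (U V : Opens M) (h : V ≤ U) (a b : ZMod 2) (X : SuperDer H F E a U)
    (Y : SuperDer H F E b U),
    resSuper H F E h (val U a b X Y) = val V a b (X.res h) (Y.res h)
  parity : ∀ (U : Opens M) (a b : ZMod 2) (X : SuperDer H F E a U) (Y : SuperDer H F E b U),
    val U a b X Y ∈ superParity H F E (p + a + b) U
  add_left : ∀ (U : Opens M) (a b : ZMod 2) (X X' : SuperDer H F E a U) (Y : SuperDer H F E b U),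
    val U a b (X + X') Y = val U a b X Y + val U a b X' Y
  add_right : ∀ (U : Opens M) (a b : ZMod 2) (X : SuperDer H F E a U) (Y Y' : SuperDer H F E b U),
    val U a b X (Y + Y') = val U a b X Y + val U a b X Y'
  lsmul_left : ∀ (U : Opens M) (a b c d : ZMod 2) (hd : c + a = d) (f : superParity H F E c U)
    (X : SuperDer H F E a U) (Y : SuperDer H F E b U),
    val U d b (SuperDer.lsmul hd f X) Y = sgn (p * c) • (f.1 * val U a b X Y)
  lsmul_right : ∀ (U : Opens M) (a b c d : ZMod 2) (hd : c + b = d) (f : superParity H F E c U)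
    (X : SuperDer H F E a U) (Y : SuperDer H F E b U),
    val U a d X (SuperDer.lsmul hd f Y) = sgn ((p + a) * c) • (f.1 * val U a b X Y)
  supersymm : ∀ (U : Opens M) (a b : ZMod 2) (X : SuperDer H F E a U) (Y : SuperDer H F E b U),
    val U a b X Y = sgn (a * b) • val U b a Y X
  nondegenerate : ∀ (U : Opens M) (q : ZMod 2) (φ : OneForm H F E q U),
    ∃! X : SuperDer H F E (p + q) U,
      ∀ (V : Opens M) (hV : V ≤ U) (a : ZMod 2) (Y : SuperDer H F E a V),
        val V (p + q) a (X.res hV) Y = φ.val V hV a Y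

/-! ### The transport from `ΠE` to `E` -/

variable (H F E) in
/-- The superfunctions of degree at most one: smooth sections of `ℝ ⊕ E*`. -/
def AffineSuper (U : Opens M) : Set (SuperFun H F E U) :=
  {s | ∀ x : U, ∃ (r : ℝ) (w : Module.Dual ℝ (E x)),
    s.1 x = algebraMap ℝ (ExtFib E x) r + ExteriorAlgebra.ι ℝ w}

/-- The projection of superfunctions to those of degree at most one. -/
def pr {U : Opens M} (s : SuperFun H F E U) : SuperFun H F E U :=
  ⟨fun x => extPr (s.1 x), fun x₀ l => by
    simp only [localRep, map_extPr]
    exact s.2 x₀ (l ∘ₗ extPr)⟩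

variable (F E) in
/-- The preimage in the total space of an open subset of the base. -/
def preim (U : Opens M) : Opens (TotalSpace F E) :=
  ⟨TotalSpace.proj ⁻¹' (U : Set M), U.isOpen.preimage (FiberBundle.continuous_proj F E)⟩

set_option linter.unusedSectionVars false in
theorem preim_mono {U V : Opens M} (h : V ≤ U) : preim F E V ≤ preim F E U :=
  fun _ he => h he

/-- The base point of a point in the preimage of `U`. -/
def baseOf {U : Opens M} (e : preim F E U) : U := ⟨e.1.proj, e.2⟩

set_option linter.unusedSectionVars false in
theorem contMDiff_baseOf {U : Opens M} :
    ContMDiff (𝓘(ℝ, H).prod 𝓘(ℝ, F)) 𝓘(ℝ, H) ∞ (baseOf : preim F E U → U) := by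
  intro e
  have h : ContMDiffAt (𝓘(ℝ, H).prod 𝓘(ℝ, F)) 𝓘(ℝ, H) ∞
      (Subtype.val ∘ (baseOf : preim F E U → U)) e :=
    ((contMDiff_proj E).comp contMDiff_subtype_val).contMDiffAt
  rw [← contMDiffWithinAt_univ] at h ⊢
  exact (ContMDiffWithinAt.subtypeVal_comp_iff U _ _ _).1 h

theorem contMDiff_psi {U : Opens M} (s : SuperFun H F E U) :
    ContMDiff (𝓘(ℝ, H).prod 𝓘(ℝ, F)) 𝓘(ℝ, ℝ) ∞ (fun e : preim F E U =>
      ExteriorAlgebra.algebraMapInv (s.1 (baseOf e)) +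
        ExteriorAlgebra.ιInv (s.1 (baseOf e)) e.1.snd) := by
  intro e₀
  let x₀ : U := baseOf e₀
  let t := trivializationAt F E (x₀ : M)
  let b := Module.finBasis ℝ F
  have hinv : ∀ x : M, ∀ u : ExtFib E x, ExteriorAlgebra.algebraMapInv (localRep F E x₀ x u) =
      ExteriorAlgebra.algebraMapInv u := fun x u => by
    have : (ExteriorAlgebra.algebraMapInv (R := ℝ) (M := Module.Dual ℝ F)).comp
        (localRep F E x₀ x) = ExteriorAlgebra.algebraMapInv := by
      apply ExteriorAlgebra.hom_ext
      ext y
      simp [ExteriorAlgebra.algebraMapInv, localRep]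
    exact DFunLike.congr_fun this u
  have hι : ∀ x : M, ∀ u : ExtFib E x, ExteriorAlgebra.ιInv (localRep F E x₀ x u) =
      (t.symmₗ ℝ x).dualMap (ExteriorAlgebra.ιInv u) := fun x u =>
    DFunLike.congr_fun (ExteriorAlgebra.ιInv_comp_map (t.symmₗ ℝ x).dualMap) u
  let l : Fin (Module.finrank ℝ F) → Module.Dual ℝ (ExteriorAlgebra ℝ (Module.Dual ℝ F)) :=
    fun i => (LinearMap.applyₗ (b i)).comp ExteriorAlgebra.ιInv
  have hsm : ∀ l : Module.Dual ℝ (ExteriorAlgebra ℝ (Module.Dual ℝ F)),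
      ContMDiffAt (𝓘(ℝ, H).prod 𝓘(ℝ, F)) 𝓘(ℝ, ℝ) ∞
        (fun e : preim F E U => l (localRep F E x₀ (baseOf e) (s.1 (baseOf e)))) e₀ := fun l =>
    ContMDiffAt.comp (I' := 𝓘(ℝ, H)) (g := fun x : U => l (localRep F E x₀ x (s.1 x)))
      (f := baseOf) e₀ (s.2 x₀ l) contMDiff_baseOf.contMDiffAt
  have htriv : ContMDiffAt (𝓘(ℝ, H).prod 𝓘(ℝ, F)) 𝓘(ℝ, F) ∞
      (fun e : preim F E U => (t e.1).2) e₀ :=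
    (contMDiffAt_totalSpace.1 (contMDiff_subtype_val (I := 𝓘(ℝ, H).prod 𝓘(ℝ, F))
      (U := preim F E U) e₀)).2
  have hcoord : ∀ i, ContMDiffAt (𝓘(ℝ, H).prod 𝓘(ℝ, F)) 𝓘(ℝ, ℝ) ∞
      (fun e : preim F E U => b.coord i (t e.1).2) e₀ := fun i =>
    ContMDiffAt.comp (I' := 𝓘(ℝ, F)) (g := fun v : F => b.coord i v) e₀
      ((LinearMap.toContinuousLinearMap (b.coord i)).contMDiff.contMDiffAt) htriv
  have hsum : ContMDiffAt (𝓘(ℝ, H).prod 𝓘(ℝ, F)) 𝓘(ℝ, ℝ) ∞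
      (fun e : preim F E U =>
        ExteriorAlgebra.algebraMapInv (localRep F E x₀ (baseOf e) (s.1 (baseOf e))) +
        ∑ i, b.coord i (t e.1).2 * l i (localRep F E x₀ (baseOf e) (s.1 (baseOf e)))) e₀ :=
    (hsm ExteriorAlgebra.algebraMapInv.toLinearMap).add
      (ContMDiffAt.sum fun i _ => (hcoord i).mul (hsm (l i)))
  refine hsum.congr_of_eventuallyEq ?_
  have hmem : ∀ᶠ e : preim F E U in nhds e₀, e.1.proj ∈ t.baseSet :=
    ((FiberBundle.continuous_proj F E).comp continuous_subtype_val).continuousAt.eventually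
      (t.open_baseSet.mem_nhds (mem_baseSet_trivializationAt F E (x₀ : M)))
  filter_upwards [hmem] with e he
  rw [hinv]
  congr 1
  have h1 : ∑ i, b.coord i (t e.1).2 * l i (localRep F E x₀ (baseOf e) (s.1 (baseOf e))) =
      ExteriorAlgebra.ιInv (localRep F E x₀ (baseOf e) (s.1 (baseOf e))) (t e.1).2 := by
    conv_rhs => rw [← b.sum_repr (t e.1).2]
    simp only [map_sum, map_smul, smul_eq_mul]
    rfl
  rw [h1, hι, LinearMap.dualMap_apply]
  congr 1
  change e.1.snd = t.symmₗ ℝ e.1.proj (t e.1).2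
  rw [t.symmₗ_apply he, t.symm_proj_apply e.1 he]

/-- The map `ψ`: a superfunction `s₀ + s₁` of degree at most one, with `s₀` of degree zero and `s₁`
of degree one, is sent to the function `e ↦ s₀(π e) + s₁(π e)(e)` on the total space. (On a general
superfunction the components of degree two or more are ignored.) -/
def psi {U : Opens M} (s : SuperFun H F E U) : Smooth (𝓘(ℝ, H).prod 𝓘(ℝ, F)) (preim F E U) :=
  ⟨fun e => ExteriorAlgebra.algebraMapInv (s.1 (baseOf e)) +
    ExteriorAlgebra.ιInv (s.1 (baseOf e)) e.1.snd, contMDiff_psi s⟩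

/-- Membership of a superderivation in `𝓛`: it preserves the superfunctions of degree at most
one. -/
def PreservesAffine {a : ZMod 2} {U : Opens M} (X : SuperDer H F E a U) : Prop :=
  ∀ (V : Opens M) (hV : V ≤ U), ∀ s ∈ AffineSuper H F E V, X.act V hV s ∈ AffineSuper H F E V

/-- The relation `X' = Ψ(X)` between a homogeneous element `X` of `𝓛(U)` and a derivation `X'` over
the preimage of `U` in `E`: on the fibrewise affine functions, `X'` is the conjugate of `X` by
`ψ`. So the elements of `𝓛'` of parity `a` are the `X'` with `IsPsi X X'` for some `X` of
parity `a`. -/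
def IsPsi {a : ZMod 2} {U : Opens M} (X : SuperDer H F E a U)
    (X' : DerSection (𝓘(ℝ, H).prod 𝓘(ℝ, F)) (preim F E U)) : Prop :=
  PreservesAffine X ∧
    ∀ (V : Opens M) (hV : V ≤ U), ∀ s ∈ AffineSuper H F E V,
      X'.act (preim F E V) (preim_mono hV) (psi s) = psi (X.act V hV s)

/-- On the even part of `𝓛'`, the form `B` is the transport of `pr ∘ g` by `Ψ` and `ψ`:
`B(Ψ X, Ψ Y) = ψ (pr (g (X, Y)))` for even `X`, `Y` in `𝓛`. -/
def IsTransport {p : ZMod 2} (g : RiemannianMetric H F E p)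
    (B : BilinearForm (𝓘(ℝ, H).prod 𝓘(ℝ, F)) (TotalSpace F E)) : Prop :=
  ∀ (U : Opens M) (X Y : SuperDer H F E 0 U)
    (X' Y' : DerSection (𝓘(ℝ, H).prod 𝓘(ℝ, F)) (preim F E U)),
    IsPsi X X' → IsPsi Y Y' → B.val (preim F E U) X' Y' = psi (pr (g.val U 0 0 X Y))

/-- The values of `B` on homogeneous elements `X' = Ψ X`, `Y' = Ψ Y` of `𝓛'` are obtained with
auxiliary functions: for all `h`, `k` of degree at most one and of the same parity as `X`, `Y`,
the products `h X`, `k Y` are even elements of `𝓛` with `Ψ(h X) = ψ(h) X'`, `Ψ(k Y) = ψ(k) Y'`, and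
`ψ(h) ψ(k) B(X', Y') = ψ (pr (g (h X, k Y)))`. -/
def IsExtendedByAuxiliary {p : ZMod 2} (g : RiemannianMetric H F E p)
    (B : BilinearForm (𝓘(ℝ, H).prod 𝓘(ℝ, F)) (TotalSpace F E)) : Prop :=
  ∀ (U : Opens M) (a b : ZMod 2) (X : SuperDer H F E a U) (Y : SuperDer H F E b U)
    (X' Y' : DerSection (𝓘(ℝ, H).prod 𝓘(ℝ, F)) (preim F E U))
    (h : superParity H F E a U) (k : superParity H F E b U),
    IsPsi X X' → IsPsi Y Y' → h.1 ∈ AffineSuper H F E U → k.1 ∈ AffineSuper H F E U →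
      IsPsi (SuperDer.lsmul (CharTwo.add_self_eq_zero a) h X) (psi h.1 • X') ∧
      IsPsi (SuperDer.lsmul (CharTwo.add_self_eq_zero b) k Y) (psi k.1 • Y') ∧
      psi h.1 * psi k.1 * B.val (preim F E U) X' Y' =
        psi (pr (g.val U 0 0 (SuperDer.lsmul (CharTwo.add_self_eq_zero a) h X)
          (SuperDer.lsmul (CharTwo.add_self_eq_zero b) k Y)))

end Super
end SuperReduction

end

/-! On superfunctions, `psi` only sees degrees zero and one, so composing with `pr` changes nothing
(`psi_pr`). The degree-one component is a derivation over the augmentation of the exterior algebra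
(`ιInv_mul`). Hence ψ(st) = ψ(s)ψ(t) for even s, and ψ(st) = ψ(s)·body(t) for odd s, where the body
is the component of degree zero.

These rules constrain odd elements of the domain of Ψ. If X is odd, X' = Ψ(X), f has degree zero and
α = X(f), comparing X'(ψ(fα)) with ψ(X(fα)) gives ψ(α)² = 0, so α = 0 (`IsPsi.act_eq_zero`). Thus X
sends superfunctions of degree at most one to functions of the base, and hX corresponds to ψ(h)X'
when h has the parity of X (`IsPsi.lsmul`). The formula with auxiliary functions is then just
bilinearity.

For existence, a chart of M and a trivialization of E give even coordinates x_i and odd coordinates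
ξ_a on ΠE, jointly z_m. Their dual superderivations ∂_m correspond under Ψ to the coordinate
derivations of E, and the functions ψ(z_m) are linear coordinates of a chart of E (`coordFrame`). An
even X equals Σ X(z_m)∂_m, and the components of X' are ψ(X(z_m)). Expanding g(X, Y) gives ψ(g(X,
Y)) = ΣΣ ψ(X(z_m)) ψ(Y(z_n)) G_mn (`psi_val_lsmul_lsmul`). Here G_mn is ψ(g(∂_m, ∂_n)) when both
indices are even, a sign times the body of g(∂_m, ∂_n) when one is odd, and 0 when both are odd.
This formula makes sense for arbitrary derivations of E and defines the form locally. It is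
symmetric because supersymmetry produces a sign only where G_mn = 0.

For uniqueness, the products ξ_a ∂_a are even, so any two solutions B, B' agree on coordinate
derivations after multiplication by factors ψ(ξ_a). Such a factor can be cancelled since a
coordinate derivation sends it to 1 (`psi_evenFactor_mul_cancel`). The same uniqueness makes the
local forms agree on overlaps, so that they glue (`exists_transport`).

The analytic input is Hadamard's lemma: derivations on E and even superderivations on ΠE are
determined by their values on coordinates (`derSection_ext`, `superDer_ext`). -/

noncomputable section

namespace SuperReduction

/-! ### Components of degree zero and one in the exterior algebra. -/

section Exterior

variable {A : Type*} [AddCommGroup A] [Module ℝ A]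

theorem algebraMapInv_algebraMap (r : ℝ) :
    ExteriorAlgebra.algebraMapInv (algebraMap ℝ (ExteriorAlgebra ℝ A) r) = r :=
  ExteriorAlgebra.algebraMap_leftInverse A r

theorem algebraMapInv_ι (w : A) :
    ExteriorAlgebra.algebraMapInv (ExteriorAlgebra.ι ℝ w) = 0 := by
  simp [ExteriorAlgebra.algebraMapInv]

theorem ιInv_ι (w : A) : ExteriorAlgebra.ιInv (ExteriorAlgebra.ι ℝ w) = w :=
  ExteriorAlgebra.ι_leftInverse w

/-- `ιInv` is the second component of an algebra morphism to the trivial square-zero extension ℝ ⊕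
A, whose first component is the augmentation. The product of that extension gives a Leibniz rule. -/
theorem ιInv_mul (u v : ExteriorAlgebra ℝ A) :
    ExteriorAlgebra.ιInv (u * v) = ExteriorAlgebra.algebraMapInv u • ExteriorAlgebra.ιInv v +
      ExteriorAlgebra.algebraMapInv v • ExteriorAlgebra.ιInv u := by
  -- The square-zero extension needs a right action. This is the one used in the definition of
  -- `ιInv`, so that `h` below holds by `rfl`.
  let : Module ℝᵐᵒᵖ A := Module.compHom _ ((RingHom.id ℝ).fromOpposite mul_comm)
  have : IsCentralScalar ℝ A := ⟨fun r m => rfl⟩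
  have hfst : ∀ u : ExteriorAlgebra ℝ A, (ExteriorAlgebra.toTrivSqZeroExt u).fst =
      ExteriorAlgebra.algebraMapInv u := by
    intro u
    have : (TrivSqZeroExt.fstHom ℝ ℝ A).comp ExteriorAlgebra.toTrivSqZeroExt =
        ExteriorAlgebra.algebraMapInv := by
      apply ExteriorAlgebra.hom_ext
      ext x
      simp [ExteriorAlgebra.algebraMapInv]
    exact DFunLike.congr_fun this u
  have h : ∀ u : ExteriorAlgebra ℝ A,
      ExteriorAlgebra.ιInv u = (ExteriorAlgebra.toTrivSqZeroExt u).snd := fun u => rfl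
  rw [h, h, h, map_mul, TrivSqZeroExt.snd_mul, hfst, hfst]
  rfl

theorem ιInv_algebraMap (r : ℝ) :
    ExteriorAlgebra.ιInv (algebraMap ℝ (ExteriorAlgebra ℝ A) r) = 0 := by
  have h1 : ExteriorAlgebra.ιInv (1 : ExteriorAlgebra ℝ A) = 0 := by
    have := ιInv_mul (1 : ExteriorAlgebra ℝ A) 1
    simpa using this
  rw [Algebra.algebraMap_eq_smul_one, map_smul, h1, smul_zero]

/-- The even part is spanned from scalars by multiplying with pairs ι a · ι b. The Leibniz rule
kills the new terms, since generators have augmentation zero. -/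
theorem ιInv_of_even {u : ExteriorAlgebra ℝ A} (hu : u ∈ extParity A 0) :
    ExteriorAlgebra.ιInv u = 0 := by
  refine CliffordAlgebra.even_induction (0 : QuadraticForm ℝ A)
      (motive := fun u _ => ExteriorAlgebra.ιInv u = 0) ?_ ?_ ?_ u hu
  · exact ιInv_algebraMap
  · intro x y _ _ hx hy
    rw [map_add, hx, hy, add_zero]
  · intro a b x _ hx
    change ExteriorAlgebra.ιInv (ExteriorAlgebra.ι ℝ a * ExteriorAlgebra.ι ℝ b * x) = 0
    rw [ιInv_mul, ιInv_mul, hx, algebraMapInv_ι, algebraMapInv_ι]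
    simp

theorem algebraMapInv_of_odd {u : ExteriorAlgebra ℝ A} (hu : u ∈ extParity A 1) :
    ExteriorAlgebra.algebraMapInv u = 0 := by
  refine CliffordAlgebra.odd_induction (P := fun u _ => ExteriorAlgebra.algebraMapInv u = 0)
    (0 : QuadraticForm ℝ A) ?_ ?_ ?_ u hu
  · exact algebraMapInv_ι
  · intro x y _ _ hx hy
    rw [map_add, hx, hy, add_zero]
  · intro a b x _ hx
    rw [map_mul, hx, mul_zero]

theorem algebraMap_mem_extParity (r : ℝ) :
    algebraMap ℝ (ExteriorAlgebra ℝ A) r ∈ extParity A 0 :=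
  SetLike.algebraMap_mem_graded _ r

theorem ι_mem_extParity (w : A) : ExteriorAlgebra.ι ℝ w ∈ extParity A 1 :=
  CliffordAlgebra.ι_mem_evenOdd_one _ w

end Exterior

section Super

variable {H : Type*} [NormedAddCommGroup H] [NormedSpace ℝ H]
  {M : Type*} [TopologicalSpace M] [ChartedSpace H M]
  {F : Type*} [NormedAddCommGroup F] [NormedSpace ℝ F] [FiniteDimensional ℝ F]
  {E : M → Type*} [TopologicalSpace (TotalSpace F E)]
  [∀ x, AddCommGroup (E x)] [∀ x, Module ℝ (E x)] [∀ x, TopologicalSpace (E x)]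
  [FiberBundle F E] [VectorBundle ℝ F E]

/-! ### The transport of superfunctions -/

set_option linter.unusedSectionVars false in
theorem algebraMapInv_localRep (x₀ x : M) (u : ExtFib E x) :
    ExteriorAlgebra.algebraMapInv (localRep F E x₀ x u) = ExteriorAlgebra.algebraMapInv u := by
  have : (ExteriorAlgebra.algebraMapInv (R := ℝ) (M := Module.Dual ℝ F)).comp
      (localRep F E x₀ x) = ExteriorAlgebra.algebraMapInv := by
    apply ExteriorAlgebra.hom_ext
    ext y
    simp [ExteriorAlgebra.algebraMapInv, localRep]
  exact DFunLike.congr_fun this u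

/-- The component of degree zero of a superfunction, as a smooth function on the base. -/
def reduced {U : Opens M} (s : SuperFun H F E U) : Smooth 𝓘(ℝ, H) U :=
  ⟨fun x => ExteriorAlgebra.algebraMapInv (s.1 x), fun x₀ => by
    have := s.2 x₀ ExteriorAlgebra.algebraMapInv.toLinearMap
    simpa only [AlgHom.toLinearMap_apply, algebraMapInv_localRep] using this⟩

/-- The component of degree zero of a superfunction, as a function on the total space. -/
def body {U : Opens M} (s : SuperFun H F E U) :
    Smooth (𝓘(ℝ, H).prod 𝓘(ℝ, F)) (preim F E U) :=
  ⟨fun e => ExteriorAlgebra.algebraMapInv (s.1 (baseOf e)),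
    (reduced s).contMDiff.comp contMDiff_baseOf⟩

variable (F E) in
/-- A smooth function on the base as a superfunction of degree zero. -/
def ofSmooth {U : Opens M} (f : Smooth 𝓘(ℝ, H) U) : SuperFun H F E U :=
  ⟨fun x => algebraMap ℝ (ExtFib E x) (f x), fun x₀ l => by
    simp only [AlgHom.commutes]
    simp only [Algebra.algebraMap_eq_smul_one, map_smul, smul_eq_mul]
    exact f.contMDiff.contMDiffAt.mul contMDiffAt_const⟩

theorem ofSmooth_mem_superParity {U : Opens M} (f : Smooth 𝓘(ℝ, H) U) :
    ofSmooth F E f ∈ superParity H F E 0 U := fun x => algebraMap_mem_extParity (f x)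

theorem ofSmooth_mem_affineSuper {U : Opens M} (f : Smooth 𝓘(ℝ, H) U) :
    ofSmooth F E f ∈ AffineSuper H F E U := fun x => ⟨f x, 0, by simp [ofSmooth]⟩

theorem psi_mk {U : Opens M} (s : SuperFun H F E U) (x : U) (v : E (x : M)) :
    psi s ⟨⟨x.1, v⟩, x.2⟩ = ExteriorAlgebra.algebraMapInv (s.1 x) +
      ExteriorAlgebra.ιInv (s.1 x) v := rfl

theorem body_mk {U : Opens M} (s : SuperFun H F E U) (x : U) (v : E (x : M)) :
    body s ⟨⟨x.1, v⟩, x.2⟩ = ExteriorAlgebra.algebraMapInv (s.1 x) := rfl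

set_option linter.unusedSectionVars false in
theorem smooth_preim_ext {U : Opens M}
    {f k : Smooth (𝓘(ℝ, H).prod 𝓘(ℝ, F)) (preim F E U)}
    (h : ∀ (x : U) (v : E (x : M)), f ⟨⟨x.1, v⟩, x.2⟩ = k ⟨⟨x.1, v⟩, x.2⟩) : f = k :=
  ContMDiffMap.ext fun e => h ⟨e.1.1, e.2⟩ e.1.2

theorem psi_add {U : Opens M} (s t : SuperFun H F E U) : psi (s + t) = psi s + psi t := by
  refine smooth_preim_ext fun x v => ?_
  change psi (s + t) _ = psi s _ + psi t _
  simp only [psi_mk, Subalgebra.coe_add, Pi.add_apply, map_add, LinearMap.add_apply]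
  ring

theorem psi_smul {U : Opens M} (r : ℝ) (s : SuperFun H F E U) : psi (r • s) = r • psi s := by
  refine smooth_preim_ext fun x v => ?_
  change psi (r • s) _ = r • psi s _
  simp only [psi_mk, Subalgebra.coe_smul, Pi.smul_apply, map_smul, LinearMap.smul_apply,
    smul_add]

/-- The transport `ψ` as a linear map. -/
def psiₗ (U : Opens M) :
    SuperFun H F E U →ₗ[ℝ] Smooth (𝓘(ℝ, H).prod 𝓘(ℝ, F)) (preim F E U) where
  toFun := psi
  map_add' := psi_add
  map_smul' := psi_smul

theorem psi_sum {U : Opens M} {ι : Type*} (t : Finset ι) (s : ι → SuperFun H F E U) :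
    psi (∑ i ∈ t, s i) = ∑ i ∈ t, psi (s i) :=
  map_sum (psiₗ U) s t

theorem psi_zero {U : Opens M} : psi (0 : SuperFun H F E U) = 0 := map_zero (psiₗ U)

theorem psi_one {U : Opens M} : psi (1 : SuperFun H F E U) = 1 := by
  refine smooth_preim_ext fun x v => ?_
  change ExteriorAlgebra.algebraMapInv (1 : ExtFib E (x : M)) +
    ExteriorAlgebra.ιInv (1 : ExtFib E (x : M)) v = 1
  have := ιInv_algebraMap (A := Module.Dual ℝ (E (x : M))) 1
  rw [map_one] at this
  rw [this]
  simp

theorem psi_pr {U : Opens M} (s : SuperFun H F E U) : psi (pr s) = psi s := by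
  refine smooth_preim_ext fun x v => ?_
  change ExteriorAlgebra.algebraMapInv (extPr (s.1 x)) + ExteriorAlgebra.ιInv (extPr (s.1 x)) v = _
  simp [extPr, algebraMapInv_ι, ιInv_ι, ιInv_algebraMap, psi_mk]

/-- An even factor contributes only its degree-zero component, which multiplies both components of
the other factor. -/
theorem psi_mul_of_even {U : Opens M} {s : SuperFun H F E U} (hs : s ∈ superParity H F E 0 U)
    (t : SuperFun H F E U) : psi (s * t) = psi s * psi t := by
  refine smooth_preim_ext fun x v => ?_
  change ExteriorAlgebra.algebraMapInv (s.1 x * t.1 x) +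
      ExteriorAlgebra.ιInv (s.1 x * t.1 x) v =
    (ExteriorAlgebra.algebraMapInv (s.1 x) + ExteriorAlgebra.ιInv (s.1 x) v) *
    (ExteriorAlgebra.algebraMapInv (t.1 x) + ExteriorAlgebra.ιInv (t.1 x) v)
  rw [ιInv_mul, ιInv_of_even (hs _), map_mul]
  simp
  ring

/-- An odd factor has no degree-zero component, so the only surviving contribution in degree at most
one pairs its linear part with the body of the other factor. -/
theorem psi_mul_of_odd {U : Opens M} {s : SuperFun H F E U} (hs : s ∈ superParity H F E 1 U)
    (t : SuperFun H F E U) : psi (s * t) = psi s * body t := by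
  refine smooth_preim_ext fun x v => ?_
  change ExteriorAlgebra.algebraMapInv (s.1 x * t.1 x) +
      ExteriorAlgebra.ιInv (s.1 x * t.1 x) v =
    (ExteriorAlgebra.algebraMapInv (s.1 x) + ExteriorAlgebra.ιInv (s.1 x) v) *
    (ExteriorAlgebra.algebraMapInv (t.1 x))
  rw [ιInv_mul, map_mul, algebraMapInv_of_odd (hs _)]
  simp
  ring

theorem body_of_odd {U : Opens M} {s : SuperFun H F E U} (hs : s ∈ superParity H F E 1 U) :
    body s = 0 := by
  refine smooth_preim_ext fun x v => ?_
  exact algebraMapInv_of_odd (hs _)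

theorem body_eq_psi_of_even {U : Opens M} {s : SuperFun H F E U}
    (hs : s ∈ superParity H F E 0 U) : body s = psi s := by
  refine smooth_preim_ext fun x v => ?_
  rw [psi_mk, body_mk, ιInv_of_even (hs _)]
  simp

theorem body_mul_of_odd {U : Opens M} {s : SuperFun H F E U} (hs : s ∈ superParity H F E 1 U)
    (t : SuperFun H F E U) : body (s * t) = 0 := by
  refine smooth_preim_ext fun x v => ?_
  change ExteriorAlgebra.algebraMapInv (s.1 x * t.1 x) = 0
  rw [map_mul, algebraMapInv_of_odd (hs _), zero_mul]

/-- An affine function on a fibre determines its constant term by its value at 0, and then its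
linear part. -/
theorem eq_zero_of_psi_eq_zero {U : Opens M} {s : SuperFun H F E U}
    (hs : s ∈ AffineSuper H F E U) (h : psi s = 0) : s = 0 := by
  apply Subtype.ext
  funext x
  obtain ⟨r, w, hx⟩ := hs x
  have key : ∀ v : E (x : M), r + w v = 0 := by
    intro v
    have h1 : psi s ⟨⟨x.1, v⟩, x.2⟩ = 0 := by rw [h]; rfl
    rw [psi_mk, hx] at h1
    simpa [algebraMapInv_ι, ιInv_ι, ιInv_algebraMap] using h1
  have hr : r = 0 := by simpa using key 0
  have hw : w = 0 := by
    ext v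
    simpa [hr] using key v
  rw [hx, hr, hw]
  simp

/-- An even superfunction of degree at most one has degree zero. -/
theorem AffineSuper.eq_algebraMap_of_even {U : Opens M} {s : SuperFun H F E U}
    (hs : s ∈ AffineSuper H F E U) (h0 : s ∈ superParity H F E 0 U) (x : U) :
    s.1 x = algebraMap ℝ (ExtFib E x) (ExteriorAlgebra.algebraMapInv (s.1 x)) := by
  obtain ⟨r, w, hx⟩ := hs x
  have h := ιInv_of_even (h0 x)
  rw [hx] at h
  have hw : w = 0 := by simpa [ιInv_ι, ιInv_algebraMap] using h
  rw [hx, hw]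
  simp

theorem AffineSuper.mul_of_even {U : Opens M} {s t : SuperFun H F E U}
    (hs : s ∈ AffineSuper H F E U) (h0 : s ∈ superParity H F E 0 U)
    (ht : t ∈ AffineSuper H F E U) : s * t ∈ AffineSuper H F E U := by
  intro x
  obtain ⟨r, w, hx⟩ := ht x
  refine ⟨ExteriorAlgebra.algebraMapInv (s.1 x) * r, ExteriorAlgebra.algebraMapInv (s.1 x) • w, ?_⟩
  change s.1 x * t.1 x = _
  rw [AffineSuper.eq_algebraMap_of_even hs h0 x, algebraMapInv_algebraMap, hx, mul_add, map_mul,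
    map_smul, Algebra.smul_def]

theorem AffineSuper.add {U : Opens M} {s t : SuperFun H F E U}
    (hs : s ∈ AffineSuper H F E U) (ht : t ∈ AffineSuper H F E U) :
    s + t ∈ AffineSuper H F E U := by
  intro x
  obtain ⟨r, w, hx⟩ := hs x
  obtain ⟨r', w', hx'⟩ := ht x
  refine ⟨r + r', w + w', ?_⟩
  change s.1 x + t.1 x = _
  rw [hx, hx', map_add, map_add]
  abel

theorem AffineSuper.smul {U : Opens M} {s : SuperFun H F E U} (c : ℝ)
    (hs : s ∈ AffineSuper H F E U) : c • s ∈ AffineSuper H F E U := by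
  intro x
  obtain ⟨r, w, hx⟩ := hs x
  refine ⟨c * r, c • w, ?_⟩
  change c • s.1 x = _
  rw [hx, smul_add, map_smul, map_mul, Algebra.smul_def]

theorem AffineSuper.res {U V : Opens M} (h : V ≤ U) {s : SuperFun H F E U}
    (hs : s ∈ AffineSuper H F E U) : resSuper H F E h s ∈ AffineSuper H F E V :=
  fun x => hs ⟨x.1, h x.2⟩

/-- Splits a superfunction of degree at most one into a function of the base and an odd remainder,
so that parity arguments apply to each piece. -/
theorem AffineSuper.sub_ofSmooth {U : Opens M} {s : SuperFun H F E U}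
    (hs : s ∈ AffineSuper H F E U) :
    s - ofSmooth F E (reduced s) ∈ AffineSuper H F E U ∧
      s - ofSmooth F E (reduced s) ∈ superParity H F E 1 U := by
  have key : ∀ x : U, ∃ w : Module.Dual ℝ (E (x : M)),
      (s - ofSmooth F E (reduced s)).1 x = ExteriorAlgebra.ι ℝ w := by
    intro x
    obtain ⟨r, w, hx⟩ := hs x
    refine ⟨w, ?_⟩
    change s.1 x - algebraMap ℝ _ (ExteriorAlgebra.algebraMapInv (s.1 x)) = _
    rw [hx, map_add, algebraMapInv_ι, algebraMapInv_algebraMap]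
    simp
  refine ⟨fun x => ?_, fun x => ?_⟩
  · obtain ⟨w, hw⟩ := key x
    exact ⟨0, w, by rw [hw]; simp⟩
  · obtain ⟨w, hw⟩ := key x
    rw [hw]
    exact ι_mem_extParity w

/-! ### Homogeneous superderivations in the domain of Ψ. -/

namespace SuperDer

theorem act_one {a : ZMod 2} {U V : Opens M} (X : SuperDer H F E a U) (hV : V ≤ U) :
    X.act V hV 1 = 0 := by
  have h1 : (1 : SuperFun H F E V) ∈ superParity H F E 0 V := fun x =>
    SetLike.GradedOne.one_mem
  have := X.leibniz V hV 0 1 1 h1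
  simpa [sgn] using this

end SuperDer

/-- An odd superderivation in the domain of `Ψ` kills the functions of the base. -/
theorem IsPsi.act_eq_zero {U : Opens M} {X : SuperDer H F E 1 U}
    {X' : DerSection (𝓘(ℝ, H).prod 𝓘(ℝ, F)) (preim F E U)} (hX : IsPsi X X') {V : Opens M}
    (hV : V ≤ U) {f : SuperFun H F E V} (hf : f ∈ AffineSuper H F E V)
    (h0 : f ∈ superParity H F E 0 V) : X.act V hV f = 0 := by
  have hα := hX.1 V hV f hf
  have hα1 : X.act V hV f ∈ superParity H F E 1 V := X.parity V hV 0 f h0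
  apply eq_zero_of_psi_eq_zero hα
  -- With α = X(f), the relation Ψ is tested on fα, again of degree at most one. The derivation X'
  -- yields a term ψ(α)², while X yields α², whose image under ψ vanishes because α is odd. The
  -- other terms cancel.
  have h1 := hX.2 V hV _ (AffineSuper.mul_of_even hf h0 hα)
  rw [psi_mul_of_even h0, Derivation.leibniz, X.leibniz V hV 0 _ _ h0, psi_add,
    psi_mul_of_odd hα1, body_of_odd hα1, hX.2 V hV _ hα, hX.2 V hV _ hf] at h1
  simp only [mul_zero, sgn, if_true, one_smul, smul_eq_mul, psi_mul_of_even h0] at h1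
  have h2 : psi (X.act V hV f) * psi (X.act V hV f) = 0 := by
    linear_combination h1
  ext e
  have h3 := DFunLike.congr_fun h2 e
  exact mul_self_eq_zero.1 h3

/-- For even X the factor h is a function of the base and ψ is multiplicative. For odd X the values
on `AffineSuper` have degree zero, so multiplying them by an odd affine h stays affine and ψ is
again multiplicative on the product. -/
theorem IsPsi.lsmul {a : ZMod 2} {U : Opens M} {X : SuperDer H F E a U}
    {X' : DerSection (𝓘(ℝ, H).prod 𝓘(ℝ, F)) (preim F E U)} (hX : IsPsi X X')
    (h : superParity H F E a U) (hh : h.1 ∈ AffineSuper H F E U) :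
    IsPsi (SuperDer.lsmul (CharTwo.add_self_eq_zero a) h X) (psi h.1 • X') := by
  have hz : a = 0 ∨ a = 1 :=
    (by decide : ∀ a : ZMod 2, a = 0 ∨ a = 1) a
  have act_eq : ∀ (V : Opens M) (hV : V ≤ U) (s : SuperFun H F E V),
      (SuperDer.lsmul (CharTwo.add_self_eq_zero a) h X).act V hV s =
        resSuper H F E hV h.1 * X.act V hV s := fun V hV s => rfl
  have act_eq' : ∀ (V : Opens M) (hV : V ≤ U) (k),
      (psi h.1 • X').act (preim F E V) (preim_mono hV) k =
        psi (resSuper H F E hV h.1) * X'.act (preim F E V) (preim_mono hV) k :=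
    fun V hV k => rfl
  rcases hz with rfl | rfl
  · refine ⟨fun V hV s hs => ?_, fun V hV s hs => ?_⟩
    · rw [act_eq]
      exact AffineSuper.mul_of_even (AffineSuper.res hV hh) (superParity_res hV h.2) (hX.1 V hV s hs)
    · rw [act_eq, act_eq', psi_mul_of_even (superParity_res hV h.2), hX.2 V hV s hs]
  -- The degree-zero part of s is killed by `act_eq_zero`, and the odd remainder is sent to an even
  -- superfunction by parity.
  · have heven : ∀ (V : Opens M) (hV : V ≤ U) (s : SuperFun H F E V), s ∈ AffineSuper H F E V →
        X.act V hV s ∈ superParity H F E 0 V := by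
      intro V hV s hs
      obtain ⟨h1, h2⟩ := AffineSuper.sub_ofSmooth hs
      have h3 := X.parity V hV 1 _ h2
      rwa [map_sub, hX.act_eq_zero hV (ofSmooth_mem_affineSuper _) (ofSmooth_mem_superParity _),
        sub_zero] at h3
    refine ⟨fun V hV s hs => ?_, fun V hV s hs => ?_⟩
    · rw [act_eq, superFun_graded_comm (superParity_res hV h.2) (heven V hV s hs)]
      exact AffineSuper.smul _
        (AffineSuper.mul_of_even (hX.1 V hV s hs) (heven V hV s hs) (AffineSuper.res hV hh))
    · rw [act_eq, act_eq', psi_mul_of_odd (superParity_res hV h.2),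
        body_eq_psi_of_even (heven V hV s hs), hX.2 V hV s hs]

theorem IsPsi.res {a : ZMod 2} {U U' : Opens M} (h : U' ≤ U) {X : SuperDer H F E a U}
    {X' : DerSection (𝓘(ℝ, H).prod 𝓘(ℝ, F)) (preim F E U)} (hX : IsPsi X X') :
    IsPsi (X.res h) (X'.res (preim_mono h)) :=
  ⟨fun V hV s hs => hX.1 V (hV.trans h) s hs, fun V hV s hs => hX.2 V (hV.trans h) s hs⟩

/-- Since hX and kY are even elements of the domain of Ψ, the transport property applies to them,
and bilinearity of B pulls out ψ(h) and ψ(k). -/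
theorem IsTransport.isExtendedByAuxiliary {p : ZMod 2} {g : RiemannianMetric H F E p}
    {B : BilinearForm (𝓘(ℝ, H).prod 𝓘(ℝ, F)) (TotalSpace F E)} (hB : IsTransport g B) :
    IsExtendedByAuxiliary g B := by
  intro U a b X Y X' Y' h k hX hY hh hk
  refine ⟨hX.lsmul h hh, hY.lsmul k hk, ?_⟩
  rw [← hB U _ _ _ _ (hX.lsmul h hh) (hY.lsmul k hk), B.smul_left, B.smul_right, mul_assoc]

end Super

section Classical

variable {EN : Type*} [NormedAddCommGroup EN] [NormedSpace ℝ EN]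
  {HN : Type*} [TopologicalSpace HN] {J : ModelWithCorners ℝ EN HN}
  {N : Type*} [TopologicalSpace N] [ChartedSpace HN N]

/-! ### Local bilinear forms -/

/-- Smoothness on an open subset in terms of the extension by zero. -/
theorem contMDiffAt_extend_iff {V : Opens N} {f : V → ℝ} {y : V} :
    ContMDiffAt J 𝓘(ℝ, ℝ) ∞ (Function.extend Subtype.val f 0) (y : N) ↔
      ContMDiffAt J 𝓘(ℝ, ℝ) ∞ f y := by
  rw [← contMDiffAt_subtype_iff]
  simp only [Subtype.val_injective.extend_apply]

/-- Locality of smoothness across two different subtypes: the extensions by zero from V and from W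
coincide near y. -/
theorem contMDiffAt_of_comp_inclusion {V W : Opens N} (h : W ≤ V) {f : V → ℝ} {y : N}
    (hy : y ∈ W) (hf : ContMDiffAt J 𝓘(ℝ, ℝ) ∞ (fun w : W => f ⟨w.1, h w.2⟩) ⟨y, hy⟩) :
    ContMDiffAt J 𝓘(ℝ, ℝ) ∞ f ⟨y, h hy⟩ := by
  rw [← contMDiffAt_extend_iff] at hf ⊢
  refine hf.congr_of_eventuallyEq ?_
  filter_upwards [W.isOpen.mem_nhds hy] with z hz
  rw [Subtype.val_injective.extend_apply f 0 (⟨z, h hz⟩ : V)]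
  exact (Subtype.val_injective.extend_apply (fun w : W => f ⟨w.1, h w.2⟩) 0 ⟨z, hz⟩).symm

namespace DerSection

instance {V : Opens N} : Zero (DerSection J V) where
  zero :=
    { act := fun _ _ => 0
      act_res := fun W W' hW h f => by simp }

instance {V : Opens N} : AddCommMonoid (DerSection J V) where
  nsmul := nsmulRec
  add_assoc _ _ _ := DerSection.ext (funext fun _ => funext fun _ => add_assoc _ _ _)
  zero_add _ := DerSection.ext (funext fun _ => funext fun _ => zero_add _)
  add_zero _ := DerSection.ext (funext fun _ => funext fun _ => add_zero _)
  add_comm _ _ := DerSection.ext (funext fun _ => funext fun _ => add_comm _ _)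

/-- The action on functions as an additive map. -/
def actHom {V W : Opens N} (hW : W ≤ V) (f : Smooth J W) : DerSection J V →+ Smooth J W where
  toFun X := X.act W hW f
  map_zero' := rfl
  map_add' _ _ := rfl

theorem sum_act {V W : Opens N} (hW : W ≤ V) (f : Smooth J W) {ι : Type*} (t : Finset ι)
    (X : ι → DerSection J V) : (∑ i ∈ t, X i).act W hW f = ∑ i ∈ t, (X i).act W hW f :=
  map_sum (actHom hW f) X t

end DerSection

variable (J) in
/-- A bilinear form on the open subset `O` of the manifold `N`. -/
structure LocalForm (O : Opens N) where
  val : ∀ V : Opens N, V ≤ O → DerSection J V → DerSection J V → Smooth J V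
  res : ∀ (V V' : Opens N) (hV : V ≤ O) (h : V' ≤ V) (X Y : DerSection J V),
    resSmooth J h (val V hV X Y) = val V' (h.trans hV) (X.res h) (Y.res h)
  add_left : ∀ (V : Opens N) (hV : V ≤ O) (X X' Y : DerSection J V),
    val V hV (X + X') Y = val V hV X Y + val V hV X' Y
  add_right : ∀ (V : Opens N) (hV : V ≤ O) (X Y Y' : DerSection J V),
    val V hV X (Y + Y') = val V hV X Y + val V hV X Y'
  smul_left : ∀ (V : Opens N) (hV : V ≤ O) (f : Smooth J V) (X Y : DerSection J V),
    val V hV (f • X) Y = f * val V hV X Y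
  smul_right : ∀ (V : Opens N) (hV : V ≤ O) (f : Smooth J V) (X Y : DerSection J V),
    val V hV X (f • Y) = f * val V hV X Y

namespace LocalForm

/-- Restriction of a local bilinear form. -/
def restrict {O O' : Opens N} (h : O' ≤ O) (B : LocalForm J O) : LocalForm J O' where
  val V hV := B.val V (hV.trans h)
  res V V' hV := B.res V V' (hV.trans h)
  add_left V hV := B.add_left V (hV.trans h)
  add_right V hV := B.add_right V (hV.trans h)
  smul_left V hV := B.smul_left V (hV.trans h)
  smul_right V hV := B.smul_right V (hV.trans h)

theorem sum_left {O V : Opens N} (B : LocalForm J O) (hV : V ≤ O) {ι : Type*} (t : Finset ι)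
    (X : ι → DerSection J V) (Y : DerSection J V) :
    B.val V hV (∑ i ∈ t, X i) Y = ∑ i ∈ t, B.val V hV (X i) Y := by
  let φ : DerSection J V →+ Smooth J V :=
    { toFun := fun X => B.val V hV X Y
      map_zero' := by
        have := B.add_left V hV 0 0 Y
        rwa [add_zero, left_eq_add] at this
      map_add' := fun X X' => B.add_left V hV X X' Y }
  exact map_sum φ X t

theorem sum_right {O V : Opens N} (B : LocalForm J O) (hV : V ≤ O) {ι : Type*} (t : Finset ι)
    (X : DerSection J V) (Y : ι → DerSection J V) :
    B.val V hV X (∑ i ∈ t, Y i) = ∑ i ∈ t, B.val V hV X (Y i) := by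
  let φ : DerSection J V →+ Smooth J V :=
    { toFun := fun Y => B.val V hV X Y
      map_zero' := by
        have := B.add_right V hV X 0 0
        rwa [add_zero, left_eq_add] at this
      map_add' := fun Y Y' => B.add_right V hV X Y Y' }
  exact map_sum φ Y t

/-- Gluing of local bilinear forms, at the level of values. -/
theorem exists_glue (O : N → Opens N) (hO : ∀ y, y ∈ O y) (B : ∀ y, LocalForm J (O y))
    (hB : ∀ (y y' : N) (V : Opens N) (h : V ≤ O y) (h' : V ≤ O y') (X Y : DerSection J V),
      (B y).val V h X Y = (B y').val V h' X Y) :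
    ∃ C : BilinearForm J N, ∀ (y : N) (V W : Opens N) (h : W ≤ V) (h' : W ≤ O y)
      (X Y : DerSection J V),
      resSmooth J h (C.val V X Y) = (B y).val W h' (X.res h) (Y.res h) := by
  -- The value at y is computed with the local form attached to y itself. The compatibility `hB`
  -- then shows that near y any other available local form gives the same value, hence smoothness.
  let v : ∀ V : Opens N, DerSection J V → DerSection J V → V → ℝ := fun V X Y y =>
    (B y).val (V ⊓ O y) inf_le_right (X.res inf_le_left) (Y.res inf_le_left) ⟨y, y.2, hO y⟩
  have hv : ∀ (V : Opens N) (X Y : DerSection J V) (y : N) (W : Opens N) (h : W ≤ V)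
      (h' : W ≤ O y) (z : W),
      v V X Y ⟨z, h z.2⟩ = (B y).val W h' (X.res h) (Y.res h) z := by
    intro V X Y y W h h' z
    have h1 := DFunLike.congr_fun ((B z).res (V ⊓ O z) (W ⊓ O z) inf_le_right
      (inf_le_inf_right _ h) (X.res inf_le_left) (Y.res inf_le_left)) ⟨z, z.2, hO z⟩
    have h2 := DFunLike.congr_fun ((B y).res W (W ⊓ O z) h' inf_le_left (X.res h) (Y.res h))
      ⟨z, z.2, hO z⟩
    refine h1.trans (Eq.trans ?_ h2.symm)
    exact DFunLike.congr_fun (hB z y (W ⊓ O z) _ _ _ _) _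
  have hsm : ∀ (V : Opens N) (X Y : DerSection J V), ContMDiff J 𝓘(ℝ, ℝ) ∞ (v V X Y) := by
    intro V X Y y
    refine contMDiffAt_of_comp_inclusion (W := V ⊓ O y) inf_le_left ⟨y.2, hO y⟩ ?_
    simp only [hv V X Y y (V ⊓ O y) inf_le_left inf_le_right]
    exact ((B y).val _ _ _ _).contMDiff.contMDiffAt
  refine ⟨⟨fun V X Y => ⟨v V X Y, hsm V X Y⟩, ?_, ?_, ?_, ?_, ?_⟩, ?_⟩
  · intro V V' h X Y
    ext z
    have h1 := hv V X Y z (V' ⊓ O z) (inf_le_left.trans h) inf_le_right ⟨z, z.2, hO z⟩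
    exact h1
  · intro V X X' Y
    ext z
    exact DFunLike.congr_fun ((B z).add_left _ _ (X.res inf_le_left) (X'.res inf_le_left) _) _
  · intro V X Y Y'
    ext z
    exact DFunLike.congr_fun ((B z).add_right _ _ _ (Y.res inf_le_left) (Y'.res inf_le_left)) _
  · intro V f X Y
    ext z
    exact DFunLike.congr_fun ((B z).smul_left _ _ (resSmooth J inf_le_left f)
      (X.res inf_le_left) _) _
  · intro V f X Y
    ext z
    exact DFunLike.congr_fun ((B z).smul_right _ _ (resSmooth J inf_le_left f) _
      (Y.res inf_le_left)) _
  · intro y V W h h' X Y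
    ext z
    exact hv V X Y y W h h' z

end LocalForm

/-- The local bilinear form defined by a bilinear form. -/
def BilinearForm.toLocal (B : BilinearForm J N) (O : Opens N) : LocalForm J O where
  val V _ := B.val V
  res V V' _ := B.res V V'
  add_left V _ := B.add_left V
  add_right V _ := B.add_right V
  smul_left V _ := B.smul_left V
  smul_right V _ := B.smul_right V

end Classical

/-! ### Sums of superderivations and the matrix entries of the transported form. -/

section Super

variable {H : Type*} [NormedAddCommGroup H] [NormedSpace ℝ H]
  {M : Type*} [TopologicalSpace M] [ChartedSpace H M]
  {F : Type*} [NormedAddCommGroup F] [NormedSpace ℝ F] [FiniteDimensional ℝ F]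
  {E : M → Type*} [TopologicalSpace (TotalSpace F E)]
  [∀ x, AddCommGroup (E x)] [∀ x, Module ℝ (E x)] [∀ x, TopologicalSpace (E x)]
  [FiberBundle F E] [VectorBundle ℝ F E]

namespace SuperDer

instance {a : ZMod 2} {U : Opens M} : Zero (SuperDer H F E a U) where
  zero :=
    { act := fun _ _ => 0
      act_res := fun V W hV h s => by simp
      parity := fun V hV c s hs => Submodule.zero_mem _
      leibniz := fun V hV c s t hs => by simp }

instance {a : ZMod 2} {U : Opens M} : AddCommMonoid (SuperDer H F E a U) where
  nsmul := nsmulRec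
  add_assoc _ _ _ := SuperDer.ext (funext fun _ => funext fun _ => add_assoc _ _ _)
  zero_add _ := SuperDer.ext (funext fun _ => funext fun _ => zero_add _)
  add_zero _ := SuperDer.ext (funext fun _ => funext fun _ => add_zero _)
  add_comm _ _ := SuperDer.ext (funext fun _ => funext fun _ => add_comm _ _)

/-- The action on superfunctions as an additive map. -/
def actHom {a : ZMod 2} {U V : Opens M} (hV : V ≤ U) (s : SuperFun H F E V) :
    SuperDer H F E a U →+ SuperFun H F E V where
  toFun X := X.act V hV s
  map_zero' := rfl
  map_add' _ _ := rfl

theorem sum_act {a : ZMod 2} {U V : Opens M} (hV : V ≤ U) (s : SuperFun H F E V) {ι : Type*}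
    (t : Finset ι) (X : ι → SuperDer H F E a U) :
    (∑ i ∈ t, X i).act V hV s = ∑ i ∈ t, (X i).act V hV s :=
  map_sum (actHom hV s) X t

end SuperDer

namespace RiemannianMetric

variable {p : ZMod 2} (g : RiemannianMetric H F E p)

theorem sum_left {a b : ZMod 2} {U : Opens M} {ι : Type*} (t : Finset ι)
    (X : ι → SuperDer H F E a U) (Y : SuperDer H F E b U) :
    g.val U a b (∑ i ∈ t, X i) Y = ∑ i ∈ t, g.val U a b (X i) Y := by
  let φ : SuperDer H F E a U →+ SuperFun H F E U :=
    { toFun := fun X => g.val U a b X Y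
      map_zero' := by
        have := g.add_left U a b 0 0 Y
        rwa [add_zero, left_eq_add] at this
      map_add' := fun X X' => g.add_left U a b X X' Y }
  exact map_sum φ X t

theorem sum_right {a b : ZMod 2} {U : Opens M} {ι : Type*} (t : Finset ι)
    (X : SuperDer H F E a U) (Y : ι → SuperDer H F E b U) :
    g.val U a b X (∑ i ∈ t, Y i) = ∑ i ∈ t, g.val U a b X (Y i) := by
  let φ : SuperDer H F E b U →+ SuperFun H F E U :=
    { toFun := fun Y => g.val U a b X Y
      map_zero' := by
        have := g.add_right U a b X 0 0
        rwa [add_zero, left_eq_add] at this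
      map_add' := fun Y Y' => g.add_right U a b X Y Y' }
  exact map_sum φ Y t

end RiemannianMetric

/-- The contribution to the transported form of the value `s = g(X, Y)` at homogeneous `X`, `Y`
of parities `a`, `b`. -/
def entry (p a b : ZMod 2) {U : Opens M} (s : SuperFun H F E U) :
    Smooth (𝓘(ℝ, H).prod 𝓘(ℝ, F)) (preim F E U) :=
  if a = 0 ∧ b = 0 then psi s else if a = 0 ∨ b = 0 then sgn p • body s else 0

theorem resSmooth_entry (p a b : ZMod 2) {U V : Opens M} (h : V ≤ U) (s : SuperFun H F E U) :
    resSmooth _ (preim_mono h) (entry p a b s) = entry p a b (resSuper H F E h s) := by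
  unfold entry
  split_ifs
  · rfl
  · rfl
  · exact map_zero _

/-- This computation dictates the shape of `entry`. Moving f and k out of g produces the signs
(-1)^(p a) and (-1)^((p + a) b). The product rules for ψ then leave ψ of the value, its body with
the sign (-1)^p, or nothing, according to whether zero, one or two of the factors are odd. -/
theorem psi_val_lsmul_lsmul {p a b : ZMod 2} (g : RiemannianMetric H F E p) {U : Opens M}
    (f : superParity H F E a U) (k : superParity H F E b U) (X : SuperDer H F E a U)
    (Y : SuperDer H F E b U) :
    psi (g.val U 0 0 (SuperDer.lsmul (CharTwo.add_self_eq_zero a) f X)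
      (SuperDer.lsmul (CharTwo.add_self_eq_zero b) k Y)) =
    psi f.1 * psi k.1 * entry p a b (g.val U a b X Y) := by
  have hz : ∀ a : ZMod 2, a = 0 ∨ a = 1 := by decide
  rw [g.lsmul_left, g.lsmul_right, psi_smul, mul_smul_comm, psi_smul]
  rcases hz a with rfl | rfl <;> rcases hz b with rfl | rfl
  · rw [psi_mul_of_even f.2, psi_mul_of_even k.2]
    simp [sgn, entry, mul_assoc]
  · rw [psi_mul_of_even f.2, psi_mul_of_odd k.2]
    simp [entry, mul_assoc]
    simp [sgn]
  · rw [psi_mul_of_odd f.2]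
    have : body (k.1 * g.val U 1 0 X Y) = psi k.1 * body (g.val U 1 0 X Y) := by
      rw [← body_eq_psi_of_even k.2]
      exact ContMDiffMap.ext fun e => map_mul ExteriorAlgebra.algebraMapInv _ _
    rw [this]
    simp [entry, mul_assoc]
    simp [sgn]
  · rw [psi_mul_of_odd f.2, body_mul_of_odd k.2]
    simp [entry]

/-- The sign of supersymmetry is nontrivial only when both arguments are odd, and there `entry` is
zero. -/
theorem entry_symm {p a b : ZMod 2} (g : RiemannianMetric H F E p) {U : Opens M}
    (X : SuperDer H F E a U) (Y : SuperDer H F E b U) :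
    entry p a b (g.val U a b X Y) = entry p b a (g.val U b a Y X) := by
  have hz : ∀ a : ZMod 2, a = 0 ∨ a = 1 := by decide
  rw [g.supersymm U a b]
  rcases hz a with rfl | rfl <;> rcases hz b with rfl | rfl <;> simp [entry, sgn]

/-! ### Local frames -/

variable (H F E) in
/-- A local frame over `U`: homogeneous coordinates `z m` of degree at most one on `ΠE`, with dual
superderivations that correspond under `Ψ` to derivations on `E`, such that superderivations and
derivations are determined by their values on the coordinates. -/
structure Frame {ι : Type*} [DecidableEq ι] (par : ι → ZMod 2) (U : Opens M) where
  z : ∀ m, superParity H F E (par m) U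
  z_affine : ∀ m, (z m).1 ∈ AffineSuper H F E U
  dz : ∀ m, SuperDer H F E (par m) U
  dz' : ι → DerSection (𝓘(ℝ, H).prod 𝓘(ℝ, F)) (preim F E U)
  isPsi : ∀ m, IsPsi (dz m) (dz' m)
  dz_z : ∀ m n, (dz m).act U le_rfl (z n).1 = if m = n then 1 else 0
  ext : ∀ (V : Opens M) (hV : V ≤ U) (X Y : SuperDer H F E 0 V),
    (∀ m, X.act V le_rfl (resSuper H F E hV (z m).1) =
      Y.act V le_rfl (resSuper H F E hV (z m).1)) → X = Y
  ext' : ∀ (V : Opens (TotalSpace F E)) (hV : V ≤ preim F E U)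
    (X Y : DerSection (𝓘(ℝ, H).prod 𝓘(ℝ, F)) V),
    (∀ m, X.act V le_rfl (resSmooth _ hV (psi (z m).1)) =
      Y.act V le_rfl (resSmooth _ hV (psi (z m).1))) → X = Y

namespace Frame

variable {ι : Type*} [DecidableEq ι] {par : ι → ZMod 2} {U : Opens M} (R : Frame H F E par U)

/-- The components of a derivation in a frame. -/
def comp {V : Opens (TotalSpace F E)} (hV : V ≤ preim F E U)
    (X : DerSection (𝓘(ℝ, H).prod 𝓘(ℝ, F)) V) (m : ι) : Smooth (𝓘(ℝ, H).prod 𝓘(ℝ, F)) V :=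
  X.act V le_rfl (resSmooth _ hV (psi (R.z m).1))

theorem dz'_z (m n : ι) :
    (R.dz' m).act (preim F E U) le_rfl (psi (R.z n).1) = if m = n then 1 else 0 := by
  have := (R.isPsi m).2 U le_rfl (R.z n).1 (R.z_affine n)
  rw [R.dz_z] at this
  refine this.trans ?_
  split_ifs
  · exact psi_one
  · exact psi_zero

/-- Both sides take the same values on the coordinates ψ(z_n) by duality, and `ext'` says that these
values suffice. V need not be the preimage of an open subset of M. -/
theorem eq_sum [Fintype ι] {V : Opens (TotalSpace F E)} (hV : V ≤ preim F E U)
    (X : DerSection (𝓘(ℝ, H).prod 𝓘(ℝ, F)) V) :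
    X = ∑ m, R.comp hV X m • (R.dz' m).res hV := by
  apply R.ext' V hV
  intro n
  rw [DerSection.sum_act]
  have : ∀ m, (R.comp hV X m • (R.dz' m).res hV).act V le_rfl
      (resSmooth _ hV (psi (R.z n).1)) = R.comp hV X m * if m = n then 1 else 0 := by
    intro m
    change R.comp hV X m * (R.dz' m).act V (le_rfl.trans hV) (resSmooth _ hV (psi (R.z n).1)) = _
    rw [← (R.dz' m).act_res _ _ le_rfl hV, R.dz'_z]
    split_ifs
    · rw [map_one]
    · rw [map_zero]
  simp only [this, mul_ite, mul_one, mul_zero, Finset.sum_ite_eq', Finset.mem_univ, if_true]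
  rfl

/-- The components of an even superderivation in a frame. -/
def superComp {V : Opens M} (hV : V ≤ U) (X : SuperDer H F E 0 V) (m : ι) :
    superParity H F E (par m) V :=
  ⟨X.act V le_rfl (resSuper H F E hV (R.z m).1), by
    have := X.parity V le_rfl _ _ (superParity_res hV (R.z m).2)
    rwa [zero_add] at this⟩

theorem super_eq_sum [Fintype ι] {V : Opens M} (hV : V ≤ U) (X : SuperDer H F E 0 V) :
    X = ∑ m, SuperDer.lsmul (CharTwo.add_self_eq_zero (par m)) (R.superComp hV X m)
      ((R.dz m).res hV) := by
  apply R.ext V hV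
  intro n
  rw [SuperDer.sum_act]
  have : ∀ m, (SuperDer.lsmul (CharTwo.add_self_eq_zero (par m)) (R.superComp hV X m)
      ((R.dz m).res hV)).act V le_rfl (resSuper H F E hV (R.z n).1) =
      (R.superComp hV X m).1 * if m = n then 1 else 0 := by
    intro m
    change (R.superComp hV X m).1 * (R.dz m).act V (le_rfl.trans hV)
      (resSuper H F E hV (R.z n).1) = _
    rw [← (R.dz m).act_res _ _ le_rfl hV, R.dz_z]
    split_ifs
    · rw [map_one]
    · rw [map_zero]
  simp only [this, mul_ite, mul_one, mul_zero, Finset.sum_ite_eq', Finset.mem_univ, if_true]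
  rfl

/-- Links the two expansions: the coordinates have degree at most one, so the relation Ψ identifies
the components of X' with the transported components of X. -/
theorem comp_of_isPsi {V : Opens M} (hV : V ≤ U) {X : SuperDer H F E 0 V}
    {X' : DerSection (𝓘(ℝ, H).prod 𝓘(ℝ, F)) (preim F E V)} (hX : IsPsi X X') (m : ι) :
    R.comp (preim_mono hV) X' m = psi (R.superComp hV X m).1 :=
  hX.2 V le_rfl _ (AffineSuper.res hV (R.z_affine m))

variable {p : ZMod 2} (g : RiemannianMetric H F E p)

/-- The transported form in a local frame. -/
def form [Fintype ι] : LocalForm (𝓘(ℝ, H).prod 𝓘(ℝ, F)) (preim F E U) where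
  val V hV X Y := ∑ m, ∑ n, R.comp hV X m * R.comp hV Y n *
    resSmooth _ hV (entry p (par m) (par n) (g.val U _ _ (R.dz m) (R.dz n)))
  res V V' hV h X Y := by
    simp only [map_sum, map_mul, comp, X.act_res, Y.act_res]
    rfl
  add_left V hV X X' Y := by
    have : ∀ m, R.comp hV (X + X') m = R.comp hV X m + R.comp hV X' m := fun m => rfl
    simp only [this, add_mul, Finset.sum_add_distrib]
  add_right V hV X Y Y' := by
    have : ∀ m, R.comp hV (Y + Y') m = R.comp hV Y m + R.comp hV Y' m := fun m => rfl
    simp only [this, add_mul, mul_add, Finset.sum_add_distrib]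
  smul_left V hV f X Y := by
    have : ∀ m, R.comp hV (f • X) m = f * R.comp hV X m := fun m => rfl
    simp only [this, Finset.mul_sum, mul_assoc]
  smul_right V hV f X Y := by
    have : ∀ m, R.comp hV (f • Y) m = f * R.comp hV Y m := fun m => rfl
    simp only [this, Finset.mul_sum, mul_assoc, mul_left_comm f]

theorem form_symm [Fintype ι] {V : Opens (TotalSpace F E)} (hV : V ≤ preim F E U)
    (X Y : DerSection (𝓘(ℝ, H).prod 𝓘(ℝ, F)) V) :
    (R.form g).val V hV X Y = (R.form g).val V hV Y X := by
  change ∑ m, ∑ n, _ = ∑ m, ∑ n, _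
  rw [Finset.sum_comm]
  refine Finset.sum_congr rfl fun m _ => Finset.sum_congr rfl fun n _ => ?_
  rw [entry_symm g, mul_comm (R.comp hV X n)]

/-- Both arguments of g are expanded in the frame. Each summand is a value at even products
X(z_m)∂_m and Y(z_n)∂_n, to which `psi_val_lsmul_lsmul` applies. -/
theorem form_transport [Fintype ι] {V : Opens M} (hV : V ≤ U)
    {X Y : SuperDer H F E 0 V}
    {X' Y' : DerSection (𝓘(ℝ, H).prod 𝓘(ℝ, F)) (preim F E V)} (hX : IsPsi X X')
    (hY : IsPsi Y Y') :
    (R.form g).val (preim F E V) (preim_mono hV) X' Y' = psi (g.val V 0 0 X Y) := by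
  conv_rhs => rw [R.super_eq_sum hV X, R.super_eq_sum hV Y]
  rw [g.sum_left, psi_sum]
  refine Finset.sum_congr rfl fun m _ => ?_
  rw [g.sum_right, psi_sum]
  refine Finset.sum_congr rfl fun n _ => ?_
  rw [psi_val_lsmul_lsmul, R.comp_of_isPsi hV hX, R.comp_of_isPsi hV hY, resSmooth_entry, g.res]

/-- The function by which a coordinate derivation is multiplied to become even. -/
def evenFactor (m : ι) : superParity H F E (par m) U :=
  if h : par m = 0 then ⟨1, by rw [h]; exact fun x => SetLike.GradedOne.one_mem⟩ else R.z m

theorem evenFactor_affine (m : ι) : (R.evenFactor m).1 ∈ AffineSuper H F E U := by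
  unfold evenFactor
  split_ifs
  · exact fun x => ⟨1, 0, by simp⟩
  · exact R.z_affine m

/-- The factor is 1 or a coordinate ζ with Dζ = 1 for the dual derivation D. If ζu = 0, applying D
gives ζ·Du + u = 0, and multiplying by u leaves u² = 0. No density argument on the zero set of ζ is
needed. -/
theorem psi_evenFactor_mul_cancel (m : ι) {f k : Smooth (𝓘(ℝ, H).prod 𝓘(ℝ, F)) (preim F E U)}
    (h : psi (R.evenFactor m).1 * f = psi (R.evenFactor m).1 * k) : f = k := by
  unfold evenFactor at h
  split_ifs at h with h0
  · rwa [psi_one, one_mul, one_mul] at h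
  · have h1 : psi (R.z m).1 * (f - k) = 0 := by rw [mul_sub, h, sub_self]
    have h2 := congrArg ((R.dz' m).act (preim F E U) le_rfl) h1
    rw [Derivation.leibniz, R.dz'_z, if_pos rfl, map_zero, smul_eq_mul, smul_eq_mul] at h2
    have h3 : (f - k) * (f - k) = 0 := by
      linear_combination (f - k) * h2 - (R.dz' m).act (preim F E U) le_rfl (f - k) * h1
    rw [← sub_eq_zero]
    ext e
    exact mul_self_eq_zero.1 (DFunLike.congr_fun h3 e)

/-- A form is determined by its values on the even derivations that correspond to even
superderivations. -/
theorem form_unique [Fintype ι] (R : Frame H F E par U)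
    {B B' : LocalForm (𝓘(ℝ, H).prod 𝓘(ℝ, F)) (preim F E U)}
    (h : ∀ (X Y : SuperDer H F E 0 U)
      (X' Y' : DerSection (𝓘(ℝ, H).prod 𝓘(ℝ, F)) (preim F E U)), IsPsi X X' → IsPsi Y Y' →
      B.val (preim F E U) le_rfl X' Y' = B'.val (preim F E U) le_rfl X' Y')
    {V : Opens (TotalSpace F E)} (hV : V ≤ preim F E U)
    (X Y : DerSection (𝓘(ℝ, H).prod 𝓘(ℝ, F)) V) : B.val V hV X Y = B'.val V hV X Y := by
  have key : ∀ m n, B.val (preim F E U) le_rfl (R.dz' m) (R.dz' n) =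
      B'.val (preim F E U) le_rfl (R.dz' m) (R.dz' n) := by
    intro m n
    -- The hypothesis speaks only of even superderivations, so each coordinate derivation is first
    -- multiplied by a factor of its own parity.
    have h1 := h _ _ _ _ ((R.isPsi m).lsmul _ (R.evenFactor_affine m))
      ((R.isPsi n).lsmul _ (R.evenFactor_affine n))
    rw [B.smul_left, B.smul_right, B'.smul_left, B'.smul_right] at h1
    exact R.psi_evenFactor_mul_cancel n (R.psi_evenFactor_mul_cancel m h1)
  rw [R.eq_sum hV X, R.eq_sum hV Y, B.sum_left, B'.sum_left]
  refine Finset.sum_congr rfl fun m _ => ?_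
  rw [B.sum_right, B'.sum_right]
  refine Finset.sum_congr rfl fun n _ => ?_
  rw [B.smul_left, B.smul_right, B'.smul_left, B'.smul_right]
  have h1 := congrArg (resSmooth _ hV) (key m n)
  rw [B.res, B'.res] at h1
  rw [h1]

end Frame

/-- The transport exists and is unique if there are frames over small open sets. -/
theorem exists_transport {ι : Type*} [DecidableEq ι] [Fintype ι] {par : ι → ZMod 2}
    (O : M → Opens M) (hO : ∀ x, x ∈ O x)
    (hR : ∀ (x : M) (U : Opens M), U ≤ O x → Nonempty (Frame H F E par U)) {p : ZMod 2}
    (g : RiemannianMetric H F E p) :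
    ∃ B : BilinearForm (𝓘(ℝ, H).prod 𝓘(ℝ, F)) (TotalSpace F E),
      B.IsSymm ∧ IsTransport g B ∧ IsExtendedByAuxiliary g B ∧
      ∀ B' : BilinearForm (𝓘(ℝ, H).prod 𝓘(ℝ, F)) (TotalSpace F E),
        IsTransport g B' → B' = B := by
  let R : ∀ x, Frame H F E par (O x) := fun x => (hR x (O x) le_rfl).some
  obtain ⟨B, hB⟩ := LocalForm.exists_glue (J := 𝓘(ℝ, H).prod 𝓘(ℝ, F))
    (fun e : TotalSpace F E => preim F E (O e.proj)) (fun e => hO e.proj)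
    (fun e => (R e.proj).form g) (by
      intro y y' V h h' X Y
      have hle : V ≤ preim F E (O y.proj ⊓ O y'.proj) := fun e he => ⟨h he, h' he⟩
      -- Over the intersection there is again a frame, and the two forms, built from different
      -- frames, both transport g there. Uniqueness forces them to agree.
      refine (hR y.proj (O y.proj ⊓ O y'.proj) inf_le_left).some.form_unique
        (B := ((R y.proj).form g).restrict (preim_mono inf_le_left))
        (B' := ((R y'.proj).form g).restrict (preim_mono inf_le_right)) ?_ hle X Y
      intro X Y X' Y' hX hY
      exact ((R y.proj).form_transport g inf_le_left hX hY).trans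
        ((R y'.proj).form_transport g inf_le_right hX hY).symm)
  have hT : IsTransport g B := by
    intro U X Y X' Y' hX hY
    rw [psi_pr]
    ext e
    have hU : U ⊓ O e.1.proj ≤ U := inf_le_left
    have h1 := hB e.1 (preim F E U) (preim F E (U ⊓ O e.1.proj)) (preim_mono hU)
      (preim_mono inf_le_right) X' Y'
    rw [(R e.1.proj).form_transport g inf_le_right (hX.res hU) (hY.res hU), ← g.res] at h1
    exact DFunLike.congr_fun h1 ⟨e.1, e.2, hO e.1.proj⟩
  refine ⟨B, ?_, hT, hT.isExtendedByAuxiliary, ?_⟩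
  · intro V X Y
    ext e
    have h1 := hB e.1 V (V ⊓ preim F E (O e.1.proj)) inf_le_left inf_le_right X Y
    have h2 := hB e.1 V (V ⊓ preim F E (O e.1.proj)) inf_le_left inf_le_right Y X
    rw [(R e.1.proj).form_symm g, ← h2] at h1
    exact DFunLike.congr_fun h1 ⟨e.1, e.2, hO e.1.proj⟩
  · intro B' hB'
    refine BilinearForm.ext (funext fun V => funext fun X => funext fun Y => ?_)
    ext e
    -- Uniqueness is local on the base: comparing the forms on preimages of frame domains is enough,
    -- because these cover the total space.
    have h1 := (R e.1.proj).form_unique (B := B'.toLocal _) (B' := B.toLocal _)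
      (fun X Y X' Y' hX hY => (hB' _ X Y X' Y' hX hY).trans (hT _ X Y X' Y' hX hY).symm)
      (V := V ⊓ preim F E (O e.1.proj)) inf_le_right (X.res inf_le_left) (Y.res inf_le_left)
    have h2 := (B'.res V _ inf_le_left X Y).trans (h1.trans (B.res V _ inf_le_left X Y).symm)
    exact DFunLike.congr_fun h2 ⟨e.1, e.2, hO e.1.proj⟩

end Super

/-! ### Hadamard's lemma -/

section Hadamard

universe u

variable {P : Type u} [NormedAddCommGroup P] [NormedSpace ℝ P] [FiniteDimensional ℝ P]

/-- Differentiating under the integral replaces the weight w(t) by t·w(t) and K by its derivative,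
an integral of the same shape. This is why the induction runs over all weights and all target
spaces. -/
theorem contDiff_integral_segment_nat (n : ℕ) : ∀ {Z : Type u} [NormedAddCommGroup Z]
    [NormedSpace ℝ Z] (p₀ : P) (w : ℝ → ℝ) (_ : Continuous w) (K : P → Z) (_ : ContDiff ℝ n K),
    ContDiff ℝ n (fun p => ∫ t in (0 : ℝ)..1, w t • K (p₀ + t • (p - p₀))) := by
  induction n with
  | zero =>
    intro Z _ _ p₀ w hw K hK
    rw [Nat.cast_zero, contDiff_zero] at hK ⊢
    apply intervalIntegral.continuous_parametric_intervalIntegral_of_continuous'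
    fun_prop
  | succ n ih =>
    intro Z _ _ p₀ w hw K hK
    rw [Nat.cast_succ] at hK ⊢
    obtain ⟨K', hK', hd⟩ := contDiff_succ_iff_hasFDerivAt.1 hK
    have hKc : Continuous K := hK.continuous
    have hK'c : Continuous K' := hK'.continuous
    refine contDiff_succ_iff_hasFDerivAt.2 ⟨fun p => ∫ t in (0 : ℝ)..1,
      (w t * t) • K' (p₀ + t • (p - p₀)), ih p₀ _ (by fun_prop) K' hK', fun p => ?_⟩
    -- The dominating constant is a bound for the derivative of the integrand on the compact set
    -- (closed unit ball at p) × [0, 1].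
    have hcont : Continuous fun q : P × ℝ => (w q.2 * q.2) • K' (p₀ + q.2 • (q.1 - p₀)) := by
      fun_prop
    obtain ⟨C, hC⟩ := ((isCompact_closedBall p 1).prod
      (isCompact_Icc (a := (0 : ℝ)) (b := 1))).exists_bound_of_continuousOn hcont.continuousOn
    refine (intervalIntegral.hasFDerivAt_integral_of_dominated_of_fderiv_le
      (F := fun p t => w t • K (p₀ + t • (p - p₀)))
      (F' := fun p t => (w t * t) • K' (p₀ + t • (p - p₀))) (bound := fun _ => C)
      (Metric.closedBall_mem_nhds p one_pos) ?_ ?_ ?_ ?_ ?_ ?_)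
    · refine Filter.Eventually.of_forall fun q => Continuous.aestronglyMeasurable ?_
      fun_prop
    · refine Continuous.intervalIntegrable ?_ _ _
      fun_prop
    · have : SecondCountableTopologyEither ℝ (P →L[ℝ] Z) :=
        secondCountableTopologyEither_of_left ℝ _
      refine Continuous.aestronglyMeasurable ?_
      fun_prop
    · refine Filter.Eventually.of_forall fun t ht q hq => hC (q, t) ⟨hq, ?_⟩
      rw [Set.uIoc_of_le zero_le_one] at ht
      exact ⟨ht.1.le, ht.2⟩
    · exact intervalIntegrable_const
    · refine Filter.Eventually.of_forall fun t _ q _ => ?_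
      have h1 : HasFDerivAt (fun q : P => p₀ + t • (q - p₀))
          (t • ContinuousLinearMap.id ℝ P) q :=
        (((hasFDerivAt_id q).sub_const p₀).const_smul t).const_add p₀
      have h2 := ((hd (p₀ + t • (q - p₀))).comp q h1).const_smul (w t)
      refine h2.congr_fderiv ?_
      ext v
      simp [mul_smul]

theorem contDiff_integral_segment {Z : Type u} [NormedAddCommGroup Z] [NormedSpace ℝ Z] (p₀ : P)
    {K : P → Z} (hK : ContDiff ℝ ∞ K) :
    ContDiff ℝ ∞ (fun p => ∫ t in (0 : ℝ)..1, K (p₀ + t • (p - p₀))) := by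
  rw [contDiff_infty]
  intro n
  have := contDiff_integral_segment_nat n p₀ (fun _ => 1) continuous_const K
    (hK.of_le (by exact_mod_cast le_top))
  simpa only [one_smul] using this

/-- **Hadamard's lemma**. -/
theorem exists_hadamard {f : P → ℝ} (hf : ContDiff ℝ ∞ f) (p₀ : P) :
    ∃ h : P → P →L[ℝ] ℝ, ContDiff ℝ ∞ h ∧ ∀ p, f p = f p₀ + h p (p - p₀) := by
  have hf' : ContDiff ℝ ∞ (fderiv ℝ f) := hf.fderiv_right (by simp)
  refine ⟨_, contDiff_integral_segment p₀ hf', fun p => ?_⟩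
  have hc : Continuous fun t : ℝ => fderiv ℝ f (p₀ + t • (p - p₀)) := by
    have := hf'.continuous
    fun_prop
  rw [ContinuousLinearMap.intervalIntegral_apply (hc.intervalIntegrable _ _)]
  -- The fundamental theorem of calculus along the segment from p₀ to p turns the integral of this
  -- derivative into f(p) - f(p₀).
  have hd : ∀ t ∈ Set.uIcc (0 : ℝ) 1, HasDerivAt (fun t : ℝ => f (p₀ + t • (p - p₀)))
      (fderiv ℝ f (p₀ + t • (p - p₀)) (p - p₀)) t := by
    intro t _
    have h1 : HasDerivAt (fun t : ℝ => p₀ + t • (p - p₀)) (p - p₀) t := by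
      simpa using ((hasDerivAt_id t).smul_const (p - p₀)).const_add p₀
    have h2 := (hf.differentiable (by simp) (p₀ + t • (p - p₀))).hasFDerivAt
    exact h2.comp_hasDerivAt t h1
  rw [intervalIntegral.integral_eq_sub_of_hasDerivAt hd
    (Continuous.intervalIntegrable (by fun_prop) _ _)]
  simp

/-- Hadamard's lemma for a function that is smooth on a neighbourhood of a point. -/
theorem exists_hadamard_local {f : P → ℝ} {S : Set P} {p₀ : P} (hS : S ∈ nhds p₀)
    (hf : ∀ p ∈ S, ContDiffAt ℝ ∞ f p) :
    ∃ h : P → P →L[ℝ] ℝ, ContDiff ℝ ∞ h ∧ ∀ᶠ p in nhds p₀, f p = f p₀ + h p (p - p₀) := by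
  obtain ⟨r, hr, hrS⟩ := Metric.nhds_basis_closedBall.mem_iff.1 hS
  -- A cutoff with support in S, equal to 1 near p₀, makes χ·f globally smooth without changing f
  -- near p₀.
  let χ : ContDiffBump p₀ := ⟨r / 2, r, half_pos hr, half_lt_self hr⟩
  have hg : ContDiff ℝ ∞ (fun p => χ p * f p) := by
    rw [contDiff_iff_contDiffAt]
    intro p
    by_cases hp : p ∈ Metric.closedBall p₀ r
    · exact χ.contDiff.contDiffAt.mul (hf p (hrS hp))
    · have hev : (fun p => χ p * f p) =ᶠ[nhds p] fun _ => 0 := by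
        filter_upwards [Metric.isClosed_closedBall.isOpen_compl.mem_nhds hp] with q hq
        rw [χ.zero_of_le_dist, zero_mul]
        have : ¬ dist q p₀ ≤ r := hq
        exact (not_le.1 this).le
      exact contDiffAt_const.congr_of_eventuallyEq hev
  obtain ⟨h, hh, hfh⟩ := exists_hadamard hg p₀
  refine ⟨h, hh, ?_⟩
  filter_upwards [χ.eventuallyEq_one] with p hp
  have h1 := hfh p
  have h2 : χ p₀ = 1 := χ.eventuallyEq_one.self_of_nhds
  rw [h2] at h1
  rw [hp] at h1
  simpa using h1

end Hadamard

/-! ### Coordinate derivations -/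

section Coordinates

set_option linter.unusedSectionVars false

variable {EN : Type*} [NormedAddCommGroup EN] [NormedSpace ℝ EN]
  {HN : Type*} [TopologicalSpace HN] {J : ModelWithCorners ℝ EN HN} [J.Boundaryless]
  {N : Type*} [TopologicalSpace N] [ChartedSpace HN N] [IsManifold J ∞ N]

variable (J) in
/-- The expression in the chart at `e₀` of a function defined on an open set. -/
def chartRep (e₀ : N) {V : Opens N} (f : V → ℝ) (p : EN) : ℝ :=
  Function.extend Subtype.val f 0 ((extChartAt J e₀).symm p)

variable (HN) in
/-- The domain of the chart at `e₀`. -/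
def chartDom (e₀ : N) : Opens N := ⟨(chartAt HN e₀).source, (chartAt HN e₀).open_source⟩

theorem contMDiffAt_extChartAt_of_le {e₀ : N} {V : Opens N} (hV : V ≤ chartDom HN e₀) (y : V) :
    ContMDiffAt J 𝓘(ℝ, EN) ∞ (fun z : V => extChartAt J e₀ z) y :=
  (contMDiffAt_subtype_iff (f := extChartAt J e₀)).2
    ((contMDiffOn_extChartAt (x := e₀)).contMDiffAt ((chartDom HN e₀).isOpen.mem_nhds (hV y.2)))

theorem mem_extChartAt_source_of_le {e₀ : N} {V : Opens N} (hV : V ≤ chartDom HN e₀) (y : V) :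
    (y : N) ∈ (extChartAt J e₀).source := by
  rw [extChartAt_source]
  exact hV y.2

theorem symm_extChartAt_of_le {e₀ : N} {V : Opens N} (hV : V ≤ chartDom HN e₀) (y : V) :
    (extChartAt J e₀).symm (extChartAt J e₀ y) = y :=
  (extChartAt J e₀).left_inv (mem_extChartAt_source_of_le hV y)

theorem chartRep_apply {e₀ : N} {V : Opens N} (hV : V ≤ chartDom HN e₀) (f : V → ℝ) (y : V) :
    chartRep J e₀ f (extChartAt J e₀ y) = f y := by
  rw [chartRep, symm_extChartAt_of_le hV, Subtype.val_injective.extend_apply]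

/-- The points of the chart that come from `V` form a neighbourhood of each of them. -/
theorem eventually_chart {e₀ : N} {V : Opens N} (hV : V ≤ chartDom HN e₀) (y : V) :
    ∀ᶠ p in nhds (extChartAt J e₀ y), p ∈ (extChartAt J e₀).target ∧
      (extChartAt J e₀).symm p ∈ V := by
  have h1 := mem_extChartAt_source_of_le (J := J) hV y
  have h2 := extChartAt_target_mem_nhds' ((extChartAt J e₀).map_source h1)
  have h3 : (extChartAt J e₀).symm ⁻¹' (V : Set N) ∈ nhds (extChartAt J e₀ y) := by
    apply (continuousAt_extChartAt_symm' h1).preimage_mem_nhds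
    rw [symm_extChartAt_of_le hV]
    exact V.isOpen.mem_nhds y.2
  filter_upwards [h2, h3] with p hp hp' using ⟨hp, hp'⟩

theorem chartRep_contDiffAt {e₀ : N} {V : Opens N} (f : Smooth J V) {p : EN}
    (hp : p ∈ (extChartAt J e₀).target) (hpV : (extChartAt J e₀).symm p ∈ V) :
    ContDiffAt ℝ ∞ (chartRep J e₀ f) p := by
  rw [← contMDiffAt_iff_contDiffAt]
  have h1 : ContMDiffAt J 𝓘(ℝ, ℝ) ∞ (Function.extend Subtype.val f 0) ((extChartAt J e₀).symm p) :=
    (contMDiffAt_extend_iff (y := ⟨_, hpV⟩)).2 f.contMDiff.contMDiffAt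
  exact h1.comp p ((contMDiffOn_extChartAt_symm e₀).contMDiffAt
    ((isOpen_extChartAt_target e₀).mem_nhds hp))

theorem chartRep_contDiffAt_apply {e₀ : N} {V : Opens N} (hV : V ≤ chartDom HN e₀)
    (f : Smooth J V) (y : V) : ContDiffAt ℝ ∞ (chartRep J e₀ f) (extChartAt J e₀ y) :=
  have h := (eventually_chart hV y).self_of_nhds
  chartRep_contDiffAt f h.1 h.2

/-- The derivative of a smooth function in a coordinate direction. -/
def coordDeriv (e₀ : N) (v : EN) {V : Opens N} (hV : V ≤ chartDom HN e₀) (f : Smooth J V) :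
    Smooth J V :=
  ⟨fun y => fderiv ℝ (chartRep J e₀ f) (extChartAt J e₀ y) v, fun y => by
    have h1 : ContDiffAt ℝ ∞ (fun p => fderiv ℝ (chartRep J e₀ f) p v) (extChartAt J e₀ y) :=
      ((chartRep_contDiffAt_apply hV f y).fderiv_right (by simp)).clm_apply contDiffAt_const
    exact (contMDiffAt_iff_contDiffAt.2 h1).comp y (contMDiffAt_extChartAt_of_le hV y)⟩

theorem coordDeriv_apply (e₀ : N) (v : EN) {V : Opens N} (hV : V ≤ chartDom HN e₀)
    (f : Smooth J V) (y : V) :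
    coordDeriv e₀ v hV f y = fderiv ℝ (chartRep J e₀ f) (extChartAt J e₀ y) v := rfl

/-- `chartRep` involves an extension by zero outside V. Only its germ at the image of y matters, so
any convenient G that represents f near that point may be differentiated instead. -/
theorem coordDeriv_apply_of_eq {e₀ : N} (v : EN) {V : Opens N} (hV : V ≤ chartDom HN e₀)
    {f : Smooth J V} {G : EN → ℝ} {y : V}
    (h : ∀ᶠ p in nhds (extChartAt J e₀ y), ∀ z : V, extChartAt J e₀ z = p → f z = G p) :
    coordDeriv e₀ v hV f y = fderiv ℝ G (extChartAt J e₀ y) v := by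
  rw [coordDeriv_apply]
  congr 1
  apply Filter.EventuallyEq.fderiv_eq
  filter_upwards [h, eventually_chart hV y] with p hp hpV
  have h1 := hp ⟨_, hpV.2⟩ ((extChartAt J e₀).right_inv hpV.1)
  rw [← h1, chartRep]
  exact Subtype.val_injective.extend_apply f 0 ⟨_, hpV.2⟩

theorem coordDeriv_res {e₀ : N} (v : EN) {V W : Opens N} (hV : V ≤ chartDom HN e₀) (h : W ≤ V)
    (f : Smooth J V) :
    resSmooth J h (coordDeriv e₀ v hV f) = coordDeriv e₀ v (h.trans hV) (resSmooth J h f) := by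
  ext y
  refine (coordDeriv_apply_of_eq v (h.trans hV) (Filter.Eventually.of_forall ?_)).symm
  rintro p z rfl
  exact (chartRep_apply hV f ⟨z.1, h z.2⟩).symm

/-- The coordinate derivation in the direction `v`. -/
def coordDerivation (e₀ : N) (v : EN) {V : Opens N} (hV : V ≤ chartDom HN e₀) :
    Derivation ℝ (Smooth J V) (Smooth J V) :=
  Derivation.mk'
    { toFun := coordDeriv e₀ v hV
      map_add' := fun f k => by
        ext y
        have hf := (chartRep_contDiffAt_apply hV f y).differentiableAt (by simp)
        have hk := (chartRep_contDiffAt_apply hV k y).differentiableAt (by simp)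
        rw [coordDeriv_apply_of_eq v hV (G := chartRep J e₀ f + chartRep J e₀ k)
          (Filter.Eventually.of_forall ?_), fderiv_add hf hk]
        · rfl
        · rintro p z rfl
          rw [Pi.add_apply, chartRep_apply hV, chartRep_apply hV]
          rfl
      map_smul' := fun r f => by
        ext y
        have hf := (chartRep_contDiffAt_apply hV f y).differentiableAt (by simp)
        rw [coordDeriv_apply_of_eq v hV (G := r • chartRep J e₀ f)
          (Filter.Eventually.of_forall ?_), fderiv_const_smul hf]
        · rfl
        · rintro p z rfl
          rw [Pi.smul_apply, chartRep_apply hV]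
          rfl }
    (fun f k => by
      ext y
      have hf := (chartRep_contDiffAt_apply hV f y).differentiableAt (by simp)
      have hk := (chartRep_contDiffAt_apply hV k y).differentiableAt (by simp)
      refine (coordDeriv_apply_of_eq v hV (G := chartRep J e₀ f * chartRep J e₀ k)
          (Filter.Eventually.of_forall ?_)).trans ?_
      · rintro p z rfl
        rw [Pi.mul_apply, chartRep_apply hV, chartRep_apply hV]
        rfl
      · rw [fderiv_mul hf hk, chartRep_apply hV, chartRep_apply hV]
        rfl)

variable (J) in
/-- The coordinate derivations as a section of the sheaf of derivations. -/
def coordDer (e₀ : N) (v : EN) {O : Opens N} (hO : O ≤ chartDom HN e₀) : DerSection J O where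
  act _ hW := coordDerivation e₀ v (hW.trans hO)
  act_res _ _ hW h f := coordDeriv_res v (hW.trans hO) h f

variable (J) in
/-- A linear coordinate function. -/
def coordFun (e₀ : N) (l : EN →L[ℝ] ℝ) {O : Opens N} (hO : O ≤ chartDom HN e₀) : Smooth J O :=
  ⟨fun y => l (extChartAt J e₀ y), fun y =>
    l.contMDiff.contMDiffAt.comp y (contMDiffAt_extChartAt_of_le hO y)⟩

theorem coordDeriv_coordFun (e₀ : N) (v : EN) (l : EN →L[ℝ] ℝ) {O : Opens N}
    (hO : O ≤ chartDom HN e₀) :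
    coordDeriv e₀ v hO (coordFun J e₀ l hO) = algebraMap ℝ _ (l v) := by
  ext y
  rw [coordDeriv_apply_of_eq v hO (G := l)
    (Filter.Eventually.of_forall (by rintro p z rfl; rfl)), l.fderiv]
  rfl

/-- **Hadamard's lemma** on a manifold. -/
theorem exists_hadamard_manifold [FiniteDimensional ℝ EN] {ι : Type*} [Fintype ι]
    (b : Module.Basis ι ℝ EN) {e₀ : N} {V : Opens N} (hV : V ≤ chartDom HN e₀) (f : Smooth J V)
    (y : V) :
    ∃ (W : Opens N) (h : W ≤ V) (_ : y.1 ∈ W) (k : ι → Smooth J W),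
      resSmooth J h f = algebraMap ℝ _ (f y) +
        ∑ i, (coordFun J e₀ (LinearMap.toContinuousLinearMap (b.coord i)) (h.trans hV) -
          algebraMap ℝ _ (b.coord i (extChartAt J e₀ y))) * k i := by
  obtain ⟨k, hk, hfk⟩ := exists_hadamard_local (eventually_chart hV y)
    (fun p hp => chartRep_contDiffAt f hp.1 hp.2)
  have h1 : ∀ᶠ z in nhds (y : N), z ∈ V ∧ chartRep J e₀ f (extChartAt J e₀ z) =
      chartRep J e₀ f (extChartAt J e₀ y) +
        k (extChartAt J e₀ z) (extChartAt J e₀ z - extChartAt J e₀ y) :=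
    (Filter.eventually_of_mem (V.isOpen.mem_nhds y.2) fun _ hz => hz).and
      ((continuousAt_extChartAt' (mem_extChartAt_source_of_le hV y)).eventually hfk)
  obtain ⟨W, hW, hWo, hyW⟩ := eventually_nhds_iff.1 h1
  let W' : Opens N := ⟨W, hWo⟩
  have hWV : W' ≤ V := fun z hz => (hW z hz).1
  have hsm : ∀ i, ContMDiff J 𝓘(ℝ, ℝ) ∞ (fun z : W' => k (extChartAt J e₀ z) (b i)) :=
    fun i z => ((hk.clm_apply contDiff_const).contMDiff.contMDiffAt).comp z
      (contMDiffAt_extChartAt_of_le (hWV.trans hV) z)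
  refine ⟨W', hWV, hyW, fun i => ⟨_, hsm i⟩, ?_⟩
  ext z
  have h2 := (hW z z.2).2
  rw [chartRep_apply hV f y, chartRep_apply hV f ⟨z.1, hWV z.2⟩] at h2
  refine h2.trans ?_
  rw [← b.sum_repr (extChartAt J e₀ z - extChartAt J e₀ y)]
  simp only [map_sum, map_smul, smul_eq_mul]
  have hval : ∀ (s : Finset ι) (q : ι → Smooth J W'), (∑ i ∈ s, q i) z = ∑ i ∈ s, q i z :=
    fun s q => map_sum (ContMDiffMap.evalRingHom z) q s
  refine Eq.trans ?_ (congrArg (f y + ·) (hval Finset.univ _).symm)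
  refine congrArg (f y + ·) ?_
  refine Finset.sum_congr rfl fun i _ => ?_
  rw [map_sub]
  rfl

/-- Derivations are determined by their values on the coordinates. -/
theorem derSection_ext [FiniteDimensional ℝ EN] {ι : Type*} [Fintype ι]
    (b : Module.Basis ι ℝ EN) {e₀ : N} {V : Opens N} (hV : V ≤ chartDom HN e₀)
    {X Y : DerSection J V}
    (h : ∀ i, X.act V le_rfl (coordFun J e₀ (LinearMap.toContinuousLinearMap (b.coord i)) hV) =
      Y.act V le_rfl (coordFun J e₀ (LinearMap.toContinuousLinearMap (b.coord i)) hV)) :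
    X = Y := by
  refine DerSection.ext (funext fun W => funext fun hW => Derivation.ext fun f => ?_)
  ext y
  obtain ⟨W', h', hy, k, hk⟩ := exists_hadamard_manifold b (hW.trans hV) f y
  -- In the Hadamard expansion of f at y, constants are killed and the factors "coordinate minus its
  -- value at y" vanish at y. What survives of Z(f)(y) involves Z only through its values on
  -- coordinates.
  have hval : ∀ Z : DerSection J V, Z.act W hW f y =
      ∑ i, k i ⟨y, hy⟩ * Z.act V le_rfl
        (coordFun J e₀ (LinearMap.toContinuousLinearMap (b.coord i)) hV) ⟨y, hW y.2⟩ := by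
    intro Z
    have h1 : Z.act W hW f y = Z.act W' (h'.trans hW) (resSmooth J h' f) ⟨y, hy⟩ := by
      rw [← Z.act_res W W' hW h' f]
      rfl
    rw [h1, hk, map_add, Derivation.map_algebraMap, zero_add, map_sum]
    refine (map_sum (ContMDiffMap.evalRingHom (⟨y, hy⟩ : W')) _ _).trans ?_
    refine Finset.sum_congr rfl fun i _ => ?_
    rw [Derivation.leibniz, map_sub, Derivation.map_algebraMap, sub_zero]
    have h2 := DFunLike.congr_fun (Z.act_res V W' le_rfl (h'.trans hW)
      (coordFun J e₀ (LinearMap.toContinuousLinearMap (b.coord i)) hV)) ⟨y, hy⟩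
    have h3 : (coordFun J e₀ (LinearMap.toContinuousLinearMap (b.coord i))
        (h'.trans (hW.trans hV)) - algebraMap ℝ _ (b.coord i (extChartAt J e₀ y)) :
        Smooth J W') ⟨y, hy⟩ = 0 := sub_self _
    rw [map_add, smul_eq_mul, smul_eq_mul, map_mul, map_mul]
    refine (congrArg₂ (· + ·) (congrArg (· * _) h3) (congrArg (_ * ·) h2.symm)).trans ?_
    rw [zero_mul, zero_add]
    rfl
  rw [hval X, hval Y]
  exact Finset.sum_congr rfl fun i _ => by rw [h i]

end Coordinates

section Super

set_option linter.unusedSectionVars false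

variable {H : Type*} [NormedAddCommGroup H] [NormedSpace ℝ H]
  {M : Type*} [TopologicalSpace M] [ChartedSpace H M]
  {F : Type*} [NormedAddCommGroup F] [NormedSpace ℝ F] [FiniteDimensional ℝ F]
  {E : M → Type*} [TopologicalSpace (TotalSpace F E)]
  [∀ x, AddCommGroup (E x)] [∀ x, Module ℝ (E x)] [∀ x, TopologicalSpace (E x)]
  [FiberBundle F E] [VectorBundle ℝ F E] [ContMDiffVectorBundle ∞ F E 𝓘(ℝ, H)]

/-! ### Coefficients of superfunctions in a fixed trivialization -/

theorem smooth_sum_apply {V : Opens M} {ι : Type*} (t : Finset ι) (q : ι → Smooth 𝓘(ℝ, H) V)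
    (x : V) : (∑ i ∈ t, q i) x = ∑ i ∈ t, q i x :=
  map_sum (ContMDiffMap.evalRingHom x) q t

variable (H F) in
/-- Smoothness at a point of a family of elements of the exterior algebra. -/
def CoefSmoothAt {V : Opens M} (S : V → ExteriorAlgebra ℝ (Module.Dual ℝ F)) (y : V) : Prop :=
  ∀ l : Module.Dual ℝ (ExteriorAlgebra ℝ (Module.Dual ℝ F)),
    ContMDiffAt 𝓘(ℝ, H) 𝓘(ℝ, ℝ) ∞ (fun x => l (S x)) y

theorem CoefSmoothAt.mul {V : Opens M} {S T : V → ExteriorAlgebra ℝ (Module.Dual ℝ F)} {y : V}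
    (hS : CoefSmoothAt H F S y) (hT : CoefSmoothAt H F T y) :
    CoefSmoothAt H F (fun x => S x * T x) y := by
  intro l
  let b := Module.finBasis ℝ (ExteriorAlgebra ℝ (Module.Dual ℝ F))
  have key : (fun x => l (S x * T x)) = fun x =>
      ∑ i, ∑ j, b.coord i (S x) * (b.coord j (T x) * l (b i * b j)) := by
    funext x
    conv_lhs => rw [← b.sum_repr (S x), ← b.sum_repr (T x)]
    simp only [Finset.sum_mul_sum, map_sum, smul_mul_smul_comm, map_smul, smul_eq_mul,
      Module.Basis.coord_apply, mul_assoc]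
  rw [key]
  exact ContMDiffAt.sum fun i _ => ContMDiffAt.sum fun j _ =>
    (hS _).mul ((hT _).mul contMDiffAt_const)

/-- Induction over the exterior algebra: on generators the expression is linear in A, and products
are handled by `CoefSmoothAt.mul`. -/
theorem CoefSmoothAt.map_dual_const {V : Opens M} {A : V → F →L[ℝ] F} {y : V}
    (hA : ContMDiffAt 𝓘(ℝ, H) 𝓘(ℝ, F →L[ℝ] F) ∞ A y)
    (u : ExteriorAlgebra ℝ (Module.Dual ℝ F)) :
    CoefSmoothAt H F (fun x => ExteriorAlgebra.map (A x).toLinearMap.dualMap u) y := by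
  induction u using ExteriorAlgebra.induction with
  | algebraMap r =>
    intro l
    simp only [AlgHom.commutes]
    exact contMDiffAt_const
  | ι w =>
    intro l
    let φ : (F →L[ℝ] F) →ₗ[ℝ] ℝ :=
      { toFun := fun B => l (ExteriorAlgebra.ι ℝ (w.comp B.toLinearMap))
        map_add' := fun B B' => by
          rw [← map_add, ← map_add, ← LinearMap.comp_add]
          rfl
        map_smul' := fun r B => by
          rw [RingHom.id_apply, ← map_smul, ← map_smul, ← LinearMap.comp_smul]
          rfl }
    have h1 : (fun x => l (ExteriorAlgebra.map (A x).toLinearMap.dualMap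
        (ExteriorAlgebra.ι ℝ w))) = fun x => LinearMap.toContinuousLinearMap φ (A x) := by
      funext x
      rw [ExteriorAlgebra.map_apply_ι]
      rfl
    rw [h1]
    exact (LinearMap.toContinuousLinearMap φ).contMDiff.contMDiffAt.comp y hA
  | mul u v hu hv =>
    simp only [map_mul]
    exact hu.mul hv
  | add u v hu hv =>
    intro l
    simp only [map_add]
    exact (hu l).add (hv l)

theorem CoefSmoothAt.map_dual {V : Opens M} {A : V → F →L[ℝ] F} {y : V}
    (hA : ContMDiffAt 𝓘(ℝ, H) 𝓘(ℝ, F →L[ℝ] F) ∞ A y)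
    {S : V → ExteriorAlgebra ℝ (Module.Dual ℝ F)} (hS : CoefSmoothAt H F S y) :
    CoefSmoothAt H F (fun x => ExteriorAlgebra.map (A x).toLinearMap.dualMap (S x)) y := by
  intro l
  let b := Module.finBasis ℝ (ExteriorAlgebra ℝ (Module.Dual ℝ F))
  have key : (fun x => l (ExteriorAlgebra.map (A x).toLinearMap.dualMap (S x))) = fun x =>
      ∑ i, b.coord i (S x) * l (ExteriorAlgebra.map (A x).toLinearMap.dualMap (b i)) := by
    funext x
    conv_lhs => rw [← b.sum_repr (S x)]
    simp only [map_sum, map_smul, smul_eq_mul, Module.Basis.coord_apply]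
  rw [key]
  exact ContMDiffAt.sum fun i _ => (hS _).mul (CoefSmoothAt.map_dual_const hA (b i) l)

/-- The inverse of `localRep`. -/
def localInv (F : Type*) [NormedAddCommGroup F] [NormedSpace ℝ F] (E : M → Type*)
    [TopologicalSpace (TotalSpace F E)] [∀ x, AddCommGroup (E x)] [∀ x, Module ℝ (E x)]
    [∀ x, TopologicalSpace (E x)] [FiberBundle F E] [VectorBundle ℝ F E] (x₀ x : M) :
    ExteriorAlgebra ℝ (Module.Dual ℝ F) →ₐ[ℝ] ExtFib E x :=
  ExteriorAlgebra.map ((trivializationAt F E x₀).linearMapAt ℝ x).dualMap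

variable (F E) in
/-- The domain of the trivialization around `x₀`. -/
def trivDom (x₀ : M) : Opens M :=
  ⟨(trivializationAt F E x₀).baseSet, (trivializationAt F E x₀).open_baseSet⟩

theorem localRep_localInv {x₀ x : M} (hx : x ∈ trivDom F E x₀)
    (u : ExteriorAlgebra ℝ (Module.Dual ℝ F)) : localRep F E x₀ x (localInv F E x₀ x u) = u := by
  have h : (localRep F E x₀ x).comp (localInv F E x₀ x) = AlgHom.id ℝ _ := by
    rw [localRep, localInv, ExteriorAlgebra.map_comp_map, LinearMap.dualMap_comp_dualMap]
    have : (trivializationAt F E x₀).linearMapAt ℝ x ∘ₗ (trivializationAt F E x₀).symmₗ ℝ x =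
        LinearMap.id := LinearMap.ext fun v =>
      (trivializationAt F E x₀).linearMapAt_symmₗ hx v
    rw [this, LinearMap.dualMap_id, ExteriorAlgebra.map_id]
  exact DFunLike.congr_fun h u

theorem localInv_localRep {x₀ x : M} (hx : x ∈ trivDom F E x₀)
    (u : ExtFib E x) : localInv F E x₀ x (localRep F E x₀ x u) = u := by
  have h : (localInv F E x₀ x).comp (localRep F E x₀ x) = AlgHom.id ℝ _ := by
    rw [localRep, localInv, ExteriorAlgebra.map_comp_map, LinearMap.dualMap_comp_dualMap]
    have : (trivializationAt F E x₀).symmₗ ℝ x ∘ₗ (trivializationAt F E x₀).linearMapAt ℝ x =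
        LinearMap.id := LinearMap.ext fun v =>
      (trivializationAt F E x₀).symmₗ_linearMapAt hx v
    rw [this, LinearMap.dualMap_id, ExteriorAlgebra.map_id]
  exact DFunLike.congr_fun h u

/-- Writing the inverse of the second trivialization as the inverse of the first composed with the
coordinate change, and dualizing, reverses the order of composition. The coordinate change therefore
goes from x₂ to x₁. -/
theorem localRep_change {x₁ x₂ x : M} (h₁ : x ∈ trivDom F E x₁) (h₂ : x ∈ trivDom F E x₂)
    (u : ExtFib E x) :
    localRep F E x₂ x u = ExteriorAlgebra.map
      (((trivializationAt F E x₂).coordChangeL ℝ (trivializationAt F E x₁) x :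
        F →L[ℝ] F)).toLinearMap.dualMap (localRep F E x₁ x u) := by
  have h : localRep F E x₂ x = (ExteriorAlgebra.map
      (((trivializationAt F E x₂).coordChangeL ℝ (trivializationAt F E x₁) x :
        F →L[ℝ] F)).toLinearMap.dualMap).comp (localRep F E x₁ x) := by
    rw [localRep, localRep, ExteriorAlgebra.map_comp_map, LinearMap.dualMap_comp_dualMap]
    congr 2
    ext v
    have h1 := (trivializationAt F E x₁).symmₗ_linearMapAt (R := ℝ) h₁
      ((trivializationAt F E x₂).symmₗ ℝ x v)
    rw [← h1]
    simp only [LinearMap.comp_apply]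
    congr 1
    rw [Trivialization.coe_linearMapAt_of_mem _ h₁, Trivialization.symmₗ_apply _ h₂]
    exact (Trivialization.coordChangeL_apply (R := ℝ) (trivializationAt F E x₂)
      (trivializationAt F E x₁) ⟨h₂, h₁⟩ v).symm
  exact DFunLike.congr_fun h u

theorem contMDiffAt_coordChange_subtype {V : Opens M} {x₁ x₂ : M} {y : V}
    (h₁ : (y : M) ∈ trivDom F E x₁) (h₂ : (y : M) ∈ trivDom F E x₂) :
    ContMDiffAt 𝓘(ℝ, H) 𝓘(ℝ, F →L[ℝ] F) ∞ (fun x : V =>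
      ((trivializationAt F E x₂).coordChangeL ℝ (trivializationAt F E x₁) (x : M) :
        F →L[ℝ] F)) y :=
  (contMDiffAt_subtype_iff (f := fun x : M =>
    ((trivializationAt F E x₂).coordChangeL ℝ (trivializationAt F E x₁) x : F →L[ℝ] F))).2
    (contMDiffAt_coordChangeL h₂ h₁)

theorem eventually_mem_trivDom {V : Opens M} {x₁ : M} {y : V}
    (h₁ : (y : M) ∈ trivDom F E x₁) : ∀ᶠ x : V in nhds y, (x : M) ∈ trivDom F E x₁ :=
  continuous_subtype_val.continuousAt.eventually ((trivDom F E x₁).isOpen.mem_nhds h₁)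

/-- The coefficients of a superfunction in a fixed trivialization are smooth. -/
theorem coefSmoothAt_localRep {x₀ : M} {V : Opens M} (hV : V ≤ trivDom F E x₀)
    (s : SuperFun H F E V) (y : V) :
    CoefSmoothAt H F (fun x : V => localRep F E x₀ x (s.1 x)) y := by
  have hy : (y : M) ∈ trivDom F E (y : M) := mem_baseSet_trivializationAt F E (y : M)
  intro l
  refine (CoefSmoothAt.map_dual (contMDiffAt_coordChange_subtype hy (hV y.2)) (s.2 y)
    l).congr_of_eventuallyEq ?_
  filter_upwards [eventually_mem_trivDom hy] with x hx
  rw [← localRep_change hx (hV x.2)]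

/-- Smoothness of a section is defined with the trivialization centred at each point, whereas
constructions use a fixed one around x₀. The smooth coordinate change bridges the two. -/
theorem isSmoothSection_localInv {x₀ : M} {V : Opens M} (hV : V ≤ trivDom F E x₀)
    {S : V → ExteriorAlgebra ℝ (Module.Dual ℝ F)} (hS : ∀ y, CoefSmoothAt H F S y) :
    IsSmoothSection H F E (fun x : V => localInv F E x₀ x (S x)) := by
  intro y l
  have hy : (y : M) ∈ trivDom F E (y : M) := mem_baseSet_trivializationAt F E (y : M)
  refine (CoefSmoothAt.map_dual (contMDiffAt_coordChange_subtype (hV y.2) hy) (hS y)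
    l).congr_of_eventuallyEq ?_
  filter_upwards [eventually_mem_trivDom hy] with x hx
  rw [localRep_change (hV x.2) hx, localRep_localInv (hV x.2)]

/-- A coefficient of a superfunction. -/
def coef {x₀ : M} {V : Opens M} (hV : V ≤ trivDom F E x₀)
    (l : Module.Dual ℝ (ExteriorAlgebra ℝ (Module.Dual ℝ F))) :
    SuperFun H F E V →ₗ[ℝ] Smooth 𝓘(ℝ, H) V where
  toFun s := ⟨fun x => l (localRep F E x₀ x (s.1 x)), fun y => coefSmoothAt_localRep hV s y l⟩
  map_add' s t := by
    ext x
    change l (localRep F E x₀ x (s.1 x + t.1 x)) = l _ + l _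
    rw [map_add, map_add]
  map_smul' r s := by
    ext x
    change l (localRep F E x₀ x (r • s.1 x)) = r • l _
    rw [map_smul, map_smul]

variable (H E) in
/-- The superfunctions that are constant in the trivialization around `x₀`. -/
def constSuper {x₀ : M} {V : Opens M} (hV : V ≤ trivDom F E x₀) :
    ExteriorAlgebra ℝ (Module.Dual ℝ F) →ₐ[ℝ] SuperFun H F E V where
  toFun u := ⟨fun x => localInv F E x₀ x u,
    isSmoothSection_localInv hV fun _ _ => contMDiffAt_const⟩
  map_one' := Subtype.ext (funext fun _ => map_one _)
  map_mul' _ _ := Subtype.ext (funext fun _ => map_mul _ _ _)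
  map_zero' := Subtype.ext (funext fun _ => map_zero _)
  map_add' _ _ := Subtype.ext (funext fun _ => map_add _ _ _)
  commutes' _ := Subtype.ext (funext fun _ => AlgHom.commutes _ _)

/-- Linear forms separate points of the exterior algebra and `localRep` is invertible here.
Identities of superfunctions thereby reduce to identities of smooth functions on the base. -/
theorem superFun_ext {x₀ : M} {V : Opens M} (hV : V ≤ trivDom F E x₀) {s t : SuperFun H F E V}
    (h : ∀ l, coef hV l s = coef hV l t) : s = t := by
  refine Subtype.ext (funext fun x => ?_)
  rw [← localInv_localRep (hV x.2) (s.1 x), ← localInv_localRep (hV x.2) (t.1 x)]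
  congr 1
  rw [← sub_eq_zero, ← Module.forall_dual_apply_eq_zero_iff ℝ]
  intro l
  rw [map_sub, sub_eq_zero]
  exact DFunLike.congr_fun (h l) x

theorem coef_ofSmooth_mul_const {x₀ : M} {V : Opens M} (hV : V ≤ trivDom F E x₀)
    (l : Module.Dual ℝ (ExteriorAlgebra ℝ (Module.Dual ℝ F))) (f : Smooth 𝓘(ℝ, H) V)
    (u : ExteriorAlgebra ℝ (Module.Dual ℝ F)) :
    coef hV l (ofSmooth F E f * constSuper H E hV u) = l u • f := by
  ext x
  change l (localRep F E x₀ x (algebraMap ℝ _ (f x) * localInv F E x₀ x u)) = l u * f x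
  rw [map_mul, AlgHom.commutes, localRep_localInv (hV x.2), ← Algebra.smul_def, map_smul,
    smul_eq_mul, mul_comm]

/-- The superfunction with given coefficients with respect to a family of constant ones. -/
theorem coef_sum {x₀ : M} {V : Opens M} (hV : V ≤ trivDom F E x₀)
    (l : Module.Dual ℝ (ExteriorAlgebra ℝ (Module.Dual ℝ F))) {ι : Type*} (t : Finset ι)
    (f : ι → Smooth 𝓘(ℝ, H) V) (u : ι → ExteriorAlgebra ℝ (Module.Dual ℝ F)) :
    coef hV l (∑ k ∈ t, ofSmooth F E (f k) * constSuper H E hV (u k)) =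
      ∑ k ∈ t, l (u k) • f k := by
  rw [map_sum]
  exact Finset.sum_congr rfl fun k _ => coef_ofSmooth_mul_const hV l _ _

variable (F) in
/-- A basis of the exterior algebra of the dual of the fibre. -/
def extBasis : Module.Basis (Fin (Module.finrank ℝ (ExteriorAlgebra ℝ (Module.Dual ℝ F)))) ℝ
    (ExteriorAlgebra ℝ (Module.Dual ℝ F)) :=
  Module.finBasis ℝ (ExteriorAlgebra ℝ (Module.Dual ℝ F))

theorem coef_eq_sum {x₀ : M} {V : Opens M} (hV : V ≤ trivDom F E x₀)
    (l : Module.Dual ℝ (ExteriorAlgebra ℝ (Module.Dual ℝ F))) (s : SuperFun H F E V) :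
    coef hV l s = ∑ k, l (extBasis F k) • coef hV ((extBasis F).coord k) s := by
  ext x
  rw [smooth_sum_apply]
  change l (localRep F E x₀ x (s.1 x)) =
    ∑ k, l (extBasis F k) * (extBasis F).coord k (localRep F E x₀ x (s.1 x))
  conv_lhs => rw [← (extBasis F).sum_repr (localRep F E x₀ x (s.1 x))]
  simp only [map_sum, map_smul, smul_eq_mul, Module.Basis.coord_apply]
  exact Finset.sum_congr rfl fun k _ => mul_comm _ _

theorem super_eq_sum_const {x₀ : M} {V : Opens M} (hV : V ≤ trivDom F E x₀)
    (s : SuperFun H F E V) :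
    s = ∑ k, ofSmooth F E (coef hV ((extBasis F).coord k) s) *
      constSuper H E hV (extBasis F k) := by
  refine superFun_ext hV fun l => ?_
  rw [coef_sum, coef_eq_sum]

theorem coef_mul {x₀ : M} {V : Opens M} (hV : V ≤ trivDom F E x₀)
    (l : Module.Dual ℝ (ExteriorAlgebra ℝ (Module.Dual ℝ F))) (s t : SuperFun H F E V) :
    coef hV l (s * t) = ∑ i, ∑ j, l (extBasis F i * extBasis F j) •
      (coef hV ((extBasis F).coord i) s * coef hV ((extBasis F).coord j) t) := by
  ext x
  simp only [smooth_sum_apply]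
  change l (localRep F E x₀ x (s.1 x * t.1 x)) =
    ∑ i, ∑ j, l (extBasis F i * extBasis F j) *
      ((extBasis F).coord i (localRep F E x₀ x (s.1 x)) *
        (extBasis F).coord j (localRep F E x₀ x (t.1 x)))
  rw [map_mul]
  conv_lhs => rw [← (extBasis F).sum_repr (localRep F E x₀ x (s.1 x)),
    ← (extBasis F).sum_repr (localRep F E x₀ x (t.1 x))]
  simp only [Finset.sum_mul_sum, map_sum, smul_mul_smul_comm, map_smul, smul_eq_mul,
    Module.Basis.coord_apply]
  exact Finset.sum_congr rfl fun i _ => Finset.sum_congr rfl fun j _ => mul_comm _ _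

end Super

/-! ### Parity and contraction in the exterior algebra. -/

section Exterior

variable {A : Type*} [AddCommGroup A] [Module ℝ A]

/-- Contracting ι a · ι b · x gives terms in which one of the two generators is removed, and a term
ι a · ι b times the contraction of x. All have parity opposite to that of x. -/
theorem contractLeft_mem_extParity (d : Module.Dual ℝ A) {c : ZMod 2} {u : ExteriorAlgebra ℝ A}
    (hu : u ∈ extParity A c) :
    CliffordAlgebra.contractLeft (Q := (0 : QuadraticForm ℝ A)) d u ∈ extParity A (1 + c) := by
  have hz : ∀ a : ZMod 2, a = 0 ∨ a = 1 := by decide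
  refine CliffordAlgebra.evenOdd_induction (0 : QuadraticForm ℝ A) c
    (motive := fun u _ => CliffordAlgebra.contractLeft (Q := (0 : QuadraticForm ℝ A)) d u ∈
      extParity A (1 + c)) ?_ ?_ ?_ u hu
  · intro w hw
    rcases hz c with rfl | rfl
    · obtain ⟨r, rfl⟩ := Submodule.mem_one.mp (by rwa [ZMod.val_zero, pow_zero] at hw)
      rw [CliffordAlgebra.contractLeft_algebraMap]
      exact Submodule.zero_mem _
    · rw [ZMod.val_one, pow_one] at hw
      obtain ⟨a, rfl⟩ := hw
      rw [CliffordAlgebra.contractLeft_ι]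
      exact algebraMap_mem_extParity _
  · intro x y _ _ hx hy
    rw [map_add]
    exact Submodule.add_mem _ hx hy
  · intro a b x hx hdx
    have hmul : ∀ (m : A) {e : ZMod 2} {w : ExteriorAlgebra ℝ A}, w ∈ extParity A e →
        ExteriorAlgebra.ι ℝ m * w ∈ extParity A (1 + e) := fun m _ _ hw =>
      SetLike.mul_mem_graded (ι_mem_extParity m) hw
    rw [mul_assoc, CliffordAlgebra.contractLeft_ι_mul, CliffordAlgebra.contractLeft_ι_mul, mul_sub,
      mul_smul_comm]
    refine Submodule.sub_mem _ (Submodule.smul_mem _ _ (hmul b hx))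
      (Submodule.sub_mem _ (Submodule.smul_mem _ _ (hmul a hx)) ?_)
    have := hmul a (hmul b hdx)
    rwa [← add_assoc, CharTwo.add_self_eq_zero, zero_add] at this

theorem map_mem_extParity {A' : Type*} [AddCommGroup A'] [Module ℝ A'] (f : A →ₗ[ℝ] A')
    {c : ZMod 2} {u : ExteriorAlgebra ℝ A} (hu : u ∈ extParity A c) :
    ExteriorAlgebra.map f u ∈ extParity A' c := by
  have hz : ∀ a : ZMod 2, a = 0 ∨ a = 1 := by decide
  refine CliffordAlgebra.evenOdd_induction (0 : QuadraticForm ℝ A) c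
    (motive := fun u _ => ExteriorAlgebra.map f u ∈ extParity A' c) ?_ ?_ ?_ u hu
  · intro w hw
    rcases hz c with rfl | rfl
    · obtain ⟨r, rfl⟩ := Submodule.mem_one.mp (by rwa [ZMod.val_zero, pow_zero] at hw)
      rw [AlgHom.commutes]
      exact algebraMap_mem_extParity r
    · rw [ZMod.val_one, pow_one] at hw
      obtain ⟨a, rfl⟩ := hw
      exact (ExteriorAlgebra.map_apply_ι f a).symm ▸ ι_mem_extParity (f a)
  · intro x y _ _ hx hy
    rw [map_add]
    exact Submodule.add_mem _ hx hy
  · intro a b x _ hx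
    have h : ExteriorAlgebra.map f (ExteriorAlgebra.ι ℝ a * ExteriorAlgebra.ι ℝ b * x) ∈
        extParity A' (1 + 1 + c) := by
      rw [map_mul, map_mul, ExteriorAlgebra.map_apply_ι, ExteriorAlgebra.map_apply_ι]
      exact SetLike.mul_mem_graded
        (SetLike.mul_mem_graded (ι_mem_extParity _) (ι_mem_extParity _)) hx
    rwa [CharTwo.add_self_eq_zero, zero_add] at h

/-- The contraction with a linear form is an odd derivation of the exterior algebra. -/
theorem contractLeft_mul_of_mem (d : Module.Dual ℝ A) {c : ZMod 2} {u : ExteriorAlgebra ℝ A}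
    (hu : u ∈ extParity A c) (v : ExteriorAlgebra ℝ A) :
    CliffordAlgebra.contractLeft (Q := (0 : QuadraticForm ℝ A)) d (u * v) =
      CliffordAlgebra.contractLeft (Q := (0 : QuadraticForm ℝ A)) d u * v +
      sgn (1 * c) • (u * CliffordAlgebra.contractLeft (Q := (0 : QuadraticForm ℝ A)) d v) := by
  have hz : ∀ a : ZMod 2, a = 0 ∨ a = 1 := by decide
  refine CliffordAlgebra.evenOdd_induction (0 : QuadraticForm ℝ A) c
    (motive := fun u _ => CliffordAlgebra.contractLeft (Q := (0 : QuadraticForm ℝ A)) d (u * v) =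
      CliffordAlgebra.contractLeft (Q := (0 : QuadraticForm ℝ A)) d u * v +
      sgn (1 * c) • (u * CliffordAlgebra.contractLeft (Q := (0 : QuadraticForm ℝ A)) d v))
    ?_ ?_ ?_ u hu
  · intro w hw
    rcases hz c with rfl | rfl
    · obtain ⟨r, rfl⟩ := Submodule.mem_one.mp (by rwa [ZMod.val_zero, pow_zero] at hw)
      rw [CliffordAlgebra.contractLeft_algebraMap_mul, CliffordAlgebra.contractLeft_algebraMap]
      simp [sgn]
    · rw [ZMod.val_one, pow_one] at hw
      obtain ⟨a, rfl⟩ := hw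
      rw [CliffordAlgebra.contractLeft_ι_mul, CliffordAlgebra.contractLeft_ι, ← Algebra.smul_def]
      simp [sgn, sub_eq_add_neg]
  · intro x y _ _ hx hy
    rw [add_mul, map_add, hx, hy, map_add, add_mul, add_mul, smul_add]
    abel
  · intro a b x _ hx
    rw [mul_assoc, mul_assoc, CliffordAlgebra.contractLeft_ι_mul,
      CliffordAlgebra.contractLeft_ι_mul, hx, mul_assoc, CliffordAlgebra.contractLeft_ι_mul,
      CliffordAlgebra.contractLeft_ι_mul]
    simp only [mul_sub, sub_mul, mul_add, mul_smul_comm, smul_mul_assoc, mul_assoc]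
    abel

end Exterior

section Super

set_option linter.unusedSectionVars false

variable {H : Type*} [NormedAddCommGroup H] [NormedSpace ℝ H]
  {M : Type*} [TopologicalSpace M] [ChartedSpace H M]
  {F : Type*} [NormedAddCommGroup F] [NormedSpace ℝ F] [FiniteDimensional ℝ F]
  {E : M → Type*} [TopologicalSpace (TotalSpace F E)]
  [∀ x, AddCommGroup (E x)] [∀ x, Module ℝ (E x)] [∀ x, TopologicalSpace (E x)]
  [FiberBundle F E] [VectorBundle ℝ F E] [ContMDiffVectorBundle ∞ F E 𝓘(ℝ, H)]

/-! ### Coordinate superderivations -/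

theorem mem_superParity_iff_localRep {x₀ : M} {V : Opens M} (hV : V ≤ trivDom F E x₀) {c : ZMod 2}
    {s : SuperFun H F E V} : s ∈ superParity H F E c V ↔
      ∀ x : V, localRep F E x₀ x (s.1 x) ∈ extParity (Module.Dual ℝ F) c := by
  refine ⟨fun h x => map_mem_extParity _ (h x), fun h x => ?_⟩
  rw [← localInv_localRep (hV x.2) (s.1 x)]
  exact map_mem_extParity _ (h x)

theorem constSuper_mem_superParity {x₀ : M} {V : Opens M} (hV : V ≤ trivDom F E x₀) {c : ZMod 2}
    {u : ExteriorAlgebra ℝ (Module.Dual ℝ F)} (hu : u ∈ extParity (Module.Dual ℝ F) c) :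
    constSuper H E hV u ∈ superParity H F E c V := fun _ => map_mem_extParity _ hu

theorem ofSmooth_one {V : Opens M} : ofSmooth F E (1 : Smooth 𝓘(ℝ, H) V) = 1 :=
  Subtype.ext (funext fun _ => map_one _)

theorem ofSmooth_zero {V : Opens M} : ofSmooth F E (0 : Smooth 𝓘(ℝ, H) V) = 0 :=
  Subtype.ext (funext fun _ => map_zero _)

theorem coef_ofSmooth {x₀ : M} {V : Opens M} (hV : V ≤ trivDom F E x₀)
    (l : Module.Dual ℝ (ExteriorAlgebra ℝ (Module.Dual ℝ F))) (f : Smooth 𝓘(ℝ, H) V) :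
    coef hV l (ofSmooth F E f) = l 1 • f := by
  rw [← coef_ofSmooth_mul_const hV, map_one, mul_one]

theorem derivation_smul {V : Opens M} (D : Derivation ℝ (Smooth 𝓘(ℝ, H) V) (Smooth 𝓘(ℝ, H) V))
    (r : ℝ) (f : Smooth 𝓘(ℝ, H) V) : D (r • f) = r • D f :=
  D.toLinearMap.map_smul r f

variable (E) in
/-- The extension of a derivation of the functions of the base to superfunctions, by acting on the
coefficients in a trivialization. -/
def evenExt {x₀ : M} {V : Opens M} (hV : V ≤ trivDom F E x₀)
    (D : Derivation ℝ (Smooth 𝓘(ℝ, H) V) (Smooth 𝓘(ℝ, H) V)) :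
    SuperFun H F E V →ₗ[ℝ] SuperFun H F E V where
  toFun s := ∑ k, ofSmooth F E (D (coef hV ((extBasis F).coord k) s)) *
    constSuper H E hV (extBasis F k)
  map_add' s t := by
    refine superFun_ext hV fun l => ?_
    simp only [map_add, coef_sum, smul_add, Finset.sum_add_distrib]
  map_smul' r s := by
    refine superFun_ext hV fun l => ?_
    rw [RingHom.id_apply, map_smul, coef_sum, coef_sum, Finset.smul_sum]
    refine Finset.sum_congr rfl fun k _ => ?_
    rw [map_smul, derivation_smul, smul_comm]

theorem coef_evenExt {x₀ : M} {V : Opens M} (hV : V ≤ trivDom F E x₀)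
    (D : Derivation ℝ (Smooth 𝓘(ℝ, H) V) (Smooth 𝓘(ℝ, H) V))
    (l : Module.Dual ℝ (ExteriorAlgebra ℝ (Module.Dual ℝ F))) (s : SuperFun H F E V) :
    coef hV l (evenExt E hV D s) = D (coef hV l s) := by
  conv_rhs => rw [coef_eq_sum]
  rw [map_sum]
  simp only [derivation_smul]
  exact coef_sum hV l _ _ _

/-- Multiplication of the exterior algebra has constant structure constants in the trivialization,
so the ordinary Leibniz rule for D on coefficients suffices. -/
theorem evenExt_mul {x₀ : M} {V : Opens M} (hV : V ≤ trivDom F E x₀)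
    (D : Derivation ℝ (Smooth 𝓘(ℝ, H) V) (Smooth 𝓘(ℝ, H) V)) (s t : SuperFun H F E V) :
    evenExt E hV D (s * t) = evenExt E hV D s * t + s * evenExt E hV D t := by
  refine superFun_ext hV fun l => ?_
  simp only [coef_evenExt, map_add, coef_mul, map_sum, derivation_smul,
    Derivation.leibniz, smul_eq_mul,
    ← Finset.sum_add_distrib, ← smul_add]
  refine Finset.sum_congr rfl fun i _ => Finset.sum_congr rfl fun j _ => ?_
  congr 1
  ring

theorem evenExt_mem_superParity {x₀ : M} {V : Opens M} (hV : V ≤ trivDom F E x₀)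
    (D : Derivation ℝ (Smooth 𝓘(ℝ, H) V) (Smooth 𝓘(ℝ, H) V)) {c : ZMod 2}
    {s : SuperFun H F E V} (hs : s ∈ superParity H F E c V) :
    evenExt E hV D s ∈ superParity H F E c V := by
  rw [mem_superParity_iff_localRep hV] at hs ⊢
  intro x
  by_contra hx
  -- If the value left the subspace of parity c, a linear form vanishing on that subspace would
  -- detect it. But the corresponding coefficient of s is identically zero, hence so is its image
  -- under D.
  obtain ⟨l, hl, hker⟩ := Submodule.exists_le_ker_of_notMem hx
  have h0 : coef hV l s = 0 := by
    ext y
    exact hker (hs y)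
  apply hl
  have h1 := DFunLike.congr_fun (coef_evenExt hV D l s) x
  rw [h0, map_zero] at h1
  exact h1

variable (E) in
/-- The extension of a linear endomorphism of the exterior algebra to superfunctions, in a
trivialization. -/
def fibreExt {x₀ : M} {V : Opens M} (hV : V ≤ trivDom F E x₀)
    (T : ExteriorAlgebra ℝ (Module.Dual ℝ F) →ₗ[ℝ] ExteriorAlgebra ℝ (Module.Dual ℝ F)) :
    SuperFun H F E V →ₗ[ℝ] SuperFun H F E V where
  toFun s := ∑ k, ofSmooth F E (coef hV ((extBasis F).coord k) s) *
    constSuper H E hV (T (extBasis F k))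
  map_add' s t := by
    refine superFun_ext hV fun l => ?_
    simp only [map_add, coef_sum, smul_add, Finset.sum_add_distrib]
  map_smul' r s := by
    refine superFun_ext hV fun l => ?_
    rw [RingHom.id_apply, map_smul, coef_sum, coef_sum, Finset.smul_sum]
    refine Finset.sum_congr rfl fun k _ => ?_
    rw [map_smul, smul_comm]

theorem coef_fibreExt {x₀ : M} {V : Opens M} (hV : V ≤ trivDom F E x₀)
    (T : ExteriorAlgebra ℝ (Module.Dual ℝ F) →ₗ[ℝ] ExteriorAlgebra ℝ (Module.Dual ℝ F))
    (l : Module.Dual ℝ (ExteriorAlgebra ℝ (Module.Dual ℝ F))) (s : SuperFun H F E V) :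
    coef hV l (fibreExt E hV T s) = coef hV (l ∘ₗ T) s := by
  conv_rhs => rw [coef_eq_sum]
  exact coef_sum hV l _ _ _

theorem localRep_fibreExt {x₀ : M} {V : Opens M} (hV : V ≤ trivDom F E x₀)
    (T : ExteriorAlgebra ℝ (Module.Dual ℝ F) →ₗ[ℝ] ExteriorAlgebra ℝ (Module.Dual ℝ F))
    (s : SuperFun H F E V) (x : V) :
    localRep F E x₀ x ((fibreExt E hV T s).1 x) = T (localRep F E x₀ x (s.1 x)) := by
  rw [← sub_eq_zero, ← Module.forall_dual_apply_eq_zero_iff ℝ]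
  intro l
  rw [map_sub, sub_eq_zero]
  exact DFunLike.congr_fun (coef_fibreExt hV T l s) x

theorem superFun_ext_localRep {x₀ : M} {V : Opens M} (hV : V ≤ trivDom F E x₀)
    {s t : SuperFun H F E V}
    (h : ∀ x : V, localRep F E x₀ x (s.1 x) = localRep F E x₀ x (t.1 x)) : s = t :=
  Subtype.ext (funext fun x => by
    rw [← localInv_localRep (hV x.2) (s.1 x), h, localInv_localRep (hV x.2)])

variable (E) in
/-- The even superderivation defined by a section of the sheaf of derivations of the base. -/
def evenSuperDer {x₀ : M} {U : Opens M} (hU : U ≤ trivDom F E x₀) (D : DerSection 𝓘(ℝ, H) U) :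
    SuperDer H F E 0 U where
  act V hV := evenExt E (hV.trans hU) (D.act V hV)
  act_res V W hV h s := by
    refine superFun_ext (h.trans (hV.trans hU)) fun l => ?_
    rw [coef_evenExt]
    refine (congrArg (resSmooth 𝓘(ℝ, H) h) (coef_evenExt (hV.trans hU) (D.act V hV) l s)).trans ?_
    exact D.act_res V W hV h _
  parity V hV c s hs := by
    rw [zero_add]
    exact evenExt_mem_superParity _ _ hs
  leibniz V hV c s t _ := by
    rw [evenExt_mul, zero_mul, sgn, if_pos rfl, one_smul]

variable (H E) in
/-- The odd superderivation given by contraction with a constant vector. -/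
def oddSuperDer {x₀ : M} {U : Opens M} (hU : U ≤ trivDom F E x₀)
    (d : Module.Dual ℝ (Module.Dual ℝ F)) : SuperDer H F E 1 U where
  act V hV := fibreExt E (hV.trans hU) (CliffordAlgebra.contractLeft d)
  act_res V W hV h s := by
    refine superFun_ext_localRep (h.trans (hV.trans hU)) fun x => ?_
    rw [localRep_fibreExt]
    exact localRep_fibreExt (hV.trans hU) _ s ⟨x.1, h x.2⟩
  parity V hV c s hs := by
    rw [mem_superParity_iff_localRep (hV.trans hU)] at hs ⊢
    intro x
    rw [localRep_fibreExt]
    exact contractLeft_mem_extParity d (hs x)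
  leibniz V hV c s t hs := by
    refine superFun_ext_localRep (hV.trans hU) fun x => ?_
    rw [mem_superParity_iff_localRep (hV.trans hU)] at hs
    rw [localRep_fibreExt]
    change CliffordAlgebra.contractLeft d (localRep F E x₀ x (s.1 x * t.1 x)) =
      localRep F E x₀ x ((fibreExt E (hV.trans hU) _ s).1 x * t.1 x +
        sgn (1 * c) • (s.1 x * (fibreExt E (hV.trans hU) _ t).1 x))
    rw [map_mul, contractLeft_mul_of_mem d (hs x), map_add, map_smul, map_mul, map_mul,
      localRep_fibreExt, localRep_fibreExt]

theorem evenExt_ofSmooth {x₀ : M} {V : Opens M} (hV : V ≤ trivDom F E x₀)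
    (D : Derivation ℝ (Smooth 𝓘(ℝ, H) V) (Smooth 𝓘(ℝ, H) V)) (f : Smooth 𝓘(ℝ, H) V) :
    evenExt E hV D (ofSmooth F E f) = ofSmooth F E (D f) := by
  refine superFun_ext hV fun l => ?_
  rw [coef_evenExt, coef_ofSmooth, coef_ofSmooth, derivation_smul]

theorem evenExt_const {x₀ : M} {V : Opens M} (hV : V ≤ trivDom F E x₀)
    (D : Derivation ℝ (Smooth 𝓘(ℝ, H) V) (Smooth 𝓘(ℝ, H) V))
    (u : ExteriorAlgebra ℝ (Module.Dual ℝ F)) :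
    evenExt E hV D (constSuper H E hV u) = 0 := by
  refine superFun_ext hV fun l => ?_
  have h := coef_ofSmooth_mul_const (H := H) (E := E) hV l 1 u
  rw [ofSmooth_one, one_mul] at h
  rw [coef_evenExt, h, derivation_smul, Derivation.map_one_eq_zero, smul_zero, map_zero]

theorem fibreExt_ofSmooth_mul_const {x₀ : M} {V : Opens M} (hV : V ≤ trivDom F E x₀)
    (T : ExteriorAlgebra ℝ (Module.Dual ℝ F) →ₗ[ℝ] ExteriorAlgebra ℝ (Module.Dual ℝ F))
    (f : Smooth 𝓘(ℝ, H) V) (u : ExteriorAlgebra ℝ (Module.Dual ℝ F)) :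
    fibreExt E hV T (ofSmooth F E f * constSuper H E hV u) =
      ofSmooth F E f * constSuper H E hV (T u) := by
  refine superFun_ext hV fun l => ?_
  rw [coef_fibreExt, coef_ofSmooth_mul_const, coef_ofSmooth_mul_const]
  rfl

theorem oddSuperDer_ofSmooth {x₀ : M} {U V : Opens M} (hU : U ≤ trivDom F E x₀)
    (d : Module.Dual ℝ (Module.Dual ℝ F)) (hV : V ≤ U) (f : Smooth 𝓘(ℝ, H) V) :
    (oddSuperDer H E hU d).act V hV (ofSmooth F E f) = 0 := by
  have h := fibreExt_ofSmooth_mul_const (E := E) (hV.trans hU) (CliffordAlgebra.contractLeft d) f 1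
  rw [map_one, mul_one, CliffordAlgebra.contractLeft_one, map_zero, mul_zero] at h
  exact h

theorem oddSuperDer_const {x₀ : M} {U V : Opens M} (hU : U ≤ trivDom F E x₀)
    (d : Module.Dual ℝ (Module.Dual ℝ F)) (hV : V ≤ U) (w : Module.Dual ℝ F) :
    (oddSuperDer H E hU d).act V hV (constSuper H E (hV.trans hU) (ExteriorAlgebra.ι ℝ w)) =
      algebraMap ℝ _ (d w) := by
  have h := fibreExt_ofSmooth_mul_const (E := E) (H := H) (hV.trans hU)
    (CliffordAlgebra.contractLeft d) 1 (ExteriorAlgebra.ι ℝ w)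
  have h2 : CliffordAlgebra.contractLeft d (ExteriorAlgebra.ι ℝ w) =
    algebraMap ℝ (ExteriorAlgebra ℝ (Module.Dual ℝ F)) (d w) :=
    CliffordAlgebra.contractLeft_ι (Q := 0) d w
  rw [h2, ofSmooth_one, one_mul, one_mul, AlgHom.commutes] at h
  exact h

end Super

section Super

set_option linter.unusedSectionVars false

variable {H : Type*} [NormedAddCommGroup H] [NormedSpace ℝ H]
  {M : Type*} [TopologicalSpace M] [ChartedSpace H M] [IsManifold 𝓘(ℝ, H) ∞ M]
  {F : Type*} [NormedAddCommGroup F] [NormedSpace ℝ F] [FiniteDimensional ℝ F]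
  {E : M → Type*} [TopologicalSpace (TotalSpace F E)]
  [∀ x, AddCommGroup (E x)] [∀ x, Module ℝ (E x)] [∀ x, TopologicalSpace (E x)]
  [FiberBundle F E] [VectorBundle ℝ F E] [ContMDiffVectorBundle ∞ F E 𝓘(ℝ, H)]

/-! ### Coordinate frames -/

variable (H F E) in
/-- The domain of the coordinate frame around `x₀`. -/
def frameDom (x₀ : M) : Opens M := chartDom H x₀ ⊓ trivDom F E x₀

variable (F E) in
/-- The point of the zero section over `x₀`. -/
def zeroPoint (x₀ : M) : TotalSpace F E := ⟨x₀, 0⟩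

/-- One chart of E, centred on the zero section, covers the whole preimage of the frame domain,
since trivializations are global along fibres. -/
theorem preim_le_chartDom {x₀ : M} {U : Opens M} (hU : U ≤ frameDom H F E x₀) :
    preim F E U ≤ chartDom (ModelProd H F) (zeroPoint F E x₀) := by
  intro e he
  have h := hU he
  change e ∈ (chartAt (ModelProd H F) (zeroPoint F E x₀)).source
  rw [FiberBundle.chartedSpace_chartAt]
  simp only [mfld_simps]
  exact ⟨(trivializationAt F E x₀).mem_source.2 h.2, by
    change (trivializationAt F E x₀ e).1 ∈ (chartAt H x₀).source
    rw [(trivializationAt F E x₀).coe_fst' h.2]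
    exact h.1⟩

theorem extChartAt_zeroPoint {x₀ : M} {e : TotalSpace F E} (he : e.proj ∈ trivDom F E x₀) :
    extChartAt (𝓘(ℝ, H).prod 𝓘(ℝ, F)) (zeroPoint F E x₀) e =
      (extChartAt 𝓘(ℝ, H) x₀ e.proj, (trivializationAt F E x₀ e).2) := by
  rw [FiberBundle.extChartAt]
  change (extChartAt 𝓘(ℝ, H) x₀ (trivializationAt F E x₀ e).1, (trivializationAt F E x₀ e).2) = _
  rw [(trivializationAt F E x₀).coe_fst' he]

theorem psi_ofSmooth_mk {V : Opens M} (f : Smooth 𝓘(ℝ, H) V) (x : V) (v : E (x : M)) :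
    psi (ofSmooth F E f) ⟨⟨x.1, v⟩, x.2⟩ = f x := by
  rw [← body_eq_psi_of_even (ofSmooth_mem_superParity f), body_mk]
  exact algebraMapInv_algebraMap _

theorem psi_constSuper_mk {x₀ : M} {V : Opens M} (hV : V ≤ trivDom F E x₀) (w : Module.Dual ℝ F)
    (x : V) (v : E (x : M)) :
    psi (constSuper H E hV (ExteriorAlgebra.ι ℝ w)) ⟨⟨x.1, v⟩, x.2⟩ =
      w (trivializationAt F E x₀ ⟨x.1, v⟩).2 := by
  have h : (constSuper H E hV (ExteriorAlgebra.ι ℝ w)).1 x = ExteriorAlgebra.ι ℝ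
      (((trivializationAt F E x₀).linearMapAt ℝ x).dualMap w) :=
    ExteriorAlgebra.map_apply_ι _ _
  rw [psi_mk, h, algebraMapInv_ι, ιInv_ι, zero_add, LinearMap.dualMap_apply,
    Trivialization.coe_linearMapAt_of_mem _ (hV x.2)]

theorem psi_ofSmooth_coordFun {x₀ : M} {V : Opens M} (hV : V ≤ frameDom H F E x₀)
    (l : H →L[ℝ] ℝ) :
    psi (ofSmooth F E (coordFun 𝓘(ℝ, H) x₀ l (hV.trans inf_le_left))) =
      coordFun (𝓘(ℝ, H).prod 𝓘(ℝ, F)) (zeroPoint F E x₀)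
        (l.comp (ContinuousLinearMap.fst ℝ H F)) (preim_le_chartDom hV) := by
  refine smooth_preim_ext fun x v => ?_
  rw [psi_ofSmooth_mk]
  change _ = l (extChartAt (𝓘(ℝ, H).prod 𝓘(ℝ, F)) (zeroPoint F E x₀) ⟨x.1, v⟩).1
  rw [extChartAt_zeroPoint (hV x.2).2]
  rfl

theorem psi_constSuper {x₀ : M} {V : Opens M} (hV : V ≤ frameDom H F E x₀)
    (w : Module.Dual ℝ F) :
    psi (constSuper H E (hV.trans inf_le_right) (ExteriorAlgebra.ι ℝ w)) =
      coordFun (𝓘(ℝ, H).prod 𝓘(ℝ, F)) (zeroPoint F E x₀)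
        ((LinearMap.toContinuousLinearMap w).comp (ContinuousLinearMap.snd ℝ H F))
        (preim_le_chartDom hV) := by
  refine smooth_preim_ext fun x v => ?_
  rw [psi_constSuper_mk]
  change _ = w (extChartAt (𝓘(ℝ, H).prod 𝓘(ℝ, F)) (zeroPoint F E x₀) ⟨x.1, v⟩).2
  rw [extChartAt_zeroPoint (hV x.2).2]

/-- In the product chart a function pulled back from the base depends only on the first coordinate,
so the chain rule for the first projection applies. -/
theorem coordDeriv_psi_ofSmooth {x₀ : M} {V : Opens M} (hV : V ≤ frameDom H F E x₀)
    (v : H × F) (f : Smooth 𝓘(ℝ, H) V) :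
    coordDeriv (zeroPoint F E x₀) v (preim_le_chartDom hV) (psi (ofSmooth F E f)) =
      psi (ofSmooth F E (coordDeriv x₀ v.1 (hV.trans inf_le_left) f)) := by
  refine smooth_preim_ext fun x w => ?_
  have hx : extChartAt (𝓘(ℝ, H).prod 𝓘(ℝ, F)) (zeroPoint F E x₀) ⟨x.1, w⟩ =
      (extChartAt 𝓘(ℝ, H) x₀ x, (trivializationAt F E x₀ ⟨x.1, w⟩).2) :=
    extChartAt_zeroPoint (hV x.2).2
  rw [psi_ofSmooth_mk, coordDeriv_apply_of_eq v (preim_le_chartDom hV)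
    (G := fun p => chartRep 𝓘(ℝ, H) x₀ f p.1), coordDeriv_apply]
  · change fderiv ℝ _ (extChartAt (𝓘(ℝ, H).prod 𝓘(ℝ, F)) (zeroPoint F E x₀) ⟨x.1, w⟩) v = _
    rw [hx]
    have hd := (chartRep_contDiffAt_apply (hV.trans inf_le_left) f x).differentiableAt (by simp)
    have h1 : HasFDerivAt (fun p : H × F => chartRep 𝓘(ℝ, H) x₀ f p.1)
        ((fderiv ℝ (chartRep 𝓘(ℝ, H) x₀ f) (extChartAt 𝓘(ℝ, H) x₀ x)).comp
          (ContinuousLinearMap.fst ℝ H F))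
        (extChartAt 𝓘(ℝ, H) x₀ x, (trivializationAt F E x₀ ⟨x.1, w⟩).2) :=
      HasFDerivAt.comp (g := chartRep 𝓘(ℝ, H) x₀ f) (f := Prod.fst) _ hd.hasFDerivAt hasFDerivAt_fst
    rw [h1.fderiv]
    rfl
  · refine Filter.Eventually.of_forall ?_
    rintro p z rfl
    rw [extChartAt_zeroPoint (hV z.2).2]
    exact (psi_ofSmooth_mk f (baseOf z) z.1.2).trans
      (chartRep_apply (hV.trans inf_le_left) f (baseOf z)).symm

/-- The fibre part is expanded in the dual basis of `bF`; the coefficient functional is the linear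
part evaluated at a basis vector. This reduces questions about `AffineSuper` to functions of the
base and the ξ_a. -/
theorem affineSuper_eq_sum {κ : Type*} [Fintype κ] (bF : Module.Basis κ ℝ F) {x₀ : M} {V : Opens M}
    (hV : V ≤ trivDom F E x₀) {s : SuperFun H F E V} (hs : s ∈ AffineSuper H F E V) :
    s = ofSmooth F E (reduced s) + ∑ a, ofSmooth F E
      (coef hV ((LinearMap.applyₗ (bF a)).comp ExteriorAlgebra.ιInv) s) *
        constSuper H E hV (ExteriorAlgebra.ι ℝ (bF.coord a)) := by
  refine superFun_ext hV fun l => ?_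
  rw [map_add, coef_sum, coef_ofSmooth]
  ext x
  obtain ⟨r, w, hx⟩ := hs x
  change l (localRep F E x₀ x (s.1 x)) =
    l 1 * ExteriorAlgebra.algebraMapInv (s.1 x) + (∑ a, _ : Smooth 𝓘(ℝ, H) V) x
  rw [smooth_sum_apply]
  change _ = _ + ∑ a, l (ExteriorAlgebra.ι ℝ (bF.coord a)) *
    (ExteriorAlgebra.ιInv (localRep F E x₀ x (s.1 x))) (bF a)
  have h1 : localRep F E x₀ x (s.1 x) = algebraMap ℝ _ r +
      ExteriorAlgebra.ι ℝ (((trivializationAt F E x₀).symmₗ ℝ x).dualMap w) := by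
    rw [hx, map_add, AlgHom.commutes]
    exact congrArg _ (ExteriorAlgebra.map_apply_ι _ _)
  generalize ((trivializationAt F E x₀).symmₗ ℝ x).dualMap w = w' at h1
  have h2 : w' = ∑ a, w' (bF a) • bF.coord a := by
    refine bF.ext fun a => ?_
    classical
    simp
  rw [h1, hx, map_add, map_add, map_add, algebraMapInv_ι, algebraMapInv_algebraMap, ιInv_ι,
    ιInv_algebraMap, zero_add, add_zero, Algebra.algebraMap_eq_smul_one, map_smul, smul_eq_mul,
    mul_comm r]
  congr 1
  conv_lhs => rw [h2]
  simp only [map_sum, map_smul, smul_eq_mul, mul_comm]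

/-- A criterion for the relation `Ψ` in terms of the action on functions of the base and on fibre
coordinates. -/
theorem isPsi_of_coord {κ : Type*} [Fintype κ] (bF : Module.Basis κ ℝ F) {x₀ : M} {U : Opens M}
    (hU : U ≤ trivDom F E x₀) {a : ZMod 2} {X : SuperDer H F E a U}
    {X' : DerSection (𝓘(ℝ, H).prod 𝓘(ℝ, F)) (preim F E U)}
    (h1 : ∀ (V : Opens M) (hV : V ≤ U) (f : Smooth 𝓘(ℝ, H) V), ∃ f' : Smooth 𝓘(ℝ, H) V,
      X.act V hV (ofSmooth F E f) = ofSmooth F E f' ∧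
      X'.act (preim F E V) (preim_mono hV) (psi (ofSmooth F E f)) = psi (ofSmooth F E f'))
    (h2 : ∀ (V : Opens M) (hV : V ≤ U) (k : κ), ∃ f' : Smooth 𝓘(ℝ, H) V,
      X.act V hV (constSuper H E (hV.trans hU) (ExteriorAlgebra.ι ℝ (bF.coord k))) =
        ofSmooth F E f' ∧
      X'.act (preim F E V) (preim_mono hV)
        (psi (constSuper H E (hV.trans hU) (ExteriorAlgebra.ι ℝ (bF.coord k)))) =
        psi (ofSmooth F E f')) : IsPsi X X' := by
  -- On a product fξ_k both sides obey the Leibniz rule without sign because f is even, and each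
  -- term has an even factor, so ψ is multiplicative.
  have hmul : ∀ (V : Opens M) (hV : V ≤ U) (f : Smooth 𝓘(ℝ, H) V) (k : κ),
      X.act V hV (ofSmooth F E f *
          constSuper H E (hV.trans hU) (ExteriorAlgebra.ι ℝ (bF.coord k))) ∈ AffineSuper H F E V ∧
      X'.act (preim F E V) (preim_mono hV) (psi (ofSmooth F E f *
          constSuper H E (hV.trans hU) (ExteriorAlgebra.ι ℝ (bF.coord k)))) =
        psi (X.act V hV (ofSmooth F E f *
          constSuper H E (hV.trans hU) (ExteriorAlgebra.ι ℝ (bF.coord k)))) := by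
    intro V hV f k
    obtain ⟨f', hf, hf'⟩ := h1 V hV f
    obtain ⟨k', hk, hk'⟩ := h2 V hV k
    have hξ : constSuper H E (hV.trans hU) (ExteriorAlgebra.ι ℝ (bF.coord k)) ∈
        AffineSuper H F E V := fun x => ⟨0, _, by
      rw [map_zero, zero_add]
      exact ExteriorAlgebra.map_apply_ι _ _⟩
    rw [X.leibniz V hV 0 _ _ (ofSmooth_mem_superParity f), hf, hk, mul_zero, sgn, if_pos rfl,
      one_smul]
    refine ⟨AffineSuper.add
      (AffineSuper.mul_of_even (ofSmooth_mem_affineSuper _) (ofSmooth_mem_superParity _) hξ)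
      (AffineSuper.mul_of_even (ofSmooth_mem_affineSuper _) (ofSmooth_mem_superParity _)
        (ofSmooth_mem_affineSuper _)), ?_⟩
    rw [psi_mul_of_even (ofSmooth_mem_superParity _), Derivation.leibniz, hf', hk', psi_add,
      psi_mul_of_even (ofSmooth_mem_superParity _), psi_mul_of_even (ofSmooth_mem_superParity _),
      smul_eq_mul, smul_eq_mul]
    ring
  have hsum : ∀ {V : Opens M} (t : Finset κ) (q : κ → SuperFun H F E V),
      (∀ k, q k ∈ AffineSuper H F E V) → ∑ k ∈ t, q k ∈ AffineSuper H F E V := by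
    intro V t q hq
    classical
    induction t using Finset.induction_on with
    | empty => exact fun x => ⟨0, 0, by simp⟩
    | insert k t hk ih =>
      rw [Finset.sum_insert hk]
      exact AffineSuper.add (hq k) ih
  refine ⟨fun V hV s hs => ?_, fun V hV s hs => ?_⟩
  · rw [affineSuper_eq_sum bF (hV.trans hU) hs, map_add, map_sum]
    obtain ⟨f', hf, -⟩ := h1 V hV (reduced s)
    refine AffineSuper.add ?_ (hsum _ _ fun k => (hmul V hV _ k).1)
    rw [hf]
    exact ofSmooth_mem_affineSuper _
  · rw [affineSuper_eq_sum bF (hV.trans hU) hs, map_add, map_sum, psi_add, psi_add, psi_sum,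
      psi_sum, map_add, map_sum]
    obtain ⟨f', hf, hf'⟩ := h1 V hV (reduced s)
    rw [hf, hf']
    congr 1
    exact Finset.sum_congr rfl fun k _ => (hmul V hV _ k).2

/-! ### Even superderivations are determined by coordinates. -/

theorem ofSmooth_add {V : Opens M} (f k : Smooth 𝓘(ℝ, H) V) :
    ofSmooth F E (f + k) = ofSmooth F E f + ofSmooth F E k :=
  Subtype.ext (funext fun _ => map_add _ _ _)

theorem ofSmooth_mul {V : Opens M} (f k : Smooth 𝓘(ℝ, H) V) :
    ofSmooth F E (f * k) = ofSmooth F E f * ofSmooth F E k :=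
  Subtype.ext (funext fun _ => map_mul _ _ _)

theorem ofSmooth_algebraMap {V : Opens M} (r : ℝ) :
    ofSmooth F E (algebraMap ℝ (Smooth 𝓘(ℝ, H) V) r) = algebraMap ℝ _ r := rfl

variable (H F E) in
/-- The embedding of functions into superfunctions as a linear map. -/
def ofSmoothₗ (V : Opens M) : Smooth 𝓘(ℝ, H) V →ₗ[ℝ] SuperFun H F E V where
  toFun := ofSmooth F E
  map_add' := ofSmooth_add
  map_smul' r f := Subtype.ext (funext fun x => by
    change algebraMap ℝ (ExtFib E (x : M)) (r * f x) = r • algebraMap ℝ (ExtFib E (x : M)) (f x)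
    rw [map_mul, Algebra.smul_def])

theorem SuperDer.act_algebraMap {a : ZMod 2} {U V : Opens M} (X : SuperDer H F E a U) (hV : V ≤ U)
    (r : ℝ) : X.act V hV (algebraMap ℝ _ r) = 0 := by
  rw [Algebra.algebraMap_eq_smul_one, map_smul, X.act_one, smul_zero]

theorem exteriorAlgebra_left_induction {N : Type*} [AddCommGroup N] [Module ℝ N]
    {P : ExteriorAlgebra ℝ N → Prop} (h0 : ∀ r, P (algebraMap ℝ _ r))
    (hadd : ∀ x y, P x → P y → P (x + y))
    (hmul : ∀ n x, P x → P (ExteriorAlgebra.ι ℝ n * x)) (x : ExteriorAlgebra ℝ N) : P x :=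
  CliffordAlgebra.left_induction (0 : QuadraticForm ℝ N) (P := P) h0 hadd
    (fun x n h => hmul n x h) x

/-- Superderivations kill scalars and satisfy the Leibniz rule, so agreement on generators
propagates through left multiplication by generators. -/
theorem SuperDer.act_const_eq {x₀ : M} {V W : Opens M} {X Y : SuperDer H F E 0 V} (hW : W ≤ V)
    (hW' : W ≤ trivDom F E x₀)
    (hι : ∀ w : Module.Dual ℝ F,
      X.act W hW (constSuper H E hW' (ExteriorAlgebra.ι ℝ w)) =
      Y.act W hW (constSuper H E hW' (ExteriorAlgebra.ι ℝ w)))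
    (u : ExteriorAlgebra ℝ (Module.Dual ℝ F)) :
    X.act W hW (constSuper H E hW' u) = Y.act W hW (constSuper H E hW' u) := by
  refine exteriorAlgebra_left_induction (P := fun u =>
    X.act W hW (constSuper H E hW' u) = Y.act W hW (constSuper H E hW' u))
    (fun r => ?_) (fun x y hx hy => ?_) (fun n x hx => ?_) u
  · have h : constSuper H E hW' (algebraMap ℝ (ExteriorAlgebra ℝ (Module.Dual ℝ F)) r) =
        algebraMap ℝ _ r := AlgHom.commutes _ _
    exact (congrArg _ h).trans ((X.act_algebraMap hW r).trans
      ((Y.act_algebraMap hW r).symm.trans (congrArg _ h.symm)))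
  · have h := map_add (constSuper H E hW') x y
    rw [h, map_add, map_add, hx, hy]
  · have hm : constSuper H E hW' (ExteriorAlgebra.ι ℝ n) ∈
      superParity H F E 1 W := constSuper_mem_superParity _ (ι_mem_extParity n)
    have h := map_mul (constSuper H E hW') (ExteriorAlgebra.ι ℝ n) x
    have hn := hι n
    generalize constSuper H E hW' (ExteriorAlgebra.ι ℝ n * x) = q at h ⊢
    generalize constSuper H E hW' (ExteriorAlgebra.ι ℝ n) = s at *
    generalize constSuper H E hW' x = t at *
    subst h
    exact (X.leibniz W hW 1 s t hm).trans (Eq.trans (by rw [hx, hn])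
      (Y.leibniz W hW 1 s t hm).symm)

/-- Even superderivations are determined by their values on the coordinates. -/
theorem superDer_ext [FiniteDimensional ℝ H] {ι κ : Type*} [Fintype ι] [Fintype κ]
    (bH : Module.Basis ι ℝ H) (bF : Module.Basis κ ℝ F) {x₀ : M} {V : Opens M}
    (hV : V ≤ frameDom H F E x₀) {X Y : SuperDer H F E 0 V}
    (h1 : ∀ i, X.act V le_rfl (ofSmooth F E (coordFun 𝓘(ℝ, H) x₀
        (LinearMap.toContinuousLinearMap (bH.coord i)) (hV.trans inf_le_left))) =
      Y.act V le_rfl (ofSmooth F E (coordFun 𝓘(ℝ, H) x₀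
        (LinearMap.toContinuousLinearMap (bH.coord i)) (hV.trans inf_le_left))))
    (h2 : ∀ k, X.act V le_rfl (constSuper H E (hV.trans inf_le_right)
        (ExteriorAlgebra.ι ℝ (bF.coord k))) =
      Y.act V le_rfl (constSuper H E (hV.trans inf_le_right)
        (ExteriorAlgebra.ι ℝ (bF.coord k)))) : X = Y := by
  have hsmooth : ∀ (W : Opens M) (hW : W ≤ V) (f : Smooth 𝓘(ℝ, H) W),
      X.act W hW (ofSmooth F E f) = Y.act W hW (ofSmooth F E f) := by
    intro W hW f
    refine Subtype.ext (funext fun y => ?_)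
    obtain ⟨W', h', hy, k, hk⟩ :=
      exists_hadamard_manifold bH (hW.trans (hV.trans inf_le_left)) f y
    -- The same Hadamard argument as for ordinary derivations, now evaluated in the fibre of the
    -- exterior bundle at y, where the values on coordinates need not be scalars.
    have hval : ∀ Z : SuperDer H F E 0 V, (Z.act W hW (ofSmooth F E f)).1 y =
        ∑ i, (Z.act V le_rfl (ofSmooth F E (coordFun 𝓘(ℝ, H) x₀
          (LinearMap.toContinuousLinearMap (bH.coord i)) (hV.trans inf_le_left)))).1 ⟨y, hW y.2⟩ *
          (ofSmooth F E (k i)).1 ⟨y, hy⟩ := by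
      intro Z
      have e1 : (Z.act W hW (ofSmooth F E f)).1 y =
          (Z.act W' (h'.trans hW) (ofSmooth F E (resSmooth _ h' f))).1 ⟨y, hy⟩ :=
        congrFun (congrArg Subtype.val (Z.act_res W W' hW h' (ofSmooth F E f))) ⟨y, hy⟩
      have e2 : ∀ i, (Z.act W' (h'.trans hW) (ofSmooth F E
          ((coordFun 𝓘(ℝ, H) x₀ (LinearMap.toContinuousLinearMap (bH.coord i))
            (h'.trans (hW.trans (hV.trans inf_le_left))) -
            algebraMap ℝ _ (bH.coord i (extChartAt 𝓘(ℝ, H) x₀ y))) * k i))).1 ⟨y, hy⟩ =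
          (Z.act V le_rfl (ofSmooth F E (coordFun 𝓘(ℝ, H) x₀
            (LinearMap.toContinuousLinearMap (bH.coord i))
            (hV.trans inf_le_left)))).1 ⟨y, hW y.2⟩ * (ofSmooth F E (k i)).1 ⟨y, hy⟩ := by
        intro i
        have e3 := congrFun (congrArg Subtype.val (Z.act_res V W' le_rfl (h'.trans hW)
          (ofSmooth F E (coordFun 𝓘(ℝ, H) x₀ (LinearMap.toContinuousLinearMap (bH.coord i))
            (hV.trans inf_le_left))))) ⟨y, hy⟩
        have e4 : Z.act W' (h'.trans hW) (ofSmooth F E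
            (coordFun 𝓘(ℝ, H) x₀ (LinearMap.toContinuousLinearMap (bH.coord i))
              (h'.trans (hW.trans (hV.trans inf_le_left))) -
            algebraMap ℝ _ (bH.coord i (extChartAt 𝓘(ℝ, H) x₀ y)))) =
            Z.act W' (h'.trans hW) (ofSmooth F E
            (coordFun 𝓘(ℝ, H) x₀ (LinearMap.toContinuousLinearMap (bH.coord i))
              (h'.trans (hW.trans (hV.trans inf_le_left))))) := by
          have e5 := map_sub (ofSmoothₗ H F E W')
            (coordFun 𝓘(ℝ, H) x₀ (LinearMap.toContinuousLinearMap (bH.coord i))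
              (h'.trans (hW.trans (hV.trans inf_le_left))))
            (algebraMap ℝ _ (bH.coord i (extChartAt 𝓘(ℝ, H) x₀ y)))
          refine (congrArg _ e5).trans ?_
          rw [map_sub]
          refine (congrArg _ (Z.act_algebraMap (h'.trans hW) _)).trans (sub_zero _)
        have e6 : (ofSmooth F E
            (coordFun 𝓘(ℝ, H) x₀ (LinearMap.toContinuousLinearMap (bH.coord i))
              (h'.trans (hW.trans (hV.trans inf_le_left))) -
            algebraMap ℝ _ (bH.coord i (extChartAt 𝓘(ℝ, H) x₀ y)))).1 (⟨y, hy⟩ : W') = 0 := by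
          change algebraMap ℝ (ExtFib E (y : M)) (_ - _) = 0
          rw [← map_zero (algebraMap ℝ (ExtFib E (y : M)))]
          exact congrArg _ (sub_self _)
        rw [ofSmooth_mul, Z.leibniz W' (h'.trans hW) 0 _ _ (ofSmooth_mem_superParity _), e4]
        change _ * _ + sgn (0 * 0) • ((ofSmooth F E _).1 (⟨y, hy⟩ : W') * _) = _
        rw [e6, zero_mul, zero_mul, smul_zero, add_zero]
        exact congrArg (· * _) e3.symm
      rw [e1, hk, ofSmooth_add, map_add, ofSmooth_algebraMap, Z.act_algebraMap, zero_add]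
      have e7 := map_sum (ofSmoothₗ H F E W') (fun i =>
        (coordFun 𝓘(ℝ, H) x₀ (LinearMap.toContinuousLinearMap (bH.coord i))
            (h'.trans (hW.trans (hV.trans inf_le_left))) -
            algebraMap ℝ _ (bH.coord i (extChartAt 𝓘(ℝ, H) x₀ y))) * k i) Finset.univ
      rw [show ofSmooth F E _ = _ from e7, map_sum]
      refine Eq.trans ?_ (Finset.sum_congr rfl fun i _ => e2 i)
      rw [AddSubmonoidClass.coe_finsetSum, Finset.sum_apply]
      rfl
    rw [hval X, hval Y]
    exact Finset.sum_congr rfl fun i _ => by rw [h1 i]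
  have hι : ∀ (W : Opens M) (hW : W ≤ V) (w : Module.Dual ℝ F),
      X.act W hW (constSuper H E (hW.trans (hV.trans inf_le_right)) (ExteriorAlgebra.ι ℝ w)) =
      Y.act W hW (constSuper H E (hW.trans (hV.trans inf_le_right)) (ExteriorAlgebra.ι ℝ w)) := by
    intro W hW w
    have hk : ∀ k, X.act W hW (constSuper H E (hW.trans (hV.trans inf_le_right))
        (ExteriorAlgebra.ι ℝ (bF.coord k))) =
        Y.act W hW (constSuper H E (hW.trans (hV.trans inf_le_right))
        (ExteriorAlgebra.ι ℝ (bF.coord k))) := fun k => by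
      have := congrArg (resSuper H F E hW) (h2 k)
      rwa [X.act_res, Y.act_res] at this
    have hw : w = ∑ k, w (bF k) • bF.coord k := by
      refine bF.ext fun a => ?_
      classical
      simp
    rw [hw]
    simp only [map_sum, map_smul, hk]
  have hconst : ∀ (W : Opens M) (hW : W ≤ V) (u : ExteriorAlgebra ℝ (Module.Dual ℝ F)),
      X.act W hW (constSuper H E (hW.trans (hV.trans inf_le_right)) u) =
      Y.act W hW (constSuper H E (hW.trans (hV.trans inf_le_right)) u) :=
    fun W hW u => SuperDer.act_const_eq hW (hW.trans (hV.trans inf_le_right)) (hι W hW) u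
  refine SuperDer.ext (funext fun W => funext fun hW => LinearMap.ext fun s => ?_)
  rw [super_eq_sum_const (hW.trans (hV.trans inf_le_right)) s, map_sum, map_sum]
  refine Finset.sum_congr rfl fun k _ => ?_
  rw [X.leibniz W hW 0 _ _ (ofSmooth_mem_superParity _),
    Y.leibniz W hW 0 _ _ (ofSmooth_mem_superParity _), hsmooth, hconst]

/-- The parities of the coordinates of a coordinate frame. -/
def coordParity (ι κ : Type*) : ι ⊕ κ → ZMod 2 := Sum.elim (fun _ => 0) (fun _ => 1)

section Frame

variable {ι κ : Type*} [Fintype ι] [Fintype κ] [DecidableEq ι] [DecidableEq κ]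
  (bH : Module.Basis ι ℝ H) (bF : Module.Basis κ ℝ F)
  {x₀ : M} {U : Opens M}

variable (E) in
/-- The coordinates of a coordinate frame. -/
def frameCoord [FiniteDimensional ℝ H] (hU : U ≤ frameDom H F E x₀) :
    ∀ m : ι ⊕ κ, superParity H F E (coordParity ι κ m) U
  | .inl i => ⟨ofSmooth F E (coordFun 𝓘(ℝ, H) x₀ (LinearMap.toContinuousLinearMap (bH.coord i))
      (hU.trans inf_le_left)), ofSmooth_mem_superParity _⟩
  | .inr a => ⟨constSuper H E (hU.trans inf_le_right) (ExteriorAlgebra.ι ℝ (bF.coord a)),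
      constSuper_mem_superParity _ (ι_mem_extParity _)⟩

variable (E) in
/-- The superderivations of a coordinate frame. -/
def frameDer (hU : U ≤ frameDom H F E x₀) :
    ∀ m : ι ⊕ κ, SuperDer H F E (coordParity ι κ m) U
  | .inl i => evenSuperDer E (hU.trans inf_le_right)
      (coordDer 𝓘(ℝ, H) x₀ (bH i) (hU.trans inf_le_left))
  | .inr a => oddSuperDer H E (hU.trans inf_le_right) (Module.Dual.eval ℝ F (bF a))

theorem psi_frameCoord [FiniteDimensional ℝ H] (hU : U ≤ frameDom H F E x₀) (m : ι ⊕ κ) :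
    psi (frameCoord E bH bF hU m).1 = coordFun (𝓘(ℝ, H).prod 𝓘(ℝ, F)) (zeroPoint F E x₀)
      (LinearMap.toContinuousLinearMap ((bH.prod bF).coord m)) (preim_le_chartDom hU) := by
  rcases m with i | a
  · refine (psi_ofSmooth_coordFun hU _).trans ?_
    congr 1
  · refine (psi_constSuper hU _).trans ?_
    congr 1

theorem frameDer_frameCoord [FiniteDimensional ℝ H] (hU : U ≤ frameDom H F E x₀) (m n : ι ⊕ κ) :
    (frameDer E bH bF hU m).act U le_rfl (frameCoord E bH bF hU n).1 = if m = n then 1 else 0 := by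
  rcases m with i | a <;> rcases n with j | b
  · refine (evenExt_ofSmooth _ _ _).trans ?_
    have h := coordDeriv_coordFun x₀ (bH i) (LinearMap.toContinuousLinearMap (bH.coord j))
      (J := 𝓘(ℝ, H)) (hU.trans inf_le_left)
    refine (congrArg (ofSmooth F E) h).trans ?_
    rw [ofSmooth_algebraMap]
    simp only [Sum.inl.injEq, LinearMap.coe_toContinuousLinearMap', Module.Basis.coord_apply,
      Module.Basis.repr_self, Finsupp.single_apply]
    split_ifs
    · exact map_one _
    · exact map_zero _
  · rw [if_neg (by simp)]
    exact evenExt_const _ _ _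
  · rw [if_neg (by simp)]
    exact oddSuperDer_ofSmooth (hU.trans inf_le_right) _ le_rfl _
  · refine (oddSuperDer_const (hU.trans inf_le_right) _ le_rfl _).trans ?_
    simp only [Sum.inr.injEq, Module.Dual.eval_apply, Module.Basis.coord_apply,
      Module.Basis.repr_self, Finsupp.single_apply]
    split_ifs
    · exact map_one _
    · exact map_zero _

/-- Checked by `isPsi_of_coord`: ∂/∂x_i differentiates functions of the base and kills each ξ_k,
while contraction with a basis vector kills functions of the base and sends ξ_k to a constant. The
coordinate derivations of E act in the same way on the images under ψ. -/
theorem isPsi_frameDer [FiniteDimensional ℝ H] (hU : U ≤ frameDom H F E x₀) (m : ι ⊕ κ) :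
    IsPsi (frameDer E bH bF hU m) (coordDer (𝓘(ℝ, H).prod 𝓘(ℝ, F)) (zeroPoint F E x₀)
      ((bH.prod bF) m) (preim_le_chartDom hU)) := by
  have hc : ∀ (V : Opens M) (hV : V ≤ U) (v : H × F) (k : κ),
      coordDeriv (zeroPoint F E x₀) v (preim_le_chartDom (hV.trans hU))
        (psi (constSuper H E ((hV.trans hU).trans inf_le_right)
          (ExteriorAlgebra.ι ℝ (bF.coord k)))) =
        algebraMap ℝ _ (bF.coord k v.2) := by
    intro V hV v k
    rw [psi_constSuper (hV.trans hU), coordDeriv_coordFun]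
    rfl
  have hz : ∀ (V : Opens M) (r : ℝ),
      psi (ofSmooth F E (algebraMap ℝ (Smooth 𝓘(ℝ, H) V) r)) = algebraMap ℝ _ r := fun V r =>
    smooth_preim_ext fun x v => psi_ofSmooth_mk _ x v
  rcases m with i | a
  · refine isPsi_of_coord bF (hU.trans inf_le_right) (fun V hV f => ?_) (fun V hV k => ?_)
    · refine ⟨coordDeriv x₀ (bH i) ((hV.trans hU).trans inf_le_left) f,
        evenExt_ofSmooth _ _ _, ?_⟩
      refine (coordDeriv_psi_ofSmooth (hV.trans hU) _ f).trans ?_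
      rw [Module.Basis.prod_apply_inl_fst]
    · refine ⟨algebraMap ℝ _ 0, ?_, (hc V hV _ k).trans ?_⟩
      · rw [map_zero, ofSmooth_zero]
        exact evenExt_const _ _ _
      · rw [hz, Module.Basis.prod_apply_inl_snd, map_zero]
  · refine isPsi_of_coord bF (hU.trans inf_le_right) (fun V hV f => ?_) (fun V hV k => ?_)
    · refine ⟨0, ?_, (coordDeriv_psi_ofSmooth (hV.trans hU) _ f).trans ?_⟩
      · rw [ofSmooth_zero]
        exact oddSuperDer_ofSmooth (hU.trans inf_le_right) _ hV f
      · rw [Module.Basis.prod_apply_inr_fst]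
        congr 2
        ext y
        rw [coordDeriv_apply, map_zero]
        rfl
    · refine ⟨algebraMap ℝ _ (bF.coord k (bF a)), oddSuperDer_const (hU.trans inf_le_right) _ hV _,
        (hc V hV _ k).trans ?_⟩
      rw [hz, Module.Basis.prod_apply_inr_snd]

variable (E) in
/-- The coordinate frame defined by a chart of the base and a trivialization of the bundle. -/
def coordFrame [FiniteDimensional ℝ H] (hU : U ≤ frameDom H F E x₀) :
    Frame H F E (coordParity ι κ) U where
  z := frameCoord E bH bF hU
  z_affine
    | .inl _ => ofSmooth_mem_affineSuper _
    | .inr _ => fun x => ⟨0, _, by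
        rw [map_zero, zero_add]
        exact ExteriorAlgebra.map_apply_ι _ _⟩
  dz := frameDer E bH bF hU
  dz' m := coordDer (𝓘(ℝ, H).prod 𝓘(ℝ, F)) (zeroPoint F E x₀) ((bH.prod bF) m)
    (preim_le_chartDom hU)
  isPsi := isPsi_frameDer bH bF hU
  dz_z := frameDer_frameCoord bH bF hU
  ext V hV X Y h := superDer_ext bH bF (hV.trans hU) (fun i => h (.inl i)) (fun a => h (.inr a))
  ext' V hV X Y h := by
    refine derSection_ext (bH.prod bF) (hV.trans (preim_le_chartDom hU)) fun m => ?_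
    have := h m
    rw [psi_frameCoord] at this
    exact this

end Frame

end Super

end SuperReduction

end

theorem proposition3p4
    {H : Type*} [NormedAddCommGroup H] [NormedSpace ℝ H] [FiniteDimensional ℝ H]
    {M : Type*} [TopologicalSpace M] [ChartedSpace H M] [IsManifold 𝓘(ℝ, H) ∞ M]
    [T2Space M] [SecondCountableTopology M]
    {F : Type*} [NormedAddCommGroup F] [NormedSpace ℝ F] [FiniteDimensional ℝ F]
    {E : M → Type*} [TopologicalSpace (TotalSpace F E)]
    [∀ x, AddCommGroup (E x)] [∀ x, Module ℝ (E x)] [∀ x, TopologicalSpace (E x)]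
    [FiberBundle F E] [VectorBundle ℝ F E] [ContMDiffVectorBundle ∞ F E 𝓘(ℝ, H)]
    (p : ZMod 2) (g : SuperReduction.RiemannianMetric H F E p) :
    ∃ B : SuperReduction.BilinearForm (𝓘(ℝ, H).prod 𝓘(ℝ, F)) (TotalSpace F E),
      B.IsSymm ∧
      SuperReduction.IsTransport g B ∧
      SuperReduction.IsExtendedByAuxiliary g B ∧
      ∀ B' : SuperReduction.BilinearForm (𝓘(ℝ, H).prod 𝓘(ℝ, F)) (TotalSpace F E),
        SuperReduction.IsTransport g B' → B' = B := by
  classical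
  -- Every open subset of a frame domain carries a coordinate frame with the same index set and
  -- parities, as the comparison on overlaps requires.
  exact SuperReduction.exists_transport (SuperReduction.frameDom H F E)
    (fun x => ⟨mem_chart_source H x, FiberBundle.mem_baseSet_trivializationAt' x⟩)
    (fun x U hU => ⟨SuperReduction.coordFrame E (Module.finBasis ℝ H) (Module.finBasis ℝ F) hU⟩) g
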